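/- A link is a disjoint union of finitely many simple closed polygons in $\mathbb{R}^3$. Two links are isotopic if they are related by a finite sequence of triangle moves and their inverses, where a triangle move replaces a segment $[u,w]\subset L$ by $[u,v]\cup[v,w]$ for a nondegenerate triangle $uvw$ that meets $L$ exactly in $[u,w]$. Project $\mathbb{R}^3$ to the plane by $(x,y,z)\mapsto(x,y)$. For $n\ge 2$, an $n$-crossing of the projection of a link is a point of the plane above which there are exactly $n$ points of the link, such that near each of these points the link is a straight strand and the projections of the $n$ strands have pairwise different directions (so that each strand bisects the crossing). A projection has only $n$-crossings if only finitely many points of the plane have at least two points of the link above them and each of these is an $n$-crossing. For a link $K$, let $c_n(K)\in\mathbb{N}\cup\{\infty\}$ be the least number of $n$-crossings in a projection with only $n$-crossings of a link isotopic to $K$ ($\infty$ if there were no such projection). **Lemma.** For all $n\ge 2$ and all links $K$, $c_n(K)\ge c_{2n}(K)$. -/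

import Mathlib

open scoped Topology

namespace Multicrossing

/-- The plane `ℝ²` onto which links are projected. -/
abbrev Plane : Type := ℝ × ℝ

/-- Three-space `ℝ³ = ℝ² × ℝ`. The second component is the height, and the projection to the plane
is `Prod.fst`. -/
abbrev Space : Type := Plane × ℝ

/-- `L ⊆ ℝ³` is a (tame, polygonal) link: a disjoint union of finitely many simple closed polygons.
The vertices are `v i`, for `i` in a finite index set, and `next i` is the vertex that follows `i`,
so that the components are the cycles of `next`. Injectivity of `(i, t) ↦ (1 - t) v i + t v (next i)`
on `0 ≤ t < 1` says that the half-open edges are nondegenerate and pairwise disjoint, that is, that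
the polygons are simple and mutually disjoint (in particular every cycle has length at least 3). -/
def IsLink (L : Set Space) : Prop :=
  ∃ (m : ℕ) (next : Equiv.Perm (Fin m)) (v : Fin m → Space),
    Set.InjOn (fun q : Fin m × ℝ => AffineMap.lineMap (v q.1) (v (next q.1)) q.2)
      (Set.univ ×ˢ Set.Ico (0 : ℝ) 1) ∧
    L = ⋃ i, segment ℝ (v i) (v (next i))

/-- A (tame, polygonal) link in `ℝ³`, with any number of components. -/
structure Link where
  carrier : Set Space
  isLink : IsLink carrier

/-- `L'` arises from `L` by a triangle move (Δ-move): there is a nondegenerate triangle `u v w` that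
meets `L` exactly in its side `[u, w]`, and `L'` is obtained from `L` by replacing that side by the
two other sides `[u, v] ∪ [v, w]`. -/
def DeltaMove (L L' : Link) : Prop :=
  ∃ u v w : Space, AffineIndependent ℝ ![u, v, w] ∧
    convexHull ℝ {u, v, w} ∩ L.carrier = segment ℝ u w ∧
    L'.carrier = (L.carrier \ segment ℝ u w) ∪ (segment ℝ u v ∪ segment ℝ v w)

/-- Equivalence (isotopy) of polygonal links: a finite sequence of triangle moves and their
inverses. -/
def Isotopic : Link → Link → Prop := Relation.EqvGen DeltaMove

/-- The points of the link above the point `p` of the plane. -/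
def fiber (L : Link) (p : Plane) : Set Space := {x | x ∈ L.carrier ∧ x.1 = p}

/-- The singular points of the projection of `L`: the points of the plane above which there are at
least two points of the link. -/
def singularPoints (L : Link) : Set Plane := {p | (fiber L p).Nontrivial}

/-- Near its point `x`, the link is a straight strand in the direction `d`. -/
def IsStrand (L : Link) (x d : Space) : Prop :=
  ∀ᶠ y in 𝓝 x, y ∈ L.carrier ↔ ∃ t : ℝ, y = x + t • d

/-- `p` is an `n`-crossing of the projection of `L`: exactly `n` strands of the link pass over `p`,
and their projections are straight near `p` with pairwise different directions, so that each strand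
bisects the crossing. -/
def IsCrossing (n : ℕ) (L : Link) (p : Plane) : Prop :=
  (fiber L p).encard = n ∧
  ∃ d : Space → Space, (∀ x ∈ fiber L p, IsStrand L x (d x)) ∧
    (fiber L p).Pairwise fun x y => LinearIndependent ℝ ![(d x).1, (d y).1]

/-- The projection of `L` has only `n`-crossings: it has finitely many singular points, and each of
them is an `n`-crossing. -/
def HasOnlyCrossings (n : ℕ) (L : Link) : Prop :=
  (singularPoints L).Finite ∧ ∀ p ∈ singularPoints L, IsCrossing n L p

/-- The `n`-crossing number `c_n(K)`: the least number of crossings in a projection of (a link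
isotopic to) `K` with only `n`-crossings; it would be `∞` if there were no such projection. -/
noncomputable def crossingNumber (n : ℕ) (K : Link) : ℕ∞ :=
  ⨅ (L : Link) (_ : Isotopic K L) (_ : HasOnlyCrossings n L), (singularPoints L).encard

end Multicrossing

/-! Cut each component at one edge that avoids the crossings, and replace this edge by an arc that
runs back along the whole component, on a thin parallel copy lying high above everything built so
far. An arc above the rest of the link is isotopic to the edge that it replaces, so the link type
does not change.

The copy is chosen so that its projection passes through every crossing and changes sides there: it
crosses its own strand exactly at the crossing and nowhere else. A crossing with `n` strands then
carries `2n` strands in pairwise different directions, and no other multiple points arise. The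
number of side changes around a component may be odd, which would prevent a closed parallel copy;
this does no harm, because the component has been cut open. The new singular points are therefore
among the old ones.

The isotopy rests on `exists_height`. The relation `Below S A` bounds how steeply `S` can rise over
`A`. If the link is below its edge `[x, y]`, a triangle over this edge with sufficiently high apex
meets the link only in `[x, y]`, and the enlarged configuration is below the new edge from the apex
to `y`. Thus the move can be repeated (`IsExtensible.extend`), and an arc with prescribed projection
grows vertex by vertex (`IsExtensible.exists_path`); at a crossing two steps are made as one
straight edge.

The plane part is prepared by `exists_isDiagram`, which makes all points over crossings vertices and
gives them symmetric neighbours, and by `IsDiagram.exists_isPushoff`, which finds the parallel copy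
by moving vertices along suitable normals by a small `ε`. `IsPartialDoubling.extend` treats one
component, and `hasOnlyCrossings_of_edges` recognises the crossings of the result. -/

namespace Multicrossing

/-! ### Polygons and the insertion of a vertex. -/

/-- The vertices `v i`, in the cyclic orders given by `next`, span disjoint simple closed
polygons. -/
def IsPolygon {ι : Type} (next : Equiv.Perm ι) (v : ι → Space) : Prop :=
  Set.InjOn (fun q : ι × ℝ => AffineMap.lineMap (v q.1) (v (next q.1)) q.2)
      (Set.univ ×ˢ Set.Ico (0 : ℝ) 1)

lemma exists_lineMap_Ico_or_eq_right {E : Type*} [AddCommGroup E] [Module ℝ E] {x y z : E}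
    (hz : z ∈ segment ℝ x y) :
    (∃ t ∈ Set.Ico (0 : ℝ) 1, AffineMap.lineMap x y t = z) ∨ z = y := by
  rw [segment_eq_image_lineMap] at hz
  obtain ⟨t, ht, rfl⟩ := hz
  rcases ht.2.lt_or_eq with h | rfl
  · exact Or.inl ⟨t, ⟨ht.1, h⟩, rfl⟩
  · simp

lemma lineMap_mem_segment' {E : Type*} [AddCommGroup E] [Module ℝ E] (x y : E) {t : ℝ}
    (ht : t ∈ Set.Icc (0 : ℝ) 1) : AffineMap.lineMap x y t ∈ segment ℝ x y := by
  rw [segment_eq_image_lineMap]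
  exact ⟨t, ht, rfl⟩

lemma lineMap_injective' {E : Type*} [AddCommGroup E] [Module ℝ E] {x y : E} (h : x ≠ y) :
    Function.Injective (AffineMap.lineMap x y : ℝ → E) :=
  AffineMap.lineMap_injective ℝ h

namespace IsPolygon

variable {ι : Type} {next : Equiv.Perm ι} {v : ι → Space}

lemma eq_of_lineMap_eq (h : IsPolygon next v) {i j : ι} {s t : ℝ} (hs : s ∈ Set.Ico (0 : ℝ) 1)
    (ht : t ∈ Set.Ico (0 : ℝ) 1)
    (he : AffineMap.lineMap (v i) (v (next i)) s = AffineMap.lineMap (v j) (v (next j)) t) :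
    i = j ∧ s = t := by
  have : (i, s) = (j, t) :=
    h (Set.mk_mem_prod (Set.mem_univ i) hs) (Set.mk_mem_prod (Set.mem_univ j) ht) he
  exact Prod.mk.inj this

lemma injective (h : IsPolygon next v) : Function.Injective v := by
  intro i j hij
  exact (h.eq_of_lineMap_eq (i := i) (j := j) (s := 0) (t := 0) (by simp) (by simp)
    (by simpa using hij)).1

lemma ne (h : IsPolygon next v) (i : ι) : v i ≠ v (next i) := by
  intro hi
  have := (h.eq_of_lineMap_eq (i := i) (j := i) (s := 0) (t := 1 / 2) (by simp) (by norm_num)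
    (by rw [← hi]; simp)).2
  norm_num at this

lemma vertex_mem (h : IsPolygon next v) {a i : ι} (ha : v a ∈ segment ℝ (v i) (v (next i))) :
    a = i ∨ a = next i := by
  rcases exists_lineMap_Ico_or_eq_right ha with ⟨t, ht, hz⟩ | hz
  · left
    exact (h.eq_of_lineMap_eq (i := a) (j := i) (s := 0) (t := t) (by simp) ht
      (by simpa using hz.symm)).1
  · exact Or.inr (h.injective hz)

/-- The half-open edges are disjoint, so a common point of two closed edges is the terminal vertex
of one of them and hence the initial vertex of the other. -/
lemma inter (h : IsPolygon next v) {i j : ι} (hij : i ≠ j) {z : Space}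
    (hi : z ∈ segment ℝ (v i) (v (next i))) (hj : z ∈ segment ℝ (v j) (v (next j))) :
    (z = v i ∧ next j = i) ∨ (z = v j ∧ next i = j) := by
  rcases exists_lineMap_Ico_or_eq_right hi with ⟨t, ht, rfl⟩ | rfl
  · rcases exists_lineMap_Ico_or_eq_right hj with ⟨s, hs, hz⟩ | hz
    · exact absurd (h.eq_of_lineMap_eq hs ht hz).1.symm hij
    · left
      have := (h.eq_of_lineMap_eq (i := i) (j := next j) (s := t) (t := 0) ht (by simp)
        (by simpa using hz))
      refine ⟨?_, this.1.symm⟩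
      rw [hz, this.1]
  · rcases h.vertex_mem hj with h' | h'
    · exact Or.inr ⟨by rw [h'], h'⟩
    · exact absurd (next.injective h') hij

lemma isLink [Finite ι] (h : IsPolygon next v) :
    IsLink (⋃ i, segment ℝ (v i) (v (next i))) := by
  obtain ⟨m, ⟨e⟩⟩ := Finite.exists_equiv_fin ι
  refine ⟨m, (e.symm.trans next).trans e, v ∘ e.symm, ?_, ?_⟩
  · rintro ⟨i, s⟩ ⟨-, hs⟩ ⟨j, t⟩ ⟨-, ht⟩ he
    simp only [Function.comp, Equiv.trans_apply, Equiv.symm_apply_apply] at he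
    obtain ⟨h1, h2⟩ := h.eq_of_lineMap_eq hs ht he
    simp only [EmbeddingLike.apply_eq_iff_eq] at h1
    exact Prod.ext h1 h2
  · simp only [Function.comp, Equiv.trans_apply, Equiv.symm_apply_apply]
    exact (e.symm.surjective.iUnion_comp (fun i => segment ℝ (v i) (v (next i)))).symm

end IsPolygon

/-- The cyclic order in which a new vertex `none` follows the vertex `i`. -/
def insertNext {ι : Type} [DecidableEq ι] (next : Equiv.Perm ι) (i : ι) :
    Equiv.Perm (Option ι) :=
  (Equiv.swap none (some i)).trans (Equiv.optionCongr next)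

section insertNext

variable {ι : Type} [DecidableEq ι] {next : Equiv.Perm ι} {v : ι → Space} {i : ι} {w : Space}

@[simp] lemma insertNext_none : insertNext next i none = some (next i) := by
  simp [insertNext]

@[simp] lemma insertNext_self : insertNext next i (some i) = none := by
  simp [insertNext]

lemma insertNext_of_ne {j : ι} (h : j ≠ i) : insertNext next i (some j) = some (next j) := by
  simp [insertNext, Equiv.swap_apply_of_ne_of_ne, h]

/-- The hypotheses allow closed edges to meet in the expected common ends. Passing to half-open
edges assigns each such end to a single edge, which restores injectivity. -/
lemma IsPolygon.insert (h : IsPolygon next v)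
    (h1 : ∀ j, j ≠ i → ∀ z ∈ segment ℝ (v i) w, z ∈ segment ℝ (v j) (v (next j)) → z = v i)
    (h2 : ∀ j, j ≠ i → ∀ z ∈ segment ℝ w (v (next i)), z ∈ segment ℝ (v j) (v (next j)) →
      z = v (next i))
    (h3 : ∀ z ∈ segment ℝ (v i) w, z ∈ segment ℝ w (v (next i)) → z = w)
    (hxw : v i ≠ w) (hwy : w ≠ v (next i)) :
    IsPolygon (insertNext next i) (fun o => o.elim w v) := by
  have mem {x y : Space} {t : ℝ} (ht : t ∈ Set.Ico (0 : ℝ) 1) :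
      AffineMap.lineMap x y t ∈ segment ℝ x y := lineMap_mem_segment' x y ⟨ht.1, ht.2.le⟩
  have A : ∀ {j} {s t : ℝ}, j ≠ i → s ∈ Set.Ico (0 : ℝ) 1 → t ∈ Set.Ico (0 : ℝ) 1 →
      AffineMap.lineMap (v i) w s = AffineMap.lineMap (v j) (v (next j)) t → False := by
    intro j s t hj hs ht he
    have := h1 j hj _ (mem hs) (he ▸ mem ht)
    rw [he] at this
    exact hj (h.eq_of_lineMap_eq (i := j) (j := i) (s := t) (t := 0) ht (by simp)
      (by simpa using this)).1
  have B : ∀ {j} {s t : ℝ}, j ≠ i → s ∈ Set.Ico (0 : ℝ) 1 → t ∈ Set.Ico (0 : ℝ) 1 →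
      AffineMap.lineMap w (v (next i)) s = AffineMap.lineMap (v j) (v (next j)) t → False := by
    intro j s t hj hs ht he
    have := h2 j hj _ (mem hs) (he ▸ mem ht)
    have h1 : s = 1 := lineMap_injective' hwy (by simpa using this)
    exact absurd hs.2 (by simp [h1])
  have C : ∀ {s t : ℝ}, s ∈ Set.Ico (0 : ℝ) 1 → t ∈ Set.Ico (0 : ℝ) 1 →
      AffineMap.lineMap (v i) w s = AffineMap.lineMap w (v (next i)) t → False := by
    intro s t hs ht he
    have := h3 _ (mem hs) (he ▸ mem ht)
    have h1 : s = 1 := lineMap_injective' hxw (by simpa using this)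
    exact absurd hs.2 (by simp [h1])
  rintro ⟨a, s⟩ ⟨-, hs⟩ ⟨b, t⟩ ⟨-, ht⟩ he
  simp only at hs ht he
  rcases a with _ | a
  · rcases b with _ | b
    · have : s = t := lineMap_injective' hwy (by simpa using he)
      simp [this]
    · by_cases hb : b = i
      · subst hb
        exact (C ht hs (by simpa using he.symm)).elim
      · exact (B hb hs ht (by simpa [insertNext_of_ne hb] using he)).elim
  · by_cases ha : a = i
    · subst ha
      rcases b with _ | b
      · exact (C hs ht (by simpa using he)).elim
      · by_cases hb : b = a
        · subst hb
          have : s = t := lineMap_injective' hxw (by simpa using he)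
          simp [this]
        · exact (A hb hs ht (by simpa [insertNext_of_ne hb] using he)).elim
    · rcases b with _ | b
      · exact (B ha ht hs (by simpa [insertNext_of_ne ha] using he.symm)).elim
      · by_cases hb : b = i
        · subst hb
          exact (A ha ht hs (by simpa [insertNext_of_ne ha] using he.symm)).elim
        · have := h.eq_of_lineMap_eq hs ht
            (by simpa [insertNext_of_ne hb, insertNext_of_ne ha] using he)
          simp [this.1, this.2]

end insertNext

/-! ### Polygonal links with some edges still to be replaced. -/

/-- The union of the edges in `F`. -/
def edgeUnion (F : Set (Space × Space)) : Set Space := ⋃ e ∈ F, segment ℝ e.1 e.2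

lemma edgeUnion_insert (e : Space × Space) (F : Set (Space × Space)) :
    edgeUnion (insert e F) = segment ℝ e.1 e.2 ∪ edgeUnion F := by
  simp [edgeUnion]

/-- `A ∪ edgeUnion F` is a polygonal link which has the elements of `F` among its edges, the union
of the other edges being `A`. -/
def IsLinkWith (A : Set Space) (F : Set (Space × Space)) : Prop :=
  ∃ (ι : Type) (_ : Finite ι) (next : Equiv.Perm ι) (v : ι → Space) (I : Set ι),
    IsPolygon next v ∧ F = (fun i => (v i, v (next i))) '' I ∧
    A = ⋃ i ∈ Iᶜ, segment ℝ (v i) (v (next i))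

namespace IsLinkWith

variable {A : Set Space} {F : Set (Space × Space)}

lemma isLink (h : IsLinkWith A F) : IsLink (A ∪ edgeUnion F) := by
  obtain ⟨ι, _, next, v, I, hp, rfl, rfl⟩ := h
  convert hp.isLink using 1
  ext z
  simp only [edgeUnion, Set.mem_union, Set.mem_iUnion, Set.mem_image, exists_prop, Set.mem_compl_iff]
  constructor
  · rintro (⟨i, -, h⟩ | ⟨e, ⟨i, -, rfl⟩, h⟩)
    · exact ⟨i, h⟩
    · exact ⟨i, h⟩
  · rintro ⟨i, h⟩
    by_cases hi : i ∈ I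
    · exact Or.inr ⟨_, ⟨i, hi, rfl⟩, h⟩
    · exact Or.inl ⟨i, hi, h⟩

lemma isLink_insert {x y : Space} (h : IsLinkWith A (insert (x, y) F)) :
    IsLink (A ∪ edgeUnion F ∪ segment ℝ x y) := by
  have := h.isLink
  rw [edgeUnion_insert] at this
  convert this using 1
  ext z
  simp only [Set.mem_union]
  tauto

lemma finish {e : Space × Space} (h : IsLinkWith A (insert e F)) (he : e ∉ F) :
    IsLinkWith (A ∪ segment ℝ e.1 e.2) F := by
  obtain ⟨ι, hf, next, v, I, hp, hF, rfl⟩ := h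
  have hinj : Function.Injective (fun i => (v i, v (next i))) := fun a b hab =>
    hp.injective (congrArg Prod.fst hab)
  obtain ⟨i, hi, rfl⟩ : e ∈ (fun i => (v i, v (next i))) '' I := hF ▸ Set.mem_insert _ _
  refine ⟨ι, hf, next, v, I \ {i}, hp, ?_, ?_⟩
  · rw [Set.image_sdiff hinj, ← hF]
    simp [he]
  · ext z
    simp only [Set.mem_union, Set.mem_iUnion, Set.mem_compl_iff, Set.mem_sdiff,
      Set.mem_singleton_iff, not_and, not_not, exists_prop]
    constructor
    · rintro (⟨j, hj, h⟩ | h)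
      · exact ⟨j, fun h' => absurd h' hj, h⟩
      · exact ⟨i, fun _ => rfl, h⟩
    · rintro ⟨j, hj, h⟩
      by_cases hjI : j ∈ I
      · obtain rfl := hj hjI
        exact Or.inr h
      · exact Or.inl ⟨j, hjI, h⟩

lemma inter_edge {x y : Space} (h : IsLinkWith A (insert (x, y) F)) (he : (x, y) ∉ F) {z : Space}
    (hz : z ∈ segment ℝ x y) (hz' : z ∈ A ∪ edgeUnion F) : z = x ∨ z = y := by
  obtain ⟨ι, hf, next, v, I, hp, hF, rfl⟩ := h
  obtain ⟨i, hi, hxy⟩ : (x, y) ∈ (fun i => (v i, v (next i))) '' I := hF ▸ Set.mem_insert _ _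
  obtain ⟨rfl, rfl⟩ := Prod.mk.inj hxy
  have key : ∀ j, j ≠ i → z ∈ segment ℝ (v j) (v (next j)) → z = v i ∨ z = v (next i) := by
    intro j hj hzj
    rcases hp.inter hj.symm hz hzj with h' | h'
    · exact Or.inl h'.1
    · exact Or.inr (by rw [h'.1, h'.2])
  rcases hz' with hz' | hz'
  · simp only [Set.mem_iUnion, Set.mem_compl_iff, exists_prop] at hz'
    obtain ⟨j, hj, hzj⟩ := hz'
    exact key j (fun h => hj (h ▸ hi)) hzj
  · simp only [edgeUnion, Set.mem_iUnion, exists_prop] at hz'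
    obtain ⟨e, heF, hz'⟩ := hz'
    have : e ∈ (fun i => (v i, v (next i))) '' I := hF ▸ Set.mem_insert_of_mem _ heF
    obtain ⟨j, hj, rfl⟩ := this
    exact key j (fun h => he (h ▸ heF)) hz'

/-- One step of growing an arc from `x` towards `y`: the edge `[x, w]` is final and joins `A`,
whereas `[w, y]` takes over the role of `[x, y]`, so that the step can be repeated. -/
lemma insert_vertex {x y w : Space} (h : IsLinkWith A (insert (x, y) F)) (he : (x, y) ∉ F)
    (h1 : ∀ z ∈ segment ℝ x w, z ∈ A ∪ edgeUnion F → z = x)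
    (h2 : ∀ z ∈ segment ℝ w y, z ∈ A ∪ edgeUnion F → z = y)
    (h3 : ∀ z ∈ segment ℝ x w, z ∈ segment ℝ w y → z = w) (hxw : x ≠ w) (hwy : w ≠ y) :
    IsLinkWith (A ∪ segment ℝ x w) (insert (w, y) F) ∧ (w, y) ∉ F := by
  classical
  obtain ⟨ι, hf, next, v, I, hp, hF, rfl⟩ := h
  have hinj : Function.Injective (fun i => (v i, v (next i))) := fun a b hab =>
    hp.injective (congrArg Prod.fst hab)
  obtain ⟨i, hi, hxy⟩ : (x, y) ∈ (fun i => (v i, v (next i))) '' I := hF ▸ Set.mem_insert _ _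
  obtain ⟨rfl, rfl⟩ := Prod.mk.inj hxy
  have hFI : F = (fun i => (v i, v (next i))) '' (I \ {i}) := by
    rw [Set.image_sdiff hinj, ← hF]
    simp [he]
  have sub : ∀ j, j ≠ i → segment ℝ (v j) (v (next j)) ⊆
      (⋃ i ∈ Iᶜ, segment ℝ (v i) (v (next i))) ∪ edgeUnion F := by
    intro j hj z hz
    by_cases hjI : j ∈ I
    · right
      rw [edgeUnion, hFI]
      simp only [Set.mem_iUnion, exists_prop]
      exact ⟨_, ⟨j, ⟨hjI, hj⟩, rfl⟩, hz⟩
    · left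
      simp only [Set.mem_iUnion, exists_prop]
      exact ⟨j, hjI, hz⟩
  refine ⟨⟨Option ι, inferInstance, insertNext next i, fun o => o.elim w v,
    insert none (some '' (I \ {i})), ?_, ?_, ?_⟩, ?_⟩
  · exact hp.insert (fun j hj z hz hz' => h1 z hz (sub j hj hz'))
      (fun j hj z hz hz' => h2 z hz (sub j hj hz')) h3 hxw hwy
  · rw [Set.image_insert_eq, Set.image_image]
    simp only [insertNext_none, Option.elim_none, Option.elim_some]
    congr 1
    rw [hFI]
    refine Set.image_congr fun j hj => ?_
    rw [insertNext_of_ne hj.2]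
    simp
  · ext z
    simp only [Set.mem_union, Set.mem_iUnion, Set.mem_compl_iff, exists_prop, Set.mem_insert_iff,
      Set.mem_image, not_or]
    constructor
    · rintro (⟨j, hj, h⟩ | h)
      · have hji : j ≠ i := fun h => hj (h ▸ hi)
        refine ⟨some j, ⟨by simp, ?_⟩, by simpa [insertNext_of_ne hji] using h⟩
        simp [hj]
      · exact ⟨some i, by simp, by simpa using h⟩
    · rintro ⟨_ | j, ⟨hj, hj'⟩, h⟩
      · simp at hj
      · by_cases hji : j = i
        · subst hji
          exact Or.inr (by simpa using h)
        · refine Or.inl ⟨j, fun hjI => hj' ⟨j, ⟨hjI, hji⟩, rfl⟩, ?_⟩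
          simpa [insertNext_of_ne hji] using h
  · rw [hFI]
    rintro ⟨j, ⟨-, hj⟩, hw⟩
    exact hj (next.injective (hp.injective (congrArg Prod.snd hw)))

end IsLinkWith

/-! ### Raising a triangle above the rest of the link. -/

/-- Above the projection of `A`, the set `S` lies below `A`; near points above which they meet, the
height of `S` over `A` is bounded by a multiple of the horizontal distance. -/
def Below (S A : Set Space) : Prop :=
  ∃ C : ℝ, ∀ z ∈ S, ∀ u ∈ A, z.2 - u.2 ≤ C * ‖z.1 - u.1‖

/-- Quantitative form of the fact that two nonzero vectors without opposite directions do not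
cancel: the norm has a positive minimum on the compact segment, and homogeneity carries the bound to
the cone. -/
lemma exists_pos_mul_le_norm {a b : Plane} (h : 0 ∉ segment ℝ a b) :
    ∃ δ > 0, ∀ α β : ℝ, 0 ≤ α → 0 ≤ β → δ * (α + β) ≤ ‖α • a + β • b‖ := by
  have hc : IsCompact (segment ℝ a b) := by
    rw [segment_eq_image_lineMap]
    exact isCompact_Icc.image AffineMap.lineMap_continuous
  obtain ⟨m, hm, hmin⟩ := hc.exists_isMinOn ⟨a, left_mem_segment ℝ a b⟩
    (continuous_norm (E := Plane)).continuousOn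
  refine ⟨‖m‖, norm_pos_iff.2 fun h0 => h (h0 ▸ hm), fun α β hα hβ => ?_⟩
  rcases (add_nonneg hα hβ).eq_or_lt with h0 | h0
  · rw [← h0, mul_zero]
    exact norm_nonneg _
  · have hmem : (α + β)⁻¹ • (α • a + β • b) ∈ segment ℝ a b := by
      refine ⟨(α + β)⁻¹ * α, (α + β)⁻¹ * β, by positivity, by positivity, by field_simp, ?_⟩
      rw [smul_add, smul_smul, smul_smul]
    have := hmin hmem
    simp only [Set.mem_ofPred_eq, norm_smul, norm_inv, Real.norm_eq_abs, abs_of_pos h0] at this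
    rw [inv_mul_eq_div, le_div_iff₀ h0] at this
    exact this

lemma isCompact_segment {E : Type*} [NormedAddCommGroup E] [NormedSpace ℝ E] (x y : E) :
    IsCompact (segment ℝ x y) := by
  rw [segment_eq_image_lineMap]
  exact isCompact_Icc.image AffineMap.lineMap_continuous

lemma norm_le_of_eq_add_smul {E : Type*} [NormedAddCommGroup E] [NormedSpace ℝ E] {a b d : E}
    {c : ℝ} (hc : 0 ≤ c) (h : a = b + c • d) : ‖a‖ ≤ ‖b‖ + c * ‖d‖ := by
  rw [h]
  refine (norm_add_le _ _).trans_eq ?_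
  rw [norm_smul, Real.norm_of_nonneg hc]

namespace Below

variable {S S' A A' : Set Space} {x y w : Space}

lemma exists_le (h : Below S A) (K : ℝ) :
    ∃ C : ℝ, K ≤ C ∧ ∀ z ∈ S, ∀ u ∈ A, z.2 - u.2 ≤ C * ‖z.1 - u.1‖ := by
  obtain ⟨C, hC⟩ := h
  refine ⟨max K C, le_max_left _ _, fun z hz u hu => (hC z hz u hu).trans ?_⟩
  gcongr
  exact le_max_right _ _

lemma union (h : Below S A) (h' : Below S' A) : Below (S ∪ S') A := by
  obtain ⟨C, hC⟩ := h
  obtain ⟨C', hCC', hC'⟩ := h'.exists_le C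
  refine ⟨C', ?_⟩
  rintro z (hz | hz) u hu
  · refine (hC z hz u hu).trans ?_
    gcongr
  · exact hC' z hz u hu

lemma mono (h : Below S A) (hS : S' ⊆ S) : Below S' A := by
  obtain ⟨C, hC⟩ := h
  exact ⟨C, fun z hz u hu => hC z (hS hz) u hu⟩

lemma iUnion {ι : Sort*} [Finite ι] {S : ι → Set Space} (h : ∀ i, Below (S i) A) :
    Below (⋃ i, S i) A := by
  choose C hC using h
  obtain ⟨M, hM⟩ := (Set.finite_range C).bddAbove
  refine ⟨M, fun z hz u hu => ?_⟩
  obtain ⟨i, hi⟩ := Set.mem_iUnion.1 hz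
  refine (hC i z hi u hu).trans ?_
  gcongr
  exact hM ⟨i, rfl⟩

lemma of_forall_ne (hS : IsCompact S) (hA : IsCompact A) (h : ∀ z ∈ S, ∀ u ∈ A, z.1 ≠ u.1) :
    Below S A := by
  have hcont : ContinuousOn (fun q : Space × Space => (q.1.2 - q.2.2) / ‖q.1.1 - q.2.1‖)
      (S ×ˢ A) := by
    refine ContinuousOn.div (by fun_prop) (by fun_prop) ?_
    rintro ⟨z, u⟩ ⟨hz, hu⟩
    exact norm_ne_zero_iff.2 (sub_ne_zero.2 (h z hz u hu))
  obtain ⟨C, hC⟩ := (hS.prod hA).bddAbove_image hcont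
  refine ⟨C, fun z hz u hu => ?_⟩
  have := hC ⟨(z, u), ⟨hz, hu⟩, rfl⟩
  rwa [div_le_iff₀ (norm_pos_iff.2 (sub_ne_zero.2 (h z hz u hu)))] at this

/-- Two edges that leave `y` in different horizontal directions separate at a linear rate, and this
controls their difference in height. -/
lemma of_segment {a b : Space} (h : 0 ∉ segment ℝ a.1 (-b.1)) :
    Below (segment ℝ y (y + a)) (segment ℝ y (y + b)) := by
  obtain ⟨δ, hδ, hδ'⟩ := exists_pos_mul_le_norm h
  refine ⟨(|a.2| + |b.2|) / δ, fun z hz u hu => ?_⟩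
  rw [segment_eq_image'] at hz hu
  obtain ⟨s, hs, rfl⟩ := hz
  obtain ⟨t, ht, rfl⟩ := hu
  have h1 := hδ' s t hs.1 ht.1
  have h2 : (y + s • (y + a - y)).1 - (y + t • (y + b - y)).1 = s • a.1 + t • -b.1 := by
    simp only [add_sub_cancel_left, Prod.fst_add, Prod.smul_fst, smul_neg]
    abel
  have h3 : (y + s • (y + a - y)).2 - (y + t • (y + b - y)).2 = s * a.2 - t * b.2 := by
    simp only [add_sub_cancel_left, Prod.snd_add, Prod.smul_snd, smul_eq_mul]
    ring
  rw [h2, h3]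
  calc s * a.2 - t * b.2 ≤ s * |a.2| + t * |b.2| := by
        have := mul_le_mul_of_nonneg_left (le_abs_self a.2) hs.1
        have := mul_le_mul_of_nonneg_left (neg_abs_le b.2) ht.1
        linarith
    _ ≤ (|a.2| + |b.2|) * (s + t) := by
        nlinarith [mul_nonneg hs.1 (abs_nonneg b.2), mul_nonneg ht.1 (abs_nonneg a.2)]
    _ = (|a.2| + |b.2|) / δ * (δ * (s + t)) := by field_simp
    _ ≤ _ := by gcongr

lemma self (h : x.1 ≠ y.1) : Below (segment ℝ x y) (segment ℝ x y) := by
  refine ⟨|y.2 - x.2| / ‖y.1 - x.1‖, fun z hz u hu => ?_⟩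
  have hpos : 0 < ‖y.1 - x.1‖ := norm_pos_iff.2 (sub_ne_zero.2 h.symm)
  rw [segment_eq_image'] at hz hu
  obtain ⟨s, hs, rfl⟩ := hz
  obtain ⟨t, ht, rfl⟩ := hu
  have h2 : (x + s • (y - x)).1 - (x + t • (y - x)).1 = (s - t) • (y.1 - x.1) := by
    simp only [Prod.fst_add, Prod.smul_fst, Prod.fst_sub, sub_smul]
    abel
  have h3 : (x + s • (y - x)).2 - (x + t • (y - x)).2 = (s - t) * (y.2 - x.2) := by
    simp only [Prod.snd_add, Prod.smul_snd, Prod.snd_sub, smul_eq_mul]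
    ring
  rw [h2, h3, norm_smul, Real.norm_eq_abs]
  calc (s - t) * (y.2 - x.2) ≤ |s - t| * |y.2 - x.2| := by
        rw [← abs_mul]; exact le_abs_self _
    _ = _ := by field_simp

end Below

/-- A triangle with two vertices on `S` and a high third vertex meets `S` in one side only, and `S`
remains below the new last side. -/
lemma exists_height {S : Set Space} {x y : Space} (hS : Below S (segment ℝ x y))
    (hxy : x.1 ≠ y.1) (hsub : segment ℝ x y ⊆ S) {P : Plane} (hP : y.1 ∉ segment ℝ x.1 P) :
    ∃ H : ℝ, ∀ h ≥ H,
      AffineIndependent ℝ ![x, ((P, h) : Space), y] ∧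
      convexHull ℝ {x, ((P, h) : Space), y} ∩ S = segment ℝ x y ∧
      Below (S ∪ segment ℝ x (P, h) ∪ segment ℝ (P, h) y) (segment ℝ (P, h) y) := by
  obtain ⟨C, hK, hC⟩ := hS.exists_le (max 0 (|y.2 - x.2| / ‖y.1 - x.1‖))
  have hC0 : 0 ≤ C := (le_max_left _ _).trans hK
  have hCK : |y.2 - x.2| / ‖y.1 - x.1‖ ≤ C := (le_max_right _ _).trans hK
  have hpos : 0 < ‖y.1 - x.1‖ := norm_pos_iff.2 (sub_ne_zero.2 hxy.symm)
  have hPy : P ≠ y.1 := fun h => hP (h ▸ right_mem_segment ℝ _ _)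
  -- Over `P`, a cone of slope `C` based at a point of `[x, y]` reaches at most the height `M`; one
  -- unit more gives the strict inequality `hu`.
  obtain ⟨M, hM⟩ := (isCompact_segment x y).bddAbove_image
    (f := fun u : Space => u.2 + C * ‖P - u.1‖) (by fun_prop)
  refine ⟨M + 1, fun h hh => ?_⟩
  have hu : ∀ u ∈ segment ℝ x y, C * ‖P - u.1‖ < h - u.2 := by
    intro u hu
    have : u.2 + C * ‖P - u.1‖ ≤ M := hM ⟨u, hu, rfl⟩
    linarith
  have hux := hu x (left_mem_segment ℝ _ _)
  have huy := hu y (right_mem_segment ℝ _ _)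
  refine ⟨?_, ?_, ?_⟩
  · rw [affineIndependent_iff_not_collinear_set]
    intro hcol
    rw [collinear_iff_of_mem (p₀ := x) (by simp)] at hcol
    obtain ⟨v, hv⟩ := hcol
    obtain ⟨s, hs⟩ := hv y (by simp)
    obtain ⟨r, hr⟩ := hv (P, h) (by simp)
    have hs1 : y.1 - x.1 = s • v.1 := by rw [hs]; simp
    have hs2 : y.2 - x.2 = s * v.2 := by rw [hs]; simp
    have hr1 : P - x.1 = r • v.1 := by
      have := congrArg Prod.fst hr
      simp only at this
      rw [this]; simp
    have hr2 : h - x.2 = r * v.2 := by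
      have := congrArg Prod.snd hr
      simp only at this
      rw [this]; simp
    rw [hs1, hs2] at hCK
    rw [hs1] at hpos
    rw [hr1, hr2] at hux
    rw [norm_smul, Real.norm_eq_abs] at *
    rw [div_le_iff₀ hpos, abs_mul] at hCK
    have hspos : 0 < |s| := pos_of_mul_pos_left hpos (norm_nonneg _)
    -- The line through `x` and `y` has slope at most `C`, whereas the apex is seen from `x` at a
    -- larger slope.
    have h1 : |v.2| ≤ C * ‖v.1‖ := by nlinarith
    have h2 : r * v.2 ≤ |r| * |v.2| := by rw [← abs_mul]; exact le_abs_self _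
    nlinarith [mul_le_mul_of_nonneg_left h1 (abs_nonneg r)]
  · apply Set.Subset.antisymm
    · rintro z ⟨hz, hzS⟩
      rw [Set.insert_comm, convexHull_insert ⟨x, by simp⟩, convexHull_pair,
        mem_convexJoin] at hz
      obtain ⟨w, hw, u, hus, hz⟩ := hz
      obtain rfl : w = (P, h) := by simpa using hw
      rw [segment_symm, segment_eq_image'] at hz
      obtain ⟨μ, hμ, rfl⟩ := hz
      have h1 := hC _ hzS u hus
      have h2 := hu u hus
      simp only [Prod.fst_add, Prod.smul_fst, Prod.fst_sub, Prod.snd_add, Prod.smul_snd,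
        Prod.snd_sub, smul_eq_mul, add_sub_cancel_left, norm_smul, Real.norm_eq_abs,
        abs_of_nonneg hμ.1] at h1
      -- Away from its base the triangle rises from `u` more steeply than `C`, which the points of
      -- `S` cannot do.
      have : μ = 0 := by
        by_contra hne
        have : 0 < μ := lt_of_le_of_ne hμ.1 (Ne.symm hne)
        nlinarith
      simpa [this] using hus
    · intro z hz
      refine ⟨?_, hsub hz⟩
      rw [← convexHull_pair] at hz
      exact convexHull_mono (by intro a; simp; tauto) hz
  · have hself : Below (segment ℝ (P, h) y) (segment ℝ (P, h) y) := Below.self hPy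
    refine Below.union (Below.union ?_ ?_) hself
    · refine ⟨C, fun z hz u hu => ?_⟩
      rw [segment_symm, segment_eq_image'] at hu
      obtain ⟨t, ht, rfl⟩ := hu
      have h1 := hC z hz y (right_mem_segment ℝ _ _)
      have h2 : ‖z.1 - y.1‖ ≤ ‖z.1 - (y + t • ((P, h) - y)).1‖ + t * ‖P - y.1‖ := by
        refine norm_le_of_eq_add_smul ht.1 ?_
        simp only [Prod.fst_add, Prod.smul_fst, Prod.fst_sub]
        module
      have h3 : (y + t • (((P, h) : Space) - y)).2 = y.2 + t * (h - y.2) := by simp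
      rw [h3]
      nlinarith [mul_le_mul_of_nonneg_left h2 hC0, mul_le_mul_of_nonneg_left huy.le ht.1]
    -- The new side over `[x.1, P]` must not pass over `y`; this is where `hP` is needed.
    · have h0 : (0 : Plane) ∉ segment ℝ (x.1 - y.1) (P - y.1) := by
        intro h0
        apply hP
        rw [← mem_segment_translate ℝ (-y.1)]
        simpa [sub_eq_neg_add] using h0
      obtain ⟨δ, hδ, hδ'⟩ := exists_pos_mul_le_norm h0
      refine ⟨max C ((|x.2 - y.2| + |h - y.2|) / δ), fun z hz u hu => ?_⟩
      rw [segment_eq_image'] at hz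
      rw [segment_eq_image'] at hu
      obtain ⟨s, hs, rfl⟩ := hz
      obtain ⟨t, ht, rfl⟩ := hu
      have e1 : (x + s • (((P, h) : Space) - x)).1 - (((P, h) : Space) + t • (y - (P, h))).1
          = (1 - s) • (x.1 - y.1) + (s - (1 - t)) • (P - y.1) := by
        simp only [Prod.fst_add, Prod.smul_fst, Prod.fst_sub]
        module
      have e2 : (x + s • (((P, h) : Space) - x)).2 - (((P, h) : Space) + t • (y - (P, h))).2
          = (1 - s) * (x.2 - y.2) + (s - (1 - t)) * (h - y.2) := by
        simp only [Prod.snd_add, Prod.smul_snd, Prod.snd_sub, smul_eq_mul]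
        ring
      rw [e1, e2]
      have hs' : 0 ≤ 1 - s := by linarith [hs.2]
      -- The difference of the two points is a combination of `x - y` and `(P, h) - y`, with
      -- nonnegative first coefficient. If the second is also nonnegative, `hδ'` excludes horizontal
      -- cancellation. If it is negative, the steep vector `(P, h) - y` lowers the point by enough
      -- for the slope bound `C` to persist.
      rcases le_or_gt 0 (s - (1 - t)) with hD | hD
      · have h1 := hδ' _ _ hs' hD
        calc (1 - s) * (x.2 - y.2) + (s - (1 - t)) * (h - y.2)
            ≤ (1 - s) * |x.2 - y.2| + (s - (1 - t)) * |h - y.2| := by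
              gcongr <;> exact le_abs_self _
          _ ≤ (|x.2 - y.2| + |h - y.2|) * ((1 - s) + (s - (1 - t))) := by
              nlinarith [mul_nonneg hs' (abs_nonneg (h - y.2)),
                mul_nonneg hD (abs_nonneg (x.2 - y.2))]
          _ = (|x.2 - y.2| + |h - y.2|) / δ * (δ * ((1 - s) + (s - (1 - t)))) := by field_simp
          _ ≤ (|x.2 - y.2| + |h - y.2|) / δ * _ := by gcongr
          _ ≤ _ := by gcongr; exact le_max_right _ _
      · have h1 := hC x (hsub (left_mem_segment ℝ _ _)) y (right_mem_segment ℝ _ _)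
        set D := s - (1 - t) with hDdef
        have h2 : (1 - s) * ‖x.1 - y.1‖ ≤
            ‖(1 - s) • (x.1 - y.1) + D • (P - y.1)‖ + (-D) * ‖P - y.1‖ := by
          rw [← Real.norm_of_nonneg hs', ← norm_smul, Real.norm_of_nonneg hs']
          exact norm_le_of_eq_add_smul (by linarith) (by module)
        calc (1 - s) * (x.2 - y.2) + D * (h - y.2)
            ≤ C * ‖(1 - s) • (x.1 - y.1) + D • (P - y.1)‖ := by
              nlinarith [mul_le_mul_of_nonneg_left h1 hs', mul_le_mul_of_nonneg_left h2 hC0,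
                mul_le_mul_of_nonneg_left huy.le (neg_nonneg.2 hD.le)]
          _ ≤ _ := by gcongr; exact le_max_left _ _

/-! ### Growing an ascending arc in place of an edge. -/

/-- A polygonal link isotopic to `K`, given by an edge `[x, y]`, further edges in `F` and the union
`A` of the remaining edges, no point of which is just above the edge `[x, y]`. -/
structure IsExtensible (K : Link) (A : Set Space) (F : Set (Space × Space)) (x y : Space) :
    Prop where
  isLinkWith : IsLinkWith A (insert (x, y) F)
  notMem : (x, y) ∉ F
  isotopic : ∃ L : Link, Isotopic K L ∧ L.carrier = A ∪ edgeUnion F ∪ segment ℝ x y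
  below : Below (A ∪ edgeUnion F ∪ segment ℝ x y) (segment ℝ x y)

lemma fst_mem_segment {a b z : Space} (h : z ∈ segment ℝ a b) : z.1 ∈ segment ℝ a.1 b.1 := by
  obtain ⟨s, t, hs, ht, hst, rfl⟩ := h
  exact ⟨s, t, hs, ht, hst, rfl⟩

lemma eq_of_mem_segment_of_affineIndependent {x w y z : Space}
    (h : AffineIndependent ℝ ![x, w, y]) (h1 : z ∈ segment ℝ x w) (h2 : z ∈ segment ℝ w y) :
    z = w := by
  by_contra hz
  rw [affineIndependent_iff_not_collinear_set] at h
  apply h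
  rw [collinear_iff_of_mem (p₀ := w) (by simp)]
  rw [segment_symm, segment_eq_image'] at h1
  rw [segment_eq_image'] at h2
  obtain ⟨s, hs, rfl⟩ := h1
  obtain ⟨t, ht, hst⟩ := h2
  simp only [add_right_inj] at hst
  have hs0 : s ≠ 0 := by
    rintro rfl
    simp at hz
  refine ⟨y - w, ?_⟩
  simp only [Set.mem_insert_iff, Set.mem_singleton_iff, forall_eq_or_imp, forall_eq]
  refine ⟨⟨t / s, ?_⟩, ⟨0, by simp⟩, ⟨1, by simp⟩⟩
  rw [div_eq_inv_mul, mul_smul, hst, smul_smul, inv_mul_cancel₀ hs0]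
  simp

/-- A single triangle move with a high apex. Both its validity and the simplicity of the new polygon
follow from the fact that the triangle meets the link in `[x, y]` only. -/
lemma IsExtensible.extend {K : Link} {A : Set Space} {F : Set (Space × Space)} {x y : Space}
    (h : IsExtensible K A F x y) (hxy : x.1 ≠ y.1) {P : Plane} (hP : y.1 ∉ segment ℝ x.1 P)
    (B : ℝ) :
    ∃ t > B, IsExtensible K (A ∪ segment ℝ x (P, t)) F (P, t) y := by
  obtain ⟨hL, hF, ⟨L, hKL, hLc⟩, hB⟩ := h
  obtain ⟨H, hH⟩ := exists_height hB hxy Set.subset_union_right hP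
  obtain ⟨hai, hint, hbelow⟩ := hH (max H (B + 1)) (le_max_left _ _)
  refine ⟨max H (B + 1), lt_of_lt_of_le (by linarith) (le_max_right _ _), ?_⟩
  set w : Space := (P, max H (B + 1)) with hw
  have hyx : y ∉ segment ℝ x w := by
    intro hy
    apply hP
    exact fst_mem_segment hy
  have hwy : w ≠ y := by
    intro hwy
    exact hyx (hwy ▸ right_mem_segment ℝ _ _)
  have hxw : x ≠ w := fun hx => by
    have := hai.injective.ne (show (0 : Fin 3) ≠ 1 by decide)
    simp at this
    exact this hx
  have h3 : ∀ z ∈ segment ℝ x w, z ∈ segment ℝ w y → z = w := fun z h1 h2 =>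
    eq_of_mem_segment_of_affineIndependent hai h1 h2
  have hconv : ∀ {a b : Space}, a ∈ ({x, w, y} : Set Space) → b ∈ ({x, w, y} : Set Space) →
      segment ℝ a b ⊆ convexHull ℝ {x, w, y} := fun ha hb =>
    (convex_convexHull ℝ _).segment_subset (subset_convexHull ℝ _ ha) (subset_convexHull ℝ _ hb)
  have h1 : ∀ z ∈ segment ℝ x w, z ∈ A ∪ edgeUnion F → z = x := by
    intro z hz hz'
    -- The point is in the triangle and on the link, hence on the old edge; the other edges meet
    -- this only in its ends.
    have : z ∈ segment ℝ x y := hint ▸ ⟨hconv (by simp) (by simp) hz, Or.inl hz'⟩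
    rcases hL.inter_edge hF this hz' with rfl | rfl
    · rfl
    · exact absurd hz hyx
  have h2 : ∀ z ∈ segment ℝ w y, z ∈ A ∪ edgeUnion F → z = y := by
    intro z hz hz'
    have : z ∈ segment ℝ x y := hint ▸ ⟨hconv (by simp) (by simp) hz, Or.inl hz'⟩
    rcases hL.inter_edge hF this hz' with rfl | rfl
    · exact absurd (h3 _ (left_mem_segment ℝ _ _) hz) hxw
    · rfl
  obtain ⟨hL', hF'⟩ := hL.insert_vertex hF h1 h2 h3 hxw hwy
  refine ⟨hL', hF', ⟨⟨_, hL'.isLink_insert⟩, ?_, rfl⟩, hbelow.mono ?_⟩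
  · refine Relation.EqvGen.trans _ _ _ hKL (Relation.EqvGen.rel _ _ ⟨x, w, y, hai, ?_, ?_⟩)
    · rw [hLc]; exact hint
    · rw [hLc]
      ext z
      constructor
      · rintro (((hz | hz) | hz) | hz)
        · by_cases hzs : z ∈ segment ℝ x y
          · rcases hL.inter_edge hF hzs (Or.inl hz) with rfl | rfl
            · exact Or.inr (Or.inl (left_mem_segment ℝ _ _))
            · exact Or.inr (Or.inr (right_mem_segment ℝ _ _))
          · exact Or.inl ⟨Or.inl (Or.inl hz), hzs⟩
        · exact Or.inr (Or.inl hz)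
        · by_cases hzs : z ∈ segment ℝ x y
          · rcases hL.inter_edge hF hzs (Or.inr hz) with rfl | rfl
            · exact Or.inr (Or.inl (left_mem_segment ℝ _ _))
            · exact Or.inr (Or.inr (right_mem_segment ℝ _ _))
          · exact Or.inl ⟨Or.inl (Or.inr hz), hzs⟩
        · exact Or.inr (Or.inr hz)
      · rintro (⟨(hz | hz) | hz, hz'⟩ | hz | hz)
        · exact Or.inl (Or.inl (Or.inl hz))
        · exact Or.inl (Or.inr hz)
        · exact absurd hz hz'
        · exact Or.inl (Or.inl (Or.inr hz))
        · exact Or.inr hz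
  · rintro z (((hz | hz) | hz) | hz)
    · exact Or.inl (Or.inl (Or.inl (Or.inl hz)))
    · exact Or.inl (Or.inr hz)
    · exact Or.inl (Or.inl (Or.inl (Or.inr hz)))
    · exact Or.inr hz

lemma segment_union_midpoint {E : Type*} [AddCommGroup E] [Module ℝ E] {a b m : E}
    (h : a + b = (2 : ℝ) • m) : segment ℝ a m ∪ segment ℝ m b = segment ℝ a b := by
  have hm : m = (1 / 2 : ℝ) • a + (1 / 2 : ℝ) • b := by
    rw [← smul_add, h, smul_smul]
    norm_num
  have hmem : m ∈ segment ℝ a b := ⟨1 / 2, 1 / 2, by norm_num, by norm_num, by norm_num, hm.symm⟩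
  apply Set.Subset.antisymm
  · exact Set.union_subset ((convex_segment a b).segment_subset (left_mem_segment ℝ _ _) hmem)
      ((convex_segment a b).segment_subset hmem (right_mem_segment ℝ _ _))
  · intro z hz
    rw [segment_eq_image'] at hz
    obtain ⟨t, ht, rfl⟩ := hz
    rcases le_total t (1 / 2) with h2 | h2
    · left
      rw [segment_eq_image']
      refine ⟨2 * t, ⟨by linarith [ht.1], by linarith⟩, ?_⟩
      simp only [hm]
      module
    · right
      rw [segment_eq_image']
      refine ⟨2 * t - 1, ⟨by linarith, by linarith [ht.2]⟩, ?_⟩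
      simp only [hm]
      module

lemma iUnion_segment_congr {w w' : ℕ → Space} {M : ℕ} (h : ∀ k ≤ M, w' k = w k) :
    (⋃ k < M, segment ℝ (w' k) (w' (k + 1))) = ⋃ k < M, segment ℝ (w k) (w (k + 1)) := by
  refine Set.iUnion_congr fun k => Set.iUnion_congr fun hk => ?_
  rw [h k hk.le, h (k + 1) hk]

/-- An edge `[x, y]` that is not covered can be replaced by a path with given projection that
ascends above the rest of the link, and is straight at prescribed vertices. -/
lemma IsExtensible.exists_path {K : Link} {A : Set Space} {F : Set (Space × Space)} {x y : Space}
    (h : IsExtensible K A F x y) (hxy : x.1 ≠ y.1) {p : ℕ → Plane} (hp0 : p 0 = x.1)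
    {cr : ℕ → Prop} (hcr0 : ¬ cr 0) {B : ℝ} (M : ℕ) (hM : ¬ cr M)
    (hcr : ∀ k, k + 1 < M → cr (k + 1) → ¬ cr k ∧ p k + p (k + 2) = (2 : ℝ) • p (k + 1))
    (hy : ∀ k < M, y.1 ∉ segment ℝ (p k) (p (k + 1))) :
    ∃ w : ℕ → Space, w 0 = x ∧ (∀ k, (w k).1 = p k) ∧
      (∀ k, k + 1 < M → cr (k + 1) → w k + w (k + 2) = (2 : ℝ) • w (k + 1)) ∧
      (∀ k < M, B < (w (k + 1)).2) ∧ (∀ k < M, (w k).2 < (w (k + 1)).2) ∧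
      IsExtensible K (A ∪ ⋃ k < M, segment ℝ (w k) (w (k + 1))) F (w M) y := by
  induction M using Nat.strong_induction_on with
  | _ M ih =>
    have ne : ∀ (m : ℕ), (m = 0 ∨ m - 1 < M) → p m ≠ y.1 := by
      intro m hm heq
      rcases m with _ | m
      · exact hxy (hp0 ▸ heq)
      · exact hy m (by omega) (heq ▸ right_mem_segment ℝ _ _)
    rcases M with _ | M
    · exact ⟨fun k => (p k, x.2), by simp [hp0], by simp, by simp, by simp, by simp,
        by simpa [hp0] using h⟩
    -- If the last vertex before the end is to be straight, the last two edges are built as one long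
    -- edge and the vertex is its midpoint. The induction then goes back by two, to a vertex not
    -- marked by `cr`.
    by_cases hcM : cr M
    · rcases M with _ | M
      · exact absurd hcM hcr0
      obtain ⟨hcM', hmid⟩ := hcr M (by omega) hcM
      obtain ⟨w, hw0, hwp, hwm, hwB, hwi, hext⟩ := ih M (by omega) hcM'
        (fun k hk => hcr k (by omega)) (fun k hk => hy k (by omega))
      have hP : y.1 ∉ segment ℝ (w M).1 (p (M + 2)) := by
        rw [hwp, ← segment_union_midpoint hmid]
        rintro (h' | h')
        · exact hy M (by omega) h'
        · exact hy (M + 1) (by omega) h'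
      obtain ⟨t, ht, hext'⟩ := hext.extend (by rw [hwp]; exact ne M (by omega)) hP
        (max (2 * B - (w M).2) (w M).2)
      have ht1 := (le_max_left _ _).trans_lt ht
      have ht2 := (le_max_right _ _).trans_lt ht
      set m : Space := (p (M + 1), ((w M).2 + t) / 2) with hm
      have hsum : w M + (p (M + 2), t) = (2 : ℝ) • m := by
        ext1
        · simp [hm, hwp, hmid]
        · simp only [hm, Prod.snd_add, Prod.smul_snd, smul_eq_mul]
          ring
      set w' : ℕ → Space := fun k => if k ≤ M then w k else if k = M + 1 then m else
        (p k, t) with hw'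
      have e0 : ∀ k ≤ M, w' k = w k := fun k hk => by simp [hw', hk]
      have e1 : w' (M + 1) = m := by simp [hw']
      have e2 : w' (M + 2) = (p (M + 2), t) := by simp [hw']
      refine ⟨w', by rw [e0 0 (by omega), hw0], ?_, ?_, ?_, ?_, ?_⟩
      · intro k
        simp only [hw']
        split_ifs with h1 h2
        · exact hwp k
        · rw [h2]
        · rfl
      · intro k hk hck
        rcases (by omega : k + 2 ≤ M ∨ k + 1 = M ∨ k = M) with h1 | h1 | h1
        · rw [e0 k (by omega), e0 _ h1, e0 _ (by omega)]
          exact hwm k (by omega) hck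
        · exact absurd (h1 ▸ hck) hcM'
        · rw [h1, e0 M le_rfl, e1, e2, hsum]
      · intro k hk
        rcases (by omega : k + 1 ≤ M ∨ k = M ∨ k = M + 1) with h1 | rfl | rfl
        · rw [e0 _ h1]; exact hwB k h1
        · rw [e1]; simp only [hm]; linarith
        · rw [e2]
          simp only
          linarith
      · intro k hk
        rcases (by omega : k + 1 ≤ M ∨ k = M ∨ k = M + 1) with h1 | rfl | rfl
        · rw [e0 _ h1, e0 _ (by omega)]; exact hwi k h1
        · rw [e1, e0 k le_rfl]; simp only [hm]; linarith
        · rw [e2, e1]; simp only [hm]; linarith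
      · rw [e2]
        convert hext' using 1
        rw [Set.biUnion_lt_succ, Set.biUnion_lt_succ, iUnion_segment_congr e0, e1, e2, e0 M le_rfl,
          Set.union_assoc, Set.union_assoc, segment_union_midpoint hsum]
    · obtain ⟨w, hw0, hwp, hwm, hwB, hwi, hext⟩ := ih M (by omega) hcM
        (fun k hk => hcr k (by omega)) (fun k hk => hy k (by omega))
      obtain ⟨t, ht, hext'⟩ := hext.extend (P := p (M + 1)) (by rw [hwp]; exact ne M (by omega))
        (by rw [hwp]; exact hy M (by omega)) (max B (w M).2)
      have ht1 := (le_max_left _ _).trans_lt ht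
      have ht2 := (le_max_right _ _).trans_lt ht
      set w' : ℕ → Space := fun k => if k ≤ M then w k else (p k, t) with hw'
      have e0 : ∀ k ≤ M, w' k = w k := fun k hk => by simp [hw', hk]
      have e1 : w' (M + 1) = (p (M + 1), t) := by simp [hw']
      refine ⟨w', by rw [e0 0 (by omega), hw0], ?_, ?_, ?_, ?_, ?_⟩
      · intro k
        simp only [hw']
        split_ifs with h1
        · exact hwp k
        · rfl
      · intro k hk hck
        rcases (by omega : k + 2 ≤ M ∨ k + 1 = M) with h1 | h1
        · rw [e0 k (by omega), e0 _ h1, e0 _ (by omega)]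
          exact hwm k (by omega) hck
        · exact absurd (h1 ▸ hck) hcM
      · intro k hk
        rcases (by omega : k + 1 ≤ M ∨ k = M) with h1 | rfl
        · rw [e0 _ h1]; exact hwB k h1
        · rw [e1]; exact ht1
      · intro k hk
        rcases (by omega : k + 1 ≤ M ∨ k = M) with h1 | rfl
        · rw [e0 _ h1, e0 _ (by omega)]; exact hwi k h1
        · rw [e1, e0 k le_rfl]; exact ht2
      · rw [e1]
        convert hext' using 1
        rw [Set.biUnion_lt_succ, iUnion_segment_congr e0, e1, e0 M le_rfl, Set.union_assoc]

/-! ### Plane geometry of small push-offs. -/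

/-- The determinant of two vectors of the plane. -/
def cross (u v : Plane) : ℝ := u.1 * v.2 - u.2 * v.1

lemma cross_smul_left (c : ℝ) (u v : Plane) : cross (c • u) v = c * cross u v := by
  simp only [cross, Prod.smul_fst, Prod.smul_snd, smul_eq_mul]; ring

lemma cross_smul_right (c : ℝ) (u v : Plane) : cross u (c • v) = c * cross u v := by
  simp only [cross, Prod.smul_fst, Prod.smul_snd, smul_eq_mul]; ring

lemma cross_add_right (u v w : Plane) : cross u (v + w) = cross u v + cross u w := by
  simp only [cross, Prod.fst_add, Prod.snd_add]; ring

lemma cross_sub_right (u v w : Plane) : cross u (v - w) = cross u v - cross u w := by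
  simp only [cross, Prod.fst_sub, Prod.snd_sub]; ring

lemma cross_sub_left (u v w : Plane) : cross (u - v) w = cross u w - cross v w := by
  simp only [cross, Prod.fst_sub, Prod.snd_sub]; ring

lemma cross_swap (u v : Plane) : cross u v = -cross v u := by
  simp only [cross]; ring

@[simp] lemma cross_self (u : Plane) : cross u u = 0 := by
  simp only [cross]; ring

@[simp] lemma cross_zero (u : Plane) : cross u 0 = 0 := by
  simp [cross]

section eventually

variable {a b c d : Plane}

/-- Disjointness is an open condition on the ends, since the two parameters range over a compact
square. -/
lemma eventually_disjoint_segment (h : Disjoint (segment ℝ a b) (segment ℝ c d))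
    (a' b' c' d' : Plane) :
    ∀ᶠ ε in 𝓝 (0 : ℝ), Disjoint (segment ℝ (a + ε • a') (b + ε • b'))
      (segment ℝ (c + ε • c') (d + ε • d')) := by
  have hK : IsCompact (Set.Icc (0 : ℝ) 1 ×ˢ Set.Icc (0 : ℝ) 1) := isCompact_Icc.prod isCompact_Icc
  have key : ∀ᶠ ε in 𝓝 (0 : ℝ), ∀ q ∈ Set.Icc (0 : ℝ) 1 ×ˢ Set.Icc (0 : ℝ) 1,
      (a + ε • a') + q.1 • ((b + ε • b') - (a + ε • a')) ≠
        (c + ε • c') + q.2 • ((d + ε • d') - (c + ε • c')) := by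
    refine hK.eventually_forall_of_forall_eventually fun q hq => ?_
    have hcont : ContinuousAt (fun z : ℝ × ℝ × ℝ =>
        ((a + z.1 • a') + z.2.1 • ((b + z.1 • b') - (a + z.1 • a'))) -
          ((c + z.1 • c') + z.2.2 • ((d + z.1 • d') - (c + z.1 • c')))) (0, q) := by fun_prop
    refine (hcont.eventually_ne (y := 0) ?_).mono fun z hz => sub_ne_zero.1 hz
    simp only [zero_smul, add_zero]
    refine sub_ne_zero.2 fun he => Set.disjoint_left.1 h
      (show a + q.1 • (b - a) ∈ segment ℝ a b from ?_) ?_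
    · rw [segment_eq_image']; exact ⟨q.1, hq.1, rfl⟩
    · rw [segment_eq_image']; exact ⟨q.2, hq.2, he.symm⟩
  filter_upwards [key] with ε hε
  rw [Set.disjoint_left]
  intro x hx hx'
  rw [segment_eq_image'] at hx hx'
  obtain ⟨s, hs, rfl⟩ := hx
  obtain ⟨t, ht, hst⟩ := hx'
  exact hε (s, t) ⟨hs, ht⟩ hst.symm

lemma eq_of_mem_segment_of_mem_segment {u v x : Plane} (h : 0 ∉ segment ℝ u (-v))
    (h1 : x ∈ segment ℝ b (b + u)) (h2 : x ∈ segment ℝ b (b + v)) : x = b := by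
  obtain ⟨δ, hδ, hδ'⟩ := exists_pos_mul_le_norm h
  rw [segment_eq_image'] at h1 h2
  obtain ⟨s, hs, rfl⟩ := h1
  obtain ⟨t, ht, hst⟩ := h2
  have h0 : s • u + t • -v = 0 := by
    simp only [add_sub_cancel_left, add_right_inj] at hst
    rw [← hst]
    simp
  have := hδ' s t hs.1 ht.1
  rw [h0, norm_zero] at this
  have hst : s + t ≤ 0 := by
    by_contra hlt
    push Not at hlt
    nlinarith [mul_pos hδ hlt]
  have : s = 0 := le_antisymm (by linarith [ht.1]) hs.1
  simp [this]

/-- That two edges at `b` do not leave in the same direction is itself a disjointness from the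
degenerate segment `{0}`, so it survives a small perturbation. -/
lemma eventually_inter_eq (h : 0 ∉ segment ℝ (a - b) (-(c - b))) (a' b' c' : Plane) :
    ∀ᶠ ε in 𝓝 (0 : ℝ), ∀ x ∈ segment ℝ (b + ε • b') (a + ε • a'),
      x ∈ segment ℝ (b + ε • b') (c + ε • c') → x = b + ε • b' := by
  have h0 : Disjoint (segment ℝ (a - b) (-(c - b))) (segment ℝ (0 : Plane) 0) := by
    simpa using h
  filter_upwards [eventually_disjoint_segment h0 (a' - b') (-(c' - b')) 0 0] with ε hε x h1 h2
  refine eq_of_mem_segment_of_mem_segment (u := (a - b) + ε • (a' - b'))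
    (v := (c - b) + ε • (c' - b')) ?_ ?_ ?_
  · simp only [smul_zero, add_zero, segment_same, Set.disjoint_singleton_right] at hε
    convert hε using 3
    module
  · convert h1 using 2; module
  · convert h2 using 2; module

/-- The short segment shrinks with `ε`, so `eventually_inter_eq` does not apply to it. It is
therefore lengthened to the fixed vector `-n`, which is legitimate once `ε < 1`. -/
lemma eventually_cap_inter_eq {n : Plane} (h : cross (c - b) n ≠ 0) (c' : Plane) :
    ∀ᶠ ε in 𝓝[>] (0 : ℝ), ∀ x ∈ segment ℝ b (b + ε • n),
      x ∈ segment ℝ (b + ε • n) (c + ε • c') → x = b + ε • n := by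
  have h0 : Disjoint (segment ℝ (-n) (-(c - b))) (segment ℝ (0 : Plane) 0) := by
    rw [segment_same, Set.disjoint_singleton_right]
    rintro ⟨s, t, hs, ht, hst, h0⟩
    have h1 := congrArg (cross (c - b)) h0
    rw [cross_add_right, cross_smul_right, cross_smul_right, ← neg_one_smul ℝ n,
      ← neg_one_smul ℝ (c - b), cross_smul_right, cross_smul_right, cross_self, cross_zero] at h1
    have hs0 : s = 0 := by
      by_contra hs0
      apply h
      have : s * cross (c - b) n = 0 := by linarith
      exact (mul_eq_zero.1 this).resolve_left hs0
    have ht1 : t = 1 := by linarith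
    rw [hs0, ht1] at h0
    have : c - b = 0 := neg_eq_zero.1 (by simpa using h0)
    rw [this] at h
    simp [cross] at h
  have h01 : ∀ᶠ ε in 𝓝[>] (0 : ℝ), ε ∈ Set.Ioo (0 : ℝ) 1 := Ioo_mem_nhdsGT one_pos
  filter_upwards [(eventually_disjoint_segment h0 0 (-(c' - n)) 0 0).filter_mono
    nhdsWithin_le_nhds, h01] with ε hε hε1 x h1 h2
  refine eq_of_mem_segment_of_mem_segment (u := -n) (v := (c - b) + ε • (c' - n)) ?_ ?_ ?_
  · simp only [smul_zero, add_zero, segment_same, Set.disjoint_singleton_right] at hε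
    convert hε using 3
    module
  · rw [segment_symm, segment_eq_image'] at h1
    obtain ⟨t, ht, rfl⟩ := h1
    rw [segment_eq_image']
    refine ⟨t * ε, ⟨by nlinarith [ht.1, hε1.1], by nlinarith [ht.1, ht.2, hε1.1, hε1.2]⟩, ?_⟩
    simp only
    module
  · convert h2 using 2; module

lemma cap_inter_eq {n x : Plane} {ε : ℝ} (hε : ε ≠ 0) (h : cross (c - b) n ≠ 0)
    (h1 : x ∈ segment ℝ b (b + ε • n)) (h2 : x ∈ segment ℝ b c) : x = b := by
  rw [segment_eq_image'] at h1 h2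
  obtain ⟨s, hs, rfl⟩ := h1
  obtain ⟨t, ht, hst⟩ := h2
  have h3 := congrArg (fun z => cross (c - b) (z - b)) hst
  simp only [add_sub_cancel_left, cross_smul_right, cross_self, mul_zero] at h3
  have : s = 0 := by
    by_contra hs0
    exact mul_ne_zero hs0 (mul_ne_zero hε h) h3.symm
  simp [this]

/-- A segment and its push-off to one side meet only at ends that are not pushed. -/
lemma pushoff_inter {n n' x : Plane} {τ ε : ℝ} (hε : 0 < ε) (hn : n = 0 ∨ 0 < τ * cross (b - a) n)
    (hn' : n' = 0 ∨ 0 < τ * cross (b - a) n') (hnn : ¬ (n = 0 ∧ n' = 0))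
    (h1 : x ∈ segment ℝ a b) (h2 : x ∈ segment ℝ (a + ε • n) (b + ε • n')) :
    (n = 0 ∧ x = a) ∨ (n' = 0 ∧ x = b) := by
  rw [segment_eq_image'] at h1
  obtain ⟨s, hs, rfl⟩ := h1
  obtain ⟨α, β, hα, hβ, hαβ, he⟩ := h2
  have h3 := congrArg (fun z => cross (b - a) (z - a)) he
  have h4 : α • (a + ε • n) + β • (b + ε • n') - a =
      β • (b - a) + ε • (α • n + β • n') := by
    obtain rfl : α = 1 - β := by linarith
    module
  simp only [h4, add_sub_cancel_left, cross_add_right, cross_smul_right, cross_self, mul_zero,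
    zero_add, mul_eq_zero, hε.ne', false_or] at h3
  have h5 : α * (τ * cross (b - a) n) + β * (τ * cross (b - a) n') = 0 := by
    linear_combination τ * h3
  rcases hn with rfl | hn
  · rcases hn' with rfl | hn'
    · simp at hnn
    · left
      simp only [cross_zero, mul_zero, zero_add] at h5
      have hβ0 : β = 0 := (mul_eq_zero.1 h5).resolve_right hn'.ne'
      have hα1 : α = 1 := by linarith
      refine ⟨rfl, ?_⟩
      rw [← he]
      simp [hβ0, hα1]
  · rcases hn' with rfl | hn'
    · right
      simp only [cross_zero, mul_zero, add_zero] at h5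
      have hα0 : α = 0 := (mul_eq_zero.1 h5).resolve_right hn.ne'
      have hβ1 : β = 1 := by linarith
      refine ⟨rfl, ?_⟩
      rw [← he]
      simp [hα0, hβ1]
    · exfalso
      rcases hα.eq_or_lt with h6 | h6
      · have : β = 1 := by linarith
        rw [← h6, this] at h5
        linarith
      · nlinarith [mul_pos h6 hn, mul_nonneg hβ hn'.le]

/-- Near a vertex `b` of a path `a, b, c`, the push-off of `[a, b]` to one side of the path does not
meet `[b, c]`. -/
lemma eventually_pushoff_disjoint {n n' : Plane} {τ : ℝ} (hn : n = 0 ∨ 0 < τ * cross (b - a) n)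
    (hn' : 0 < τ * cross (b - a) n') (hn'' : 0 < τ * cross (c - b) n') (ha : a ∉ segment ℝ b c) :
    ∀ᶠ ε in 𝓝[>] (0 : ℝ), Disjoint (segment ℝ (a + ε • n) (b + ε • n')) (segment ℝ b c) := by
  have hpos : ∀ᶠ ε in 𝓝[>] (0 : ℝ), 0 < ε := eventually_mem_nhdsWithin
  -- If the path does not turn towards the pushed side at `b`, the line through `a` and `b`
  -- separates `[b, c]` from the push-off, except possibly at an unpushed `a`, which `ha` excludes.
  rcases le_or_gt (τ * cross (b - a) (c - b)) 0 with h | h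
  · filter_upwards [hpos] with ε hε
    rw [Set.disjoint_left]
    rintro x ⟨α, β, hα, hβ, hαβ, rfl⟩ h2
    rw [segment_eq_image'] at h2
    obtain ⟨t, ht, he⟩ := h2
    have h3 := congrArg (fun z => τ * cross (b - a) (z - b)) he
    have h4 : α • (a + ε • n) + β • (b + ε • n') - b =
        (-α) • (b - a) + ε • (α • n + β • n') := by
      obtain rfl : α = 1 - β := by linarith
      module
    simp only [h4, add_sub_cancel_left, cross_add_right, cross_smul_right, cross_self, mul_zero,
      zero_add] at h3
    have h5 : 0 ≤ τ * cross (b - a) n := by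
      rcases hn with rfl | hn
      · simp
      · exact hn.le
    have h6 : t * (τ * cross (b - a) (c - b)) ≤ 0 := mul_nonpos_of_nonneg_of_nonpos ht.1 h
    have h7 : ε * (α * (τ * cross (b - a) n) + β * (τ * cross (b - a) n')) ≤ 0 := by
      linarith
    have h8 : α * (τ * cross (b - a) n) + β * (τ * cross (b - a) n') ≤ 0 := by
      by_contra h8
      push Not at h8
      exact absurd (mul_pos hε h8) (not_lt.2 h7)
    have hβ0 : β = 0 := by
      by_contra hβ0
      have : 0 < β := lt_of_le_of_ne hβ (Ne.symm hβ0)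
      nlinarith [mul_pos this hn', mul_nonneg hα h5]
    have hα1 : α = 1 := by linarith
    rcases hn with rfl | hn
    · apply ha
      rw [segment_eq_image']
      exact ⟨t, ht, by rw [he]; simp [hβ0, hα1]⟩
    · rw [hβ0, hα1] at h8
      linarith
  -- If the path turns towards the pushed side, `a` is strictly on that side of the line through `b`
  -- and `c`, and so is the whole push-off.
  · have hev : ∀ᶠ ε in 𝓝[>] (0 : ℝ), 0 < τ * cross (c - b) (a + ε • n - b) := by
      have hcont : ContinuousAt (fun ε : ℝ => τ * cross (c - b) (a + ε • n - b)) 0 := by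
        unfold cross
        fun_prop
      refine (hcont.eventually_const_lt ?_).filter_mono nhdsWithin_le_nhds
      simp only [zero_smul, add_zero]
      convert h using 1
      simp only [cross, Prod.fst_sub, Prod.snd_sub]
      ring
    filter_upwards [hpos, hev] with ε hε hev
    rw [Set.disjoint_left]
    rintro x ⟨α, β, hα, hβ, hαβ, rfl⟩ h2
    rw [segment_eq_image'] at h2
    obtain ⟨t, ht, he⟩ := h2
    have h3 := congrArg (fun z => τ * cross (c - b) (z - b)) he
    have h4 : α • (a + ε • n) + β • (b + ε • n') - b =
        α • (a + ε • n - b) + (β * ε) • n' := by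
      obtain rfl : α = 1 - β := by linarith
      module
    simp only [h4, add_sub_cancel_left, cross_add_right, cross_smul_right, cross_self, mul_zero] at h3
    have h5 : 0 = α * (τ * cross (c - b) (a + ε • n - b)) + β * ε * (τ * cross (c - b) n') := by
      linear_combination h3
    have h6 : 0 < ε * (τ * cross (c - b) n') := mul_pos hε hn''
    rcases hα.eq_or_lt with h7 | h7
    · have : β = 1 := by linarith
      rw [← h7, this] at h5
      linarith
    · nlinarith [mul_pos h7 hev, mul_nonneg hβ h6.le]

end eventually

/-- Two vectors that are not oppositely directed lie on the same side of a line. -/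
lemma exists_cross_pos {u v : Plane} (hu : u ≠ 0) (h : 0 ∉ segment ℝ u v) :
    ∃ n : Plane, 0 < cross u n ∧ 0 < cross v n ∧
      (cross u v = 0 → n = ‖u‖⁻¹ • ((-u.2, u.1) : Plane)) := by
  have hsq : 0 < u.1 * u.1 + u.2 * u.2 := by
    by_contra hle
    apply hu
    ext1 <;> simp only [Prod.fst_zero, Prod.snd_zero] <;>
      nlinarith [mul_self_nonneg u.1, mul_self_nonneg u.2]
  rcases lt_trichotomy (cross u v) 0 with h0 | h0 | h0
  · refine ⟨u - v, ?_, ?_, fun h1 => absurd h1 h0.ne⟩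
    · rw [cross_sub_right, cross_self]; linarith
    · rw [cross_sub_right, cross_self, cross_swap v u]; linarith
  · have hinv : 0 < ‖u‖⁻¹ := inv_pos.2 (norm_pos_iff.2 hu)
    -- The normalisation makes this vector depend only on the direction of `u`, so the vectors
    -- chosen on the two sides of a crossing can be compared.
    refine ⟨‖u‖⁻¹ • ((-u.2, u.1) : Plane), ?_, ?_, fun _ => rfl⟩
    · rw [cross_smul_right]
      refine mul_pos hinv ?_
      simp only [cross]
      linarith
    · rw [cross_smul_right]
      refine mul_pos hinv ?_
      by_contra hle
      apply h
      simp only [cross] at hle h0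
      set p := u.1 * v.1 + u.2 * v.2 with hp
      set q := u.1 * u.1 + u.2 * u.2 with hq
      have hp0 : p ≤ 0 := by linarith
      -- Here `v` would be `p / q` times `u` with `p ≤ 0`; these weights make the convex combination
      -- of `u` and `v` vanish.
      refine ⟨-p / (q - p), q / (q - p), div_nonneg (by linarith) (by linarith),
        div_nonneg hsq.le (by linarith), ?_, ?_⟩
      · rw [← add_div, div_eq_one_iff_eq (by linarith)]
        ring
      · have hne : q - p ≠ 0 := by linarith
        ext1
        · simp only [Prod.fst_add, Prod.smul_fst, smul_eq_mul, Prod.fst_zero]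
          field_simp
          rw [hp, hq]
          linear_combination (-u.2) * h0
        · simp only [Prod.snd_add, Prod.smul_snd, smul_eq_mul, Prod.snd_zero]
          field_simp
          rw [hp, hq]
          linear_combination u.1 * h0
  · refine ⟨v - u, ?_, ?_, fun h1 => absurd h1 h0.ne'⟩
    · rw [cross_sub_right, cross_self]; linarith
    · rw [cross_sub_right, cross_self, cross_swap v u]; linarith

/-! ### Subdivision of polygons. -/

lemma eq_of_mem_segment_of_mem_segment' {E : Type*} [AddCommGroup E] [Module ℝ E] {x y z u : E}
    (hz : z ∈ segment ℝ x y) (h1 : u ∈ segment ℝ x z) (h2 : u ∈ segment ℝ z y) : u = z := by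
  rw [mem_segment_iff_wbtw] at *
  exact (wbtw_swap_right_iff ℝ x).1 ⟨h1, hz.trans_right_left h2⟩

lemma segment_union_segment {E : Type*} [AddCommGroup E] [Module ℝ E] {x y z : E}
    (hz : z ∈ segment ℝ x y) : segment ℝ x z ∪ segment ℝ z y = segment ℝ x y := by
  rw [segment_eq_image_lineMap] at hz
  obtain ⟨t, ht, rfl⟩ := hz
  have key : ∀ s r : ℝ, s ≤ r → segment ℝ (AffineMap.lineMap x y s) (AffineMap.lineMap x y r) =
      AffineMap.lineMap x y '' Set.Icc s r := by
    intro s r h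
    rw [← segment_eq_Icc h, image_segment]
  have h1 := key 0 t ht.1
  have h2 := key t 1 ht.2
  have h3 := key 0 1 zero_le_one
  rw [AffineMap.lineMap_apply_zero] at h1 h3
  rw [AffineMap.lineMap_apply_one] at h2 h3
  rw [h1, h2, h3, ← Set.image_union, Set.Icc_union_Icc_eq_Icc ht.1 ht.2]

/-- Finitely many points of a polygonal link can be added to its vertices. -/
lemma IsPolygon.exists_refinement {ι : Type} [Finite ι] {next : Equiv.Perm ι} {v : ι → Space}
    (h : IsPolygon next v) {Y : Set Space} (hY : Y.Finite)
    (hYv : Y ⊆ ⋃ i, segment ℝ (v i) (v (next i))) :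
    ∃ (κ : Type) (_ : Finite κ) (next' : Equiv.Perm κ) (v' : κ → Space), IsPolygon next' v' ∧
      (⋃ i, segment ℝ (v' i) (v' (next' i))) = (⋃ i, segment ℝ (v i) (v (next i))) ∧
      Y ⊆ Set.range v' := by
  classical
  induction Y, hY using Set.Finite.induction_on with
  | empty => exact ⟨ι, inferInstance, next, v, h, rfl, Set.empty_subset _⟩
  | @insert z Y _ _ ih =>
    obtain ⟨κ, _, next', v', h', hu, hr⟩ := ih fun y hy => hYv (Set.mem_insert_of_mem _ hy)
    by_cases hz : z ∈ Set.range v'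
    · exact ⟨κ, inferInstance, next', v', h', hu, Set.insert_subset hz hr⟩
    have hzu := hYv (Set.mem_insert z Y)
    rw [← hu, Set.mem_iUnion] at hzu
    obtain ⟨i, hi⟩ := hzu
    have hx : v' i ≠ z := fun h => hz ⟨i, h⟩
    have hy : z ≠ v' (next' i) := fun h => hz ⟨_, h.symm⟩
    have hsub1 : segment ℝ (v' i) z ⊆ segment ℝ (v' i) (v' (next' i)) :=
      (segment_union_segment hi) ▸ Set.subset_union_left
    have hsub2 : segment ℝ z (v' (next' i)) ⊆ segment ℝ (v' i) (v' (next' i)) :=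
      (segment_union_segment hi) ▸ Set.subset_union_right
    refine ⟨Option κ, inferInstance, insertNext next' i, fun o => o.elim z v', h'.insert
      (fun j hj u hu1 hu2 => ?_) (fun j hj u hu1 hu2 => ?_)
      (fun u hu1 hu2 => eq_of_mem_segment_of_mem_segment' hi hu1 hu2) hx hy, ?_, ?_⟩
    · rcases h'.inter hj.symm (hsub1 hu1) hu2 with ⟨h1, -⟩ | ⟨h1, h2⟩
      · exact h1
      · rw [h1, ← h2] at hu1
        exact absurd (eq_of_mem_segment_of_mem_segment' hi hu1 (right_mem_segment ℝ _ _)).symm hy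
    · rcases h'.inter hj.symm (hsub2 hu1) hu2 with ⟨h1, -⟩ | ⟨h1, h2⟩
      · rw [h1] at hu1
        exact absurd (eq_of_mem_segment_of_mem_segment' hi (left_mem_segment ℝ _ _) hu1) hx
      · rw [h1, h2]
    · rw [← hu]
      ext u
      simp only [Set.mem_iUnion]
      constructor
      · rintro ⟨_ | j, hj⟩
        · exact ⟨i, hsub2 (by simpa using hj)⟩
        · by_cases hji : j = i
          · subst hji
            exact ⟨j, hsub1 (by simpa using hj)⟩
          · exact ⟨j, by simpa [insertNext_of_ne hji] using hj⟩
      · rintro ⟨j, hj⟩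
        by_cases hji : j = i
        · subst hji
          rw [← segment_union_segment hi] at hj
          rcases hj with hj | hj
          · exact ⟨some j, by simpa using hj⟩
          · exact ⟨none, by simpa using hj⟩
        · exact ⟨some j, by simpa [insertNext_of_ne hji] using hj⟩
    · rintro u (rfl | hu)
      · exact ⟨none, rfl⟩
      · obtain ⟨j, rfl⟩ := hr hu
        exact ⟨some j, rfl⟩

/-! ### Polygons whose projection has only `n`-crossings. -/

/-- Another vertex has the same projection as the vertex `v i`. -/
def IsCrossingVertex {ι : Type} (v : ι → Space) (i : ι) : Prop := ∃ j ≠ i, (v j).1 = (v i).1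

section HasOnlyCrossings

variable {n : ℕ} {L : Link} {ι : Type} {next : Equiv.Perm ι} {v : ι → Space}

lemma fiber_finite (hL : HasOnlyCrossings n L) {p : Plane} (hp : p ∈ singularPoints L) :
    (fiber L p).Finite :=
  Set.finite_of_encard_eq_coe (hL.2 p hp).1

lemma segment_infinite {E : Type*} [AddCommGroup E] [Module ℝ E] {x y : E} (h : x ≠ y) :
    (segment ℝ x y).Infinite := by
  rw [segment_eq_image_lineMap]
  exact (Set.Icc_infinite one_pos).image (lineMap_injective' h).injOn

/-- A vertical edge would put infinitely many points of the link over a single singular point. -/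
lemma IsPolygon.fst_ne (hv : IsPolygon next v) (hL : HasOnlyCrossings n L)
    (hLv : L.carrier = ⋃ i, segment ℝ (v i) (v (next i))) (i : ι) :
    (v i).1 ≠ (v (next i)).1 := by
  intro he
  have hsub : segment ℝ (v i) (v (next i)) ⊆ fiber L (v i).1 := by
    intro z hz
    refine ⟨hLv ▸ Set.mem_iUnion.2 ⟨i, hz⟩, ?_⟩
    have := fst_mem_segment hz
    rw [← he, segment_same] at this
    exact this
  have hs : (v i).1 ∈ singularPoints L :=
    ⟨v i, hsub (left_mem_segment ℝ _ _), v (next i), hsub (right_mem_segment ℝ _ _), hv.ne i⟩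
  exact segment_infinite (hv.ne i) ((fiber_finite hL hs).subset hsub)

lemma exists_mem_segment_of_fst {a b : Space} {c : Plane} (hc : c ∈ segment ℝ a.1 b.1) :
    ∃ z ∈ segment ℝ a b, z.1 = c := by
  obtain ⟨s, t, hs, ht, hst, rfl⟩ := hc
  exact ⟨_, ⟨s, t, hs, ht, hst, rfl⟩, rfl⟩

lemma mem_singularPoints {L : Link} {z z' : Space} (hz : z ∈ L.carrier) (hz' : z' ∈ L.carrier)
    (h : z ≠ z') (he : z.1 = z'.1) : z.1 ∈ singularPoints L :=
  ⟨z, ⟨hz, rfl⟩, z', ⟨hz', he.symm⟩, h⟩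

lemma vertex_mem_carrier (hLv : L.carrier = ⋃ i, segment ℝ (v i) (v (next i))) (i : ι) :
    v i ∈ L.carrier :=
  hLv ▸ Set.mem_iUnion.2 ⟨i, left_mem_segment ℝ _ _⟩

lemma IsCrossingVertex.mem_singularPoints (hv : IsPolygon next v)
    (hLv : L.carrier = ⋃ i, segment ℝ (v i) (v (next i))) {i : ι} (hi : IsCrossingVertex v i) :
    (v i).1 ∈ singularPoints L := by
  obtain ⟨j, hj, he⟩ := hi
  exact Multicrossing.mem_singularPoints (vertex_mem_carrier hLv i) (vertex_mem_carrier hLv j)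
    (fun h => hj (hv.injective h).symm) he.symm

/-- If the points of the two edges over `c` coincide, the edges meet in space, at a common vertex.
If they differ, `c` is singular and `hY` makes both of them vertices. -/
lemma IsPolygon.inter_fst (hv : IsPolygon next v)
    (hLv : L.carrier = ⋃ i, segment ℝ (v i) (v (next i)))
    (hY : ∀ z ∈ L.carrier, z.1 ∈ singularPoints L → z ∈ Set.range v) {i j : ι} (hij : i ≠ j)
    {c : Plane} (hi : c ∈ segment ℝ (v i).1 (v (next i)).1)
    (hj : c ∈ segment ℝ (v j).1 (v (next j)).1) :
    ∃ a, (a = i ∨ a = next i) ∧ ∃ b, (b = j ∨ b = next j) ∧ (v a).1 = c ∧ (v b).1 = c := by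
  obtain ⟨z, hz, rfl⟩ := exists_mem_segment_of_fst hi
  obtain ⟨z', hz', he⟩ := exists_mem_segment_of_fst hj
  have hzL : z ∈ L.carrier := hLv ▸ Set.mem_iUnion.2 ⟨i, hz⟩
  have hzL' : z' ∈ L.carrier := hLv ▸ Set.mem_iUnion.2 ⟨j, hz'⟩
  by_cases hzz : z = z'
  · subst hzz
    rcases hv.inter hij hz hz' with ⟨rfl, h⟩ | ⟨rfl, h⟩
    · exact ⟨i, Or.inl rfl, i, Or.inr h.symm, rfl, rfl⟩
    · exact ⟨j, Or.inr h.symm, j, Or.inl rfl, rfl, rfl⟩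
  · have hs := mem_singularPoints hzL hzL' hzz he.symm
    obtain ⟨a, rfl⟩ := hY z hzL hs
    obtain ⟨b, rfl⟩ := hY z' hzL' (he ▸ hs)
    exact ⟨a, hv.vertex_mem hz, b, hv.vertex_mem hz', rfl, he⟩

lemma IsCrossingVertex.ncard (hv : IsPolygon next v) (hL : HasOnlyCrossings n L)
    (hLv : L.carrier = ⋃ i, segment ℝ (v i) (v (next i)))
    (hY : ∀ z ∈ L.carrier, z.1 ∈ singularPoints L → z ∈ Set.range v) {i : ι}
    (hi : IsCrossingVertex v i) : {j | (v j).1 = (v i).1}.ncard = n := by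
  have hs := hi.mem_singularPoints hv hLv
  have hf : v '' {j | (v j).1 = (v i).1} = fiber L (v i).1 := by
    ext z
    constructor
    · rintro ⟨j, hj, rfl⟩
      exact ⟨vertex_mem_carrier hLv j, hj⟩
    · rintro ⟨hz, he⟩
      obtain ⟨j, rfl⟩ := hY z hz (he ▸ hs)
      exact ⟨j, he, rfl⟩
  rw [← Set.ncard_image_of_injective _ hv.injective, hf, Set.ncard_def, (hL.2 _ hs).1]
  simp

/-- The link is straight at a vertex that is projected to a crossing. -/
lemma IsCrossingVertex.straight (hv : IsPolygon next v) (hL : HasOnlyCrossings n L)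
    (hLv : L.carrier = ⋃ i, segment ℝ (v i) (v (next i))) {i : ι} (hi : IsCrossingVertex v i) :
    ∃ κ : ℝ, 0 < κ ∧ v (next.symm i) - v i = -κ • (v (next i) - v i) := by
  have hs := hi.mem_singularPoints hv hLv
  obtain ⟨-, d, hd, -⟩ := hL.2 _ hs
  have hst := hd (v i) ⟨vertex_mem_carrier hLv i, rfl⟩
  -- Each edge at `v i` has the direction of the strand there; the sign of the factor between the
  -- two edges remains to be found.
  have key : ∀ a : Space, (∀ s ∈ Set.Ioo (0 : ℝ) 1, v i + s • a ∈ L.carrier) → a ≠ 0 →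
      ∃ c : ℝ, c ≠ 0 ∧ d (v i) = c • a := by
    intro a ha ha0
    have hcont : Filter.Tendsto (fun s : ℝ => v i + s • a) (𝓝[>] 0) (𝓝 (v i)) := by
      have : ContinuousAt (fun s : ℝ => v i + s • a) 0 := by fun_prop
      have h2 := this.tendsto
      simp only [zero_smul, add_zero] at h2
      exact h2.mono_left nhdsWithin_le_nhds
    have h01 : ∀ᶠ ε in 𝓝[>] (0 : ℝ), ε ∈ Set.Ioo (0 : ℝ) 1 := Ioo_mem_nhdsGT one_pos
    obtain ⟨s, hs1, hs2⟩ := ((hcont.eventually hst).and h01).exists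
    obtain ⟨t, ht⟩ := hs1.1 (ha s hs2)
    rw [add_right_inj] at ht
    have ht0 : t ≠ 0 := by
      rintro rfl
      rw [zero_smul] at ht
      exact (smul_ne_zero hs2.1.ne' ha0) ht
    refine ⟨t⁻¹ * s, mul_ne_zero (inv_ne_zero ht0) hs2.1.ne', ?_⟩
    rw [mul_smul, ht, smul_smul, inv_mul_cancel₀ ht0, one_smul]
  have hni : next (next.symm i) = i := by simp
  have ha0 : v (next i) - v i ≠ 0 := sub_ne_zero.2 (hv.ne i).symm
  have hb0 : v (next.symm i) - v i ≠ 0 := by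
    have := hv.ne (next.symm i)
    rw [hni] at this
    exact sub_ne_zero.2 this
  obtain ⟨c, hc0, hc⟩ := key (v (next i) - v i) (fun s hs => by
    rw [hLv]
    refine Set.mem_iUnion.2 ⟨i, ?_⟩
    rw [segment_eq_image']
    exact ⟨s, ⟨hs.1.le, hs.2.le⟩, rfl⟩) ha0
  obtain ⟨c', hc0', hc'⟩ := key (v (next.symm i) - v i) (fun s hs => by
    rw [hLv]
    refine Set.mem_iUnion.2 ⟨next.symm i, ?_⟩
    rw [hni, segment_symm, segment_eq_image']
    exact ⟨s, ⟨hs.1.le, hs.2.le⟩, rfl⟩) hb0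
  have hba : v (next.symm i) - v i = (c'⁻¹ * c) • (v (next i) - v i) := by
    rw [mul_smul, ← hc, hc', smul_smul, inv_mul_cancel₀ hc0', one_smul]
  have hl0 : c'⁻¹ * c ≠ 0 := mul_ne_zero (inv_ne_zero hc0') hc0
  rcases lt_or_gt_of_ne hl0 with hneg | hpos
  · exact ⟨-(c'⁻¹ * c), by linarith, by rw [neg_neg]; exact hba⟩
  -- With a positive factor the two edges would overlap near `v i`; the bounds `1 / 2` and `l / 2`
  -- on `s` give a common point strictly inside both.
  · exfalso
    set l := c'⁻¹ * c with hl
    have hne : i ≠ next.symm i := by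
      intro h
      rw [← h, sub_self] at hb0
      exact hb0 rfl
    set s := min (1 / 2) (l / 2) with hsdef
    have hs0 : 0 < s := lt_min (by norm_num) (by linarith)
    have hs1 : s ≤ 1 / 2 := min_le_left _ _
    have hs2 : s ≤ l / 2 := min_le_right _ _
    have m1 : v i + s • (v (next i) - v i) ∈ segment ℝ (v i) (v (next i)) := by
      rw [segment_eq_image']
      exact ⟨s, ⟨hs0.le, by linarith⟩, rfl⟩
    have heq : v i + s • (v (next i) - v i) = v i + (s / l) • (v (next.symm i) - v i) := by
      rw [hba, smul_smul, div_mul_cancel₀ _ hl0]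
    have hsl : s / l ≤ 1 / 2 := by rw [div_le_iff₀ hpos]; linarith
    have m2 : v i + s • (v (next i) - v i) ∈
        segment ℝ (v (next.symm i)) (v (next (next.symm i))) := by
      rw [hni, segment_symm, segment_eq_image', heq]
      exact ⟨s / l, ⟨by positivity, by linarith⟩, rfl⟩
    rcases hv.inter hne m1 m2 with ⟨h, -⟩ | ⟨h, -⟩
    · exact smul_ne_zero hs0.ne' ha0 (by simpa using h)
    · rw [heq, ← eq_sub_iff_add_eq'] at h
      have : (1 - s / l) • (v (next.symm i) - v i) = 0 := by
        rw [sub_smul, one_smul, h, sub_self]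
      rcases smul_eq_zero.1 this with h1 | h1
      · linarith
      · exact hb0 h1

end HasOnlyCrossings

/-! ### Diagrams with symmetric neighbourhoods of the crossings. -/

/-- A refined link diagram: the projections of different edges of the polygonal link meet only in
end points, and the link is straight and symmetric near its crossings, each of which is passed by
`n` strands. On each component there is an edge far from the crossings. -/
structure IsDiagram (n : ℕ) {ι : Type} (next : Equiv.Perm ι) (v : ι → Space) : Prop where
  isPolygon : IsPolygon next v
  fst_ne : ∀ i, (v i).1 ≠ (v (next i)).1
  inter : ∀ i j, i ≠ j → ∀ c ∈ segment ℝ (v i).1 (v (next i)).1,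
    c ∈ segment ℝ (v j).1 (v (next j)).1 →
      ∃ a, (a = i ∨ a = next i) ∧ ∃ b, (b = j ∨ b = next j) ∧ (v a).1 = c ∧ (v b).1 = c
  add_eq : ∀ i, IsCrossingVertex v i → v (next i) + v (next.symm i) = (2 : ℝ) • v i
  straight_next : ∀ i, IsCrossingVertex v i → ∃ κ : ℝ, 0 < κ ∧
    (v (next (next i))).1 - (v (next i)).1 = κ • ((v (next i)).1 - (v i).1)
  straight_prev : ∀ i, IsCrossingVertex v i → ∃ κ : ℝ, 0 < κ ∧
    (v (next.symm i)).1 - (v (next.symm (next.symm i))).1 = κ • ((v i).1 - (v (next.symm i)).1)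
  not_next : ∀ i, IsCrossingVertex v i → ¬ IsCrossingVertex v (next i)
  not_prev : ∀ i, IsCrossingVertex v i → ¬ IsCrossingVertex v (next.symm i)
  exists_cut : ∀ i, ∃ c, next.SameCycle i c ∧ ¬ IsCrossingVertex v c ∧
    ¬ IsCrossingVertex v (next c)
  ncard : ∀ i, IsCrossingVertex v i → {j | (v j).1 = (v i).1}.ncard = n

section trisect

variable {ι : Type} (next : Equiv.Perm ι) (v : ι → Space) (r : ι → ℝ)

/-- The cyclic order of the vertices of a polygonal link after two new vertices have been added to
each edge. -/
def trisectNext : Equiv.Perm (ι × Fin 3) where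
  toFun q := (if q.2 = 2 then next q.1 else q.1, q.2 + 1)
  invFun q := (if q.2 = 0 then next.symm q.1 else q.1, q.2 - 1)
  left_inv := by
    rintro ⟨i, k⟩
    fin_cases k
    · rfl
    · rfl
    · exact Prod.ext (next.symm_apply_apply i) rfl
  right_inv := by
    rintro ⟨i, k⟩
    fin_cases k
    · exact Prod.ext (next.apply_symm_apply i) rfl
    · rfl
    · rfl

@[simp] lemma trisectNext_zero (i : ι) : trisectNext next (i, 0) = (i, 1) := rfl
@[simp] lemma trisectNext_one (i : ι) : trisectNext next (i, 1) = (i, 2) := rfl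
@[simp] lemma trisectNext_two (i : ι) : trisectNext next (i, 2) = (next i, 0) := rfl
@[simp] lemma trisectNext_symm_zero (i : ι) :
    (trisectNext next).symm (i, 0) = (next.symm i, 2) := rfl
@[simp] lemma trisectNext_symm_two (i : ι) : (trisectNext next).symm (i, 2) = (i, 1) := rfl

/-- The position of the vertex of index `k` on an edge. -/
def trisectParam (t : ℝ) (k : Fin 3) : ℝ := ![0, t, 1 - t] k

/-- The vertices of a polygonal link after two new vertices have been added to each edge, at
relative distance `r i` from the ends of the edge. -/
noncomputable def trisect (q : ι × Fin 3) : Space :=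
  AffineMap.lineMap (v q.1) (v (next q.1)) (trisectParam (r q.1) q.2)

@[simp] lemma trisect_zero (i : ι) : trisect next v r (i, 0) = v i := by
  simp [trisect, trisectParam]

lemma trisect_one (i : ι) :
    trisect next v r (i, 1) = AffineMap.lineMap (v i) (v (next i)) (r i) := by
  simp [trisect, trisectParam]

lemma trisect_two (i : ι) :
    trisect next v r (i, 2) = AffineMap.lineMap (v i) (v (next i)) (1 - r i) := by
  simp [trisect, trisectParam]

/-- The position on an edge of a point of one of its three parts. -/
def trisectEdgeParam (r : ℝ) (k : Fin 3) (t : ℝ) : ℝ :=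
  ![t * r, r + t * (1 - 2 * r), 1 - r + t * r] k

variable {next v r}

lemma lineMap_lineMap_lineMap {E : Type*} [AddCommGroup E] [Module ℝ E] (x y : E) (a b t : ℝ) :
    AffineMap.lineMap (AffineMap.lineMap x y a) (AffineMap.lineMap x y b) t =
      AffineMap.lineMap x y (a + t * (b - a)) := by
  simp only [AffineMap.lineMap_apply_module]
  module

lemma lineMap_trisect (i : ι) (k : Fin 3) (t : ℝ) :
    AffineMap.lineMap (trisect next v r (i, k)) (trisect next v r (trisectNext next (i, k))) t =
      AffineMap.lineMap (v i) (v (next i)) (trisectEdgeParam (r i) k t) := by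
  fin_cases k
  · simp only [Fin.zero_eta, trisectNext_zero, trisect_zero, trisect_one]
    simp [trisectEdgeParam, AffineMap.lineMap_apply_module]
    module
  · simp only [Fin.mk_one, trisectNext_one, trisect_one, trisect_two, lineMap_lineMap_lineMap]
    congr 1
    change r i + t * (1 - r i - r i) = r i + t * (1 - 2 * r i)
    ring
  · simp only [Fin.reduceFinMk, trisectNext_two, trisect_two, trisect_zero]
    simp [trisectEdgeParam, AffineMap.lineMap_apply_module]
    module

lemma trisectEdgeParam_mem {r : ℝ} (h0 : 0 < r) (h1 : r < 1 / 2) (k : Fin 3) {t : ℝ}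
    (ht : t ∈ Set.Ico (0 : ℝ) 1) : trisectEdgeParam r k t ∈ Set.Ico (0 : ℝ) 1 := by
  obtain ⟨ht0, ht1⟩ := ht
  fin_cases k <;> simp only [trisectEdgeParam] <;> simp <;> constructor <;> nlinarith

lemma trisectEdgeParam_inj {r : ℝ} (h0 : 0 < r) (h1 : r < 1 / 2) {k l : Fin 3} {s t : ℝ}
    (hs : s ∈ Set.Ico (0 : ℝ) 1) (ht : t ∈ Set.Ico (0 : ℝ) 1)
    (h : trisectEdgeParam r k s = trisectEdgeParam r l t) : k = l ∧ s = t := by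
  obtain ⟨hs0, hs1⟩ := hs
  obtain ⟨ht0, ht1⟩ := ht
  have h2 : 0 < 1 - 2 * r := by linarith
  have e1 := mul_lt_mul_of_pos_right hs1 h0
  have e2 := mul_lt_mul_of_pos_right ht1 h0
  have e3 := mul_lt_mul_of_pos_right hs1 h2
  have e4 := mul_lt_mul_of_pos_right ht1 h2
  have e5 := mul_nonneg hs0 h0.le
  have e6 := mul_nonneg ht0 h0.le
  have e7 := mul_nonneg hs0 h2.le
  have e8 := mul_nonneg ht0 h2.le
  fin_cases k <;> fin_cases l <;> simp [trisectEdgeParam] at h ⊢ <;> first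
    | (rcases h with h | h
       · exact h
       · linarith)
    | linarith

lemma IsPolygon.trisect (hv : IsPolygon next v) (h0 : ∀ i, 0 < r i) (h1 : ∀ i, r i < 1 / 2) :
    IsPolygon (trisectNext next) (trisect next v r) := by
  rintro ⟨⟨i, k⟩, s⟩ ⟨-, hs⟩ ⟨⟨j, l⟩, t⟩ ⟨-, ht⟩ he
  simp only [lineMap_trisect] at hs ht he
  obtain ⟨rfl, he'⟩ := hv.eq_of_lineMap_eq (trisectEdgeParam_mem (h0 i) (h1 i) k hs)
    (trisectEdgeParam_mem (h0 j) (h1 j) l ht) he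
  obtain ⟨rfl, rfl⟩ := trisectEdgeParam_inj (h0 i) (h1 i) hs ht he'
  rfl

lemma iUnion_trisect (h0 : ∀ i, 0 < r i) (h1 : ∀ i, r i < 1 / 2) :
    (⋃ q, segment ℝ (trisect next v r q) (trisect next v r (trisectNext next q))) =
      ⋃ i, segment ℝ (v i) (v (next i)) := by
  rw [Set.iUnion_prod']
  refine Set.iUnion_congr fun i => ?_
  have hr0 := h0 i
  have hr1 := h1 i
  have e1 : trisect next v r (i, 1) ∈ segment ℝ (v i) (v (next i)) := by
    rw [trisect_one]
    exact lineMap_mem_segment' _ _ ⟨hr0.le, by linarith⟩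
  have e2 : trisect next v r (i, 2) ∈ segment ℝ (trisect next v r (i, 1)) (v (next i)) := by
    have : v (next i) = AffineMap.lineMap (v i) (v (next i)) (1 : ℝ) := by simp
    rw [trisect_two, trisect_one]
    have h2 : (1 - r i) = r i + ((1 - 2 * r i) / (1 - r i)) * (1 - r i) := by
      field_simp [(by linarith : (1 - r i) ≠ 0)]
      ring
    rw [h2, ← lineMap_lineMap_lineMap, ← this]
    refine lineMap_mem_segment' _ _ ⟨div_nonneg (by linarith) (by linarith), ?_⟩
    rw [div_le_one (by linarith)]
    linarith
  rw [← segment_union_segment e1, ← segment_union_segment e2]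
  ext z
  simp only [Set.mem_iUnion, Set.mem_union, Fin.exists_fin_succ, Fin.exists_fin_zero]
  simp

end trisect

theorem exists_isDiagram {n : ℕ} {L : Link} (hL : HasOnlyCrossings n L) :
    ∃ (ι : Type) (_ : Finite ι) (next : Equiv.Perm ι) (v : ι → Space), IsDiagram n next v ∧
      L.carrier = (⋃ i, segment ℝ (v i) (v (next i))) ∧
      ∀ i, IsCrossingVertex v i → (v i).1 ∈ singularPoints L := by
  obtain ⟨m, next₀, v₀, hv₀, hLv₀⟩ := L.isLink
  have hYfin : (⋃ p ∈ singularPoints L, fiber L p).Finite :=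
    hL.1.biUnion fun p hp => fiber_finite hL hp
  have hYsub : (⋃ p ∈ singularPoints L, fiber L p) ⊆
      ⋃ i, segment ℝ (v₀ i) (v₀ (next₀ i)) := by
    rw [← hLv₀]
    exact Set.iUnion₂_subset fun p _ z hz => hz.1
  obtain ⟨ι, hι, next, v, hv, hu, hY'⟩ := IsPolygon.exists_refinement hv₀ hYfin hYsub
  have hLv : L.carrier = ⋃ i, segment ℝ (v i) (v (next i)) := hLv₀.trans hu.symm
  have hY : ∀ z ∈ L.carrier, z.1 ∈ singularPoints L → z ∈ Set.range v := fun z hz hs =>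
    hY' (Set.mem_biUnion hs ⟨hz, rfl⟩)
  have hne := hv.fst_ne hL hLv
  have hlpos : ∀ i, 0 < ‖(v (next i)).1 - (v i).1‖ := fun i =>
    norm_pos_iff.2 (sub_ne_zero.2 (hne i).symm)
  -- One planar distance `ρ` serves all edges, so that the new neighbours of a straight vertex are
  -- placed symmetrically; less than half of every edge leaves a middle part.
  obtain ⟨ρ, hρ0, hρ⟩ : ∃ ρ : ℝ, 0 < ρ ∧ ∀ i, ρ < ‖(v (next i)).1 - (v i).1‖ / 2 := by
    have : ∀ᶠ ρ in 𝓝[>] (0 : ℝ), ∀ i, ρ < ‖(v (next i)).1 - (v i).1‖ / 2 := by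
      rw [Filter.eventually_all]
      intro i
      exact (eventually_lt_nhds (half_pos (hlpos i))).filter_mono nhdsWithin_le_nhds
    obtain ⟨ρ, h1, h2⟩ := (this.and eventually_mem_nhdsWithin).exists
    exact ⟨ρ, h2, h1⟩
  set r : ι → ℝ := fun i => ρ / ‖(v (next i)).1 - (v i).1‖ with hr
  have h0 : ∀ i, 0 < r i := fun i => div_pos hρ0 (hlpos i)
  have h1 : ∀ i, r i < 1 / 2 := fun i => by
    rw [hr]
    simp only
    rw [div_lt_iff₀ (hlpos i)]
    linarith [hρ i]
  have hv3 := hv.trisect h0 h1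
  have hLv3 := hLv.trans (iUnion_trisect (next := next) (v := v) h0 h1).symm
  have hY3 : ∀ z ∈ L.carrier, z.1 ∈ singularPoints L → z ∈ Set.range (trisect next v r) := by
    intro z hz hs
    obtain ⟨i, rfl⟩ := hY z hz hs
    exact ⟨(i, 0), by simp⟩
  -- All points over singular points were vertices before the trisection, so the new vertices are
  -- not over crossings.
  have hcr : ∀ i k, IsCrossingVertex (trisect next v r) (i, k) → k = 0 ∧ IsCrossingVertex v i := by
    intro i k hik
    have hz : ∀ q, (trisect next v r q).1 ∈ singularPoints L → ∃ j, q = (j, 0) := by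
      intro q hq
      obtain ⟨j, hj⟩ := hY _ (vertex_mem_carrier hLv3 q) hq
      exact ⟨j, hv3.injective (by simp [hj])⟩
    have hs := hik.mem_singularPoints hv3 hLv3
    obtain ⟨j, hj⟩ := hz _ hs
    obtain ⟨rfl, rfl⟩ := Prod.mk.inj hj
    refine ⟨rfl, ?_⟩
    obtain ⟨q, hq, he⟩ := hik
    obtain ⟨l, rfl⟩ := hz q (he ▸ hs)
    exact ⟨l, fun h => hq (by rw [h]), by simpa using he⟩
  have hr1 : ∀ i, r i • ((v (next i)).1 - (v i).1) = (trisect next v r (i, 1)).1 - (v i).1 := by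
    intro i
    rw [trisect_one, AffineMap.lineMap_apply_module]
    simp only [Prod.fst_add, Prod.smul_fst]
    module
  have hr2 : ∀ i, r i • ((v (next i)).1 - (v i).1) =
      (v (next i)).1 - (trisect next v r (i, 2)).1 := by
    intro i
    rw [trisect_two, AffineMap.lineMap_apply_module]
    simp only [Prod.fst_add, Prod.smul_fst]
    module
  have hr3 : ∀ i, (1 - 2 * r i) • ((v (next i)).1 - (v i).1) =
      (trisect next v r (i, 2)).1 - (trisect next v r (i, 1)).1 := by
    intro i
    rw [trisect_two, trisect_one, AffineMap.lineMap_apply_module, AffineMap.lineMap_apply_module]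
    simp only [Prod.fst_add, Prod.smul_fst]
    module
  have hk : ∀ i, 0 < (1 - 2 * r i) / r i := fun i => div_pos (by linarith [h1 i]) (h0 i)
  have hk' : ∀ i, (1 - 2 * r i) / r i * r i = 1 - 2 * r i := fun i =>
    div_mul_cancel₀ _ (h0 i).ne'
  refine ⟨ι × Fin 3, inferInstance, trisectNext next, trisect next v r, ⟨hv3, hv3.fst_ne hL hLv3,
    fun i j hij c hi hj => hv3.inter_fst hLv3 hY3 hij hi hj, ?_, ?_, ?_, ?_, ?_, ?_,
    fun i hi => hi.ncard hv3 hL hLv3 hY3⟩, hLv3, fun i hi => hi.mem_singularPoints hv3 hLv3⟩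
  · rintro ⟨i, k⟩ hi
    obtain ⟨rfl, hi'⟩ := hcr i k hi
    obtain ⟨κ, hκ, hs⟩ := hi'.straight hv hL hLv
    have hni : next (next.symm i) = i := by simp
    have hs1 : (v (next.symm i)).1 - (v i).1 = -κ • ((v (next i)).1 - (v i).1) := by
      have := congrArg Prod.fst hs
      simpa using this
    -- The factor `κ` is the ratio of the lengths of the two edges, and `r` is inversely
    -- proportional to the length.
    have hrr : κ * r (next.symm i) = r i := by
      simp only [hr, hni]
      rw [norm_sub_rev, hs1, norm_smul, norm_neg, Real.norm_of_nonneg hκ.le]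
      have := (hlpos i).ne'
      field_simp
    rw [trisectNext_zero, trisectNext_symm_zero, trisect_zero, trisect_one, trisect_two, hni]
    rw [← sub_eq_zero]
    have e : AffineMap.lineMap (v i) (v (next i)) (r i) +
        AffineMap.lineMap (v (next.symm i)) (v i) (1 - r (next.symm i)) - (2 : ℝ) • v i =
        r i • (v (next i) - v i) + r (next.symm i) • (v (next.symm i) - v i) := by
      rw [AffineMap.lineMap_apply_module, AffineMap.lineMap_apply_module]
      module
    rw [e, hs, smul_smul, ← hrr]
    module
  · rintro ⟨i, k⟩ hi
    obtain ⟨rfl, -⟩ := hcr i k hi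
    refine ⟨_, hk i, ?_⟩
    rw [trisectNext_zero, trisectNext_one, trisect_zero, ← hr3, ← hr1, smul_smul, hk']
  · rintro ⟨i, k⟩ hi
    obtain ⟨rfl, -⟩ := hcr i k hi
    have hni : next (next.symm i) = i := by simp
    refine ⟨_, hk (next.symm i), ?_⟩
    have := hr2 (next.symm i)
    rw [hni] at this
    rw [trisectNext_symm_zero, trisectNext_symm_two, trisect_zero, ← hr3, ← this, hni, smul_smul,
      hk']
  · rintro ⟨i, k⟩ hi hi'
    obtain ⟨rfl, -⟩ := hcr i k hi
    exact absurd (hcr i 1 hi').1 (by decide)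
  · rintro ⟨i, k⟩ hi hi'
    obtain ⟨rfl, -⟩ := hcr i k hi
    exact absurd (hcr (next.symm i) 2 hi').1 (by decide)
  · rintro ⟨i, k⟩
    -- The middle third of any edge can be cut, as both of its ends are new vertices.
    refine ⟨(i, 1), ?_, fun h => absurd (hcr i 1 h).1 (by decide),
      fun h => absurd (hcr i 2 h).1 (by decide)⟩
    have e01 : (trisectNext next).SameCycle (i, 0) (i, 1) := by
      have := Equiv.Perm.sameCycle_apply_right.2 (Equiv.Perm.SameCycle.refl (trisectNext next) (i, 0))
      simpa using this
    have e12 : (trisectNext next).SameCycle (i, 1) (i, 2) := by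
      have := Equiv.Perm.sameCycle_apply_right.2 (Equiv.Perm.SameCycle.refl (trisectNext next) (i, 1))
      simpa using this
    fin_cases k
    · exact e01
    · exact Equiv.Perm.SameCycle.refl _ _
    · exact e12.symm

/-! ### Cuts, signs and normal vectors. -/

/-- A set of edges, one in each cycle of `next`, with ends that are not crossings. -/
structure IsCut {ι : Type} (next : Equiv.Perm ι) (v : ι → Space) (C : Set ι) : Prop where
  not_crossing : ∀ c ∈ C, ¬ IsCrossingVertex v c
  not_crossing_next : ∀ c ∈ C, ¬ IsCrossingVertex v (next c)
  exists_sameCycle : ∀ i, ∃ c ∈ C, next.SameCycle i c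
  eq_of_sameCycle : ∀ c ∈ C, ∀ c' ∈ C, next.SameCycle c c' → c = c'

section

variable {ι : Type} {next : Equiv.Perm ι} {v : ι → Space} {n : ℕ}

lemma IsDiagram.exists_isCut (D : IsDiagram n next v) : ∃ C : Set ι, IsCut next v C := by
  choose f hf using D.exists_cut
  let s : Setoid ι := Equiv.Perm.SameCycle.setoid next
  have hsame : ∀ i, next.SameCycle i (f (Quotient.out (Quotient.mk s i))) := fun i =>
    (Equiv.Perm.SameCycle.symm (Quotient.exact (Quotient.out_eq (Quotient.mk s i)))).trans
      (hf _).1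
  refine ⟨Set.range fun q : Quotient s => f q.out, ?_, ?_, ?_, ?_⟩
  · rintro _ ⟨q, rfl⟩
    exact (hf _).2.1
  · rintro _ ⟨q, rfl⟩
    exact (hf _).2.2
  · exact fun i => ⟨_, ⟨_, rfl⟩, hsame i⟩
  · rintro _ ⟨q, rfl⟩ _ ⟨q', rfl⟩ h
    have h1 : next.SameCycle q.out q'.out := ((hf _).1.trans h).trans (hf _).1.symm
    have h2 : (Quotient.mk s q.out) = Quotient.mk s q'.out := Quotient.sound h1
    rw [Quotient.out_eq, Quotient.out_eq] at h2
    rw [h2]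

lemma exists_iterate_symm_mem [Finite ι] {C : Set ι}
    (h : ∀ i, ∃ c ∈ C, next.SameCycle i c) (i : ι) : ∃ k, next.symm^[k + 1] i ∈ C := by
  obtain ⟨c, hc, hi⟩ := h i
  obtain ⟨k, hk, -, hk'⟩ := (Equiv.Perm.sameCycle_inv.2 hi).exists_pow_eq''
  refine ⟨k - 1, ?_⟩
  rw [Nat.sub_add_cancel hk]
  have : next.symm^[k] i = c := by
    rw [← hk', ← Equiv.Perm.iterate_eq_pow]
    rfl
  rwa [this]

/-- Signs with prescribed changes along the edges outside of `C`. -/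
lemma exists_sign [Finite ι] {C : Set ι} (h : ∀ i, ∃ c ∈ C, next.SameCycle i c) {f : ι → ℝ}
    (hf : ∀ i, f i * f i = 1) :
    ∃ σ : ι → ℝ, (∀ i, σ i * σ i = 1) ∧ ∀ i ∉ C, σ (next i) = f (next i) * σ i := by
  classical
  have hex := exists_iterate_symm_mem h
  -- The product runs backwards from `i` to the preceding cut edge. The shift `k + 1` in `hex` makes
  -- it empty exactly when the edge that enters `i` is cut.
  refine ⟨fun i => ∏ j ∈ Finset.range (Nat.find (hex i)), f (next.symm^[j] i), fun i => ?_,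
    fun i hi => ?_⟩
  · simp only [← Finset.prod_mul_distrib, hf, Finset.prod_const_one]
  · have e : ∀ k, next.symm^[k + 1] (next i) = next.symm^[k] i := fun k => by
      rw [Function.iterate_succ_apply, Equiv.symm_apply_apply]
    have h1 : Nat.find (hex (next i)) = Nat.find (hex i) + 1 := by
      rw [Nat.find_eq_iff]
      refine ⟨by rw [e]; exact Nat.find_spec (hex i), fun m hm => ?_⟩
      rw [e]
      rcases m with _ | m
      · exact hi
      · exact Nat.find_min (hex i) (by omega)
    simp only [h1]
    rw [Finset.prod_range_succ', mul_comm]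
    simp only [e, Function.iterate_zero, id_eq]

/-- The vertices `a`, `a'` are the two ends of the edge `i`. -/
def AreEnds (next : Equiv.Perm ι) (i a a' : ι) : Prop :=
  (a = i ∧ a' = next i) ∨ (a = next i ∧ a' = i)

lemma AreEnds.left {i a a' : ι} (h : AreEnds next i a a') : a = i ∨ a = next i := by
  rcases h with ⟨h, -⟩ | ⟨h, -⟩
  · exact Or.inl h
  · exact Or.inr h

lemma exists_areEnds {i a : ι} (h : a = i ∨ a = next i) : ∃ a', AreEnds next i a a' := by
  rcases h with rfl | rfl
  · exact ⟨next a, Or.inl ⟨rfl, rfl⟩⟩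
  · exact ⟨i, Or.inr ⟨rfl, rfl⟩⟩

lemma AreEnds.segment_eq {i a a' : ι} (h : AreEnds next i a a') (w : ι → Plane) :
    segment ℝ (w i) (w (next i)) = segment ℝ (w a) (w a') := by
  rcases h with ⟨rfl, rfl⟩ | ⟨rfl, rfl⟩
  · rfl
  · rw [segment_symm]

namespace IsDiagram

lemma fst_ne_of_areEnds (D : IsDiagram n next v) {i a a' : ι} (h : AreEnds next i a a') :
    (v a).1 ≠ (v a').1 := by
  rcases h with ⟨rfl, rfl⟩ | ⟨rfl, rfl⟩
  · exact D.fst_ne _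
  · exact (D.fst_ne _).symm

/-- Edges leaving a common point in the same direction would overlap, but projected edges meet only
in end points. This transversality underlies all later perturbation arguments. -/
lemma zero_notMem_segment (D : IsDiagram n next v) {i j a a' b b' : ι} (hij : i ≠ j)
    (ha : AreEnds next i a a') (hb : AreEnds next j b b') (hab : (v a).1 = (v b).1) :
    0 ∉ segment ℝ ((v a').1 - (v a).1) (-((v b').1 - (v b).1)) := by
  rintro ⟨s, t, hs, ht, hst, h0⟩
  have hu : (v a').1 - (v a).1 ≠ 0 := sub_ne_zero.2 (D.fst_ne_of_areEnds ha).symm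
  have hv : (v b').1 - (v b).1 ≠ 0 := sub_ne_zero.2 (D.fst_ne_of_areEnds hb).symm
  have heq : s • ((v a').1 - (v a).1) = t • ((v b').1 - (v b).1) := by
    rw [smul_neg, ← sub_eq_add_neg, sub_eq_zero] at h0
    exact h0
  have hs0 : s ≠ 0 := by
    rintro rfl
    rw [zero_smul] at heq
    rcases smul_eq_zero.1 heq.symm with h | h
    · linarith
    · exact hv h
  -- Halving the weight keeps the common point away from the far end `a'`, even for `s = 1`.
  have m1 : (v a).1 + (s / 2) • ((v a').1 - (v a).1) ∈ segment ℝ (v i).1 (v (next i)).1 := by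
    rw [ha.segment_eq (fun i => (v i).1), segment_eq_image']
    exact ⟨s / 2, ⟨by linarith, by linarith⟩, rfl⟩
  have m2 : (v a).1 + (s / 2) • ((v a').1 - (v a).1) ∈ segment ℝ (v j).1 (v (next j)).1 := by
    rw [hb.segment_eq (fun i => (v i).1), segment_eq_image']
    refine ⟨t / 2, ⟨by linarith, by linarith⟩, ?_⟩
    simp only
    rw [div_eq_inv_mul, mul_smul, ← heq, smul_smul, ← div_eq_inv_mul, hab]
  obtain ⟨e, he, -, -, hex, -⟩ := D.inter i j hij _ m1 m2
  have he' : e = a ∨ e = a' := by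
    rcases ha with ⟨rfl, rfl⟩ | ⟨rfl, rfl⟩
    · exact he
    · exact he.symm
  rcases he' with rfl | rfl
  · have : (s / 2) • ((v a').1 - (v e).1) = 0 := by simpa using hex.symm
    rcases smul_eq_zero.1 this with h | h
    · exact hs0 (by linarith)
    · exact hu h
  · have : (1 - s / 2) • ((v e).1 - (v a).1) = 0 := by
      rw [sub_smul, one_smul, sub_eq_zero]
      nth_rewrite 1 [hex]
      simp
    rcases smul_eq_zero.1 this with h | h
    · linarith
    · exact hu h

/-- These are the cases that a push-off has to handle: disjoint edges stay disjoint, crossing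
vertices are not moved, and at an ordinary common vertex the side of the push matters. -/
lemma disjoint_or (D : IsDiagram n next v) {i j : ι} (hij : i ≠ j) :
    Disjoint (segment ℝ (v i).1 (v (next i)).1) (segment ℝ (v j).1 (v (next j)).1) ∨
      ∃ a a' b b', AreEnds next i a a' ∧ AreEnds next j b b' ∧ (v a).1 = (v b).1 ∧
        ((IsCrossingVertex v a ∧ IsCrossingVertex v b) ∨ (a = b ∧ ¬ IsCrossingVertex v a)) := by
  by_cases hd : Disjoint (segment ℝ (v i).1 (v (next i)).1) (segment ℝ (v j).1 (v (next j)).1)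
  · exact Or.inl hd
  right
  rw [Set.not_disjoint_iff] at hd
  obtain ⟨c, hc, hc'⟩ := hd
  obtain ⟨a, ha, b, hb, hac, hbc⟩ := D.inter i j hij c hc hc'
  obtain ⟨a', ha'⟩ := exists_areEnds ha
  obtain ⟨b', hb'⟩ := exists_areEnds hb
  refine ⟨a, a', b, b', ha', hb', hac.trans hbc.symm, ?_⟩
  by_cases hab : a = b
  · subst hab
    by_cases hcr : IsCrossingVertex v a
    · exact Or.inl ⟨hcr, hcr⟩
    · exact Or.inr ⟨rfl, hcr⟩
  · exact Or.inl ⟨⟨b, Ne.symm hab, hbc.trans hac.symm⟩, ⟨a, hab, hac.trans hbc.symm⟩⟩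

lemma mem_edge (D : IsDiagram n next v) {b i : ι} (hb : ¬ IsCrossingVertex v b)
    (h : (v b).1 ∈ segment ℝ (v i).1 (v (next i)).1) : b = i ∨ b = next i := by
  by_cases hbi : b = i
  · exact Or.inl hbi
  obtain ⟨a, ha, f, hf, -, hfb⟩ := D.inter b i hbi _ (left_mem_segment ℝ _ _) h
  by_cases hfb' : f = b
  · exact hfb' ▸ hf
  · exact absurd ⟨f, hfb', hfb⟩ hb

end IsDiagram

/-- Vectors by which the vertices are pushed off, to the side of the edge `i` given by the sign
`σ i`. -/
structure IsNormal (next : Equiv.Perm ι) (v : ι → Space) (C : Set ι) (σ : ι → ℝ)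
    (ν : ι → Plane) : Prop where
  eq_zero : ∀ i, IsCrossingVertex v i → ν i = 0
  ne_zero : ∀ i, ¬ IsCrossingVertex v i → ν i ≠ 0
  pos : ∀ i ∉ C, ¬ IsCrossingVertex v i → 0 < σ i * cross ((v (next i)).1 - (v i).1) (ν i)
  pos_next : ∀ i ∉ C, ¬ IsCrossingVertex v (next i) →
    0 < σ i * cross ((v (next i)).1 - (v i).1) (ν (next i))
  sign_next : ∀ i ∉ C, ¬ IsCrossingVertex v (next i) → σ (next i) = σ i
  add_eq : ∀ i, IsCrossingVertex v i → ν (next i) + ν (next.symm i) = 0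

/-- The sign changes at each crossing vertex, so the copy changes sides there. Around a crossing the
polygon is straight over several edges; the normalised normals of the two neighbours agree and their
opposite signs make them cancel. -/
lemma IsDiagram.exists_isNormal [Finite ι] (D : IsDiagram n next v) {C : Set ι}
    (hC : IsCut next v C) : ∃ (σ : ι → ℝ) (ν : ι → Plane), IsNormal next v C σ ν := by
  classical
  obtain ⟨σ, hσ, hσn⟩ := exists_sign (next := next) hC.exists_sameCycle
    (f := fun i => if IsCrossingVertex v i then -1 else 1) (fun i => by split_ifs <;> norm_num)
  have hE : ∀ i, (v (next i)).1 - (v i).1 ≠ 0 := fun i => sub_ne_zero.2 (D.fst_ne i).symm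
  have hg : ∀ i, ∃ g : Plane, 0 < cross ((v i).1 - (v (next.symm i)).1) g ∧
      0 < cross ((v (next i)).1 - (v i).1) g ∧
      (cross ((v i).1 - (v (next.symm i)).1) ((v (next i)).1 - (v i).1) = 0 →
        g = ‖(v i).1 - (v (next.symm i)).1‖⁻¹ •
          ((-((v i).1 - (v (next.symm i)).1).2, ((v i).1 - (v (next.symm i)).1).1) : Plane)) := by
    intro i
    have hni : next (next.symm i) = i := by simp
    have hE' := hE (next.symm i)
    rw [hni] at hE'
    -- Consecutive edges do not fold back onto each other, so one vector points to the same side of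
    -- both.
    refine exists_cross_pos hE' ?_
    have hne : next.symm i ≠ i := by
      intro h
      rw [h, sub_self] at hE'
      exact hE' rfl
    have := D.zero_notMem_segment hne (a := i) (a' := next.symm i) (b := i) (b' := next i)
      (Or.inr ⟨hni.symm, rfl⟩) (Or.inl ⟨rfl, rfl⟩) rfl
    rintro ⟨s, t, hs, ht, hst, h0⟩
    refine this ⟨s, t, hs, ht, hst, ?_⟩
    rw [← neg_eq_zero, ← h0]
    module
  choose g hg1 hg2 hg3 using hg
  have hσ0 : ∀ i, σ i ≠ 0 := fun i h => by simpa [h] using hσ i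
  have hsign : ∀ i ∉ C, ¬ IsCrossingVertex v (next i) → σ (next i) = σ i := by
    intro i hi hcr
    rw [hσn i hi, if_neg hcr, one_mul]
  refine ⟨σ, fun i => if IsCrossingVertex v i then 0 else σ i • g i, ?_, ?_, ?_, ?_, hsign, ?_⟩
  · exact fun i hi => if_pos hi
  · intro i hi
    rw [if_neg hi]
    refine smul_ne_zero (hσ0 i) fun h => ?_
    have := hg2 i
    rw [h, cross_zero] at this
    exact this.false
  · intro i _ hcr
    rw [if_neg hcr, cross_smul_right, ← mul_assoc, hσ, one_mul]
    exact hg2 i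
  · intro i hi hcr
    rw [if_neg hcr, cross_smul_right, ← mul_assoc, hsign i hi hcr, hσ, one_mul]
    have := hg1 (next i)
    rwa [Equiv.symm_apply_apply] at this
  · intro i hi
    have hni : next (next.symm i) = i := by simp
    have hiC : i ∉ C := fun h => hC.not_crossing i h hi
    have hpC : next.symm i ∉ C := fun h => hC.not_crossing_next _ h (by rwa [hni])
    have h1 := D.not_next i hi
    have h2 := D.not_prev i hi
    rw [if_neg h1, if_neg h2, hsign i hiC h1]
    have h3 : σ i = -σ (next.symm i) := by
      have := hσn _ hpC
      rw [hni, if_pos hi] at this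
      linarith
    obtain ⟨κ, hκ, hs⟩ := D.straight_next i hi
    obtain ⟨κ', hκ', hs'⟩ := D.straight_prev i hi
    have hmid : (v i).1 - (v (next.symm i)).1 = (v (next i)).1 - (v i).1 := by
      have := congrArg Prod.fst (D.add_eq i hi)
      simp only [Prod.fst_add, two_smul] at this
      rw [sub_eq_sub_iff_add_eq_add, this]
    have g1 := hg3 (next i) (by
      rw [Equiv.symm_apply_apply, hs, cross_smul_right, cross_self, mul_zero])
    have g2 := hg3 (next.symm i) (by
      rw [hni, hs', cross_smul_left, cross_self, mul_zero])
    rw [Equiv.symm_apply_apply] at g1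
    rw [hs', hmid, norm_smul, Real.norm_of_nonneg hκ'.le] at g2
    have : g (next.symm i) = g (next i) := by
      rw [g1, g2]
      set u := (v (next i)).1 - (v i).1
      have e : ((-(κ' • u).2, (κ' • u).1) : Plane) = κ' • ((-u.2, u.1) : Plane) := by
        ext1 <;> simp
      rw [e, smul_smul, mul_inv, mul_comm κ'⁻¹, mul_assoc, inv_mul_cancel₀ hκ'.ne', mul_one]
    rw [this, h3]
    module

end

/-! ### The parallel copy. -/

/-- The vertices `w` span a parallel copy of the projection of the polygonal link, cut open at `C`:
edges, parallel edges and the short segments that join the ends of the cut edges to their parallel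
copies meet only in common end points. -/
structure IsPushoff {ι : Type} (next : Equiv.Perm ι) (v : ι → Space) (C : Set ι) (w : ι → Plane) :
    Prop where
  edge_push : ∀ i ∉ C, ∀ j ∉ C, ∀ x ∈ segment ℝ (v i).1 (v (next i)).1,
    x ∈ segment ℝ (w j) (w (next j)) →
      ∃ a, (a = i ∨ a = next i) ∧ ∃ b, (b = j ∨ b = next j) ∧ (v a).1 = x ∧ w b = x
  push_push : ∀ i ∉ C, ∀ j ∉ C, i ≠ j → ∀ x ∈ segment ℝ (w i) (w (next i)),
    x ∈ segment ℝ (w j) (w (next j)) →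
      ∃ a, (a = i ∨ a = next i) ∧ ∃ b, (b = j ∨ b = next j) ∧ w a = x ∧ w b = x
  cap_edge : ∀ b, (b ∈ C ∨ next.symm b ∈ C) → ∀ i ∉ C, ∀ x ∈ segment ℝ (v b).1 (w b),
    x ∈ segment ℝ (v i).1 (v (next i)).1 → x = (v b).1 ∧ (b = i ∨ b = next i)
  cap_push : ∀ b, (b ∈ C ∨ next.symm b ∈ C) → ∀ i ∉ C, ∀ x ∈ segment ℝ (v b).1 (w b),
    x ∈ segment ℝ (w i) (w (next i)) → x = w b ∧ (b = i ∨ b = next i)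
  cap_cap : ∀ b, (b ∈ C ∨ next.symm b ∈ C) → ∀ b', (b' ∈ C ∨ next.symm b' ∈ C) → b ≠ b' →
    Disjoint (segment ℝ (v b).1 (w b)) (segment ℝ (v b').1 (w b'))
  cut_push : ∀ c ∈ C, ∀ i ∉ C, ¬ next.SameCycle c i →
    Disjoint (segment ℝ (v c).1 (v (next c)).1) (segment ℝ (w i) (w (next i)))
  cut_cap : ∀ c ∈ C, ∀ b, (b ∈ C ∨ next.symm b ∈ C) → ¬ next.SameCycle c b →
    Disjoint (segment ℝ (v c).1 (v (next c)).1) (segment ℝ (v b).1 (w b))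
  push_injective : ∀ i j, w i = w j → i ≠ j → IsCrossingVertex v i ∧ IsCrossingVertex v j
  push_eq_vertex : ∀ i j, w i = (v j).1 → IsCrossingVertex v i ∧ IsCrossingVertex v j
  eq_of_crossing : ∀ i, IsCrossingVertex v i → w i = (v i).1
  add_eq : ∀ i, IsCrossingVertex v i → w (next i) + w (next.symm i) = (2 : ℝ) • w i

section

variable {ι : Type} {next : Equiv.Perm ι} {v : ι → Space} {n : ℕ} {C : Set ι} {σ : ι → ℝ}
  {ν : ι → Plane}

lemma IsCrossingVertex.of_fst_eq {i j : ι} (hi : IsCrossingVertex v i)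
    (h : (v i).1 = (v j).1) : IsCrossingVertex v j := by
  by_cases hij : i = j
  · exact hij ▸ hi
  · exact ⟨i, hij, h⟩

lemma IsNormal.eq_zero_or_pos (N : IsNormal next v C σ ν) {i : ι} (hi : i ∉ C) :
    ν i = 0 ∨ 0 < σ i * cross ((v (next i)).1 - (v i).1) (ν i) := by
  by_cases h : IsCrossingVertex v i
  · exact Or.inl (N.eq_zero i h)
  · exact Or.inr (N.pos i hi h)

lemma IsNormal.eq_zero_or_pos_next (N : IsNormal next v C σ ν) {i : ι} (hi : i ∉ C) :
    ν (next i) = 0 ∨ 0 < σ i * cross ((v (next i)).1 - (v i).1) (ν (next i)) := by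
  by_cases h : IsCrossingVertex v (next i)
  · exact Or.inl (N.eq_zero _ h)
  · exact Or.inr (N.pos_next i hi h)

lemma cross_neg_sub (u u' w : Plane) : cross (u - u') w = -cross (u' - u) w := by
  rw [cross_sub_left, cross_sub_left]; ring

lemma IsDiagram.notMem_segment (D : IsDiagram n next v) {i j a a' b' : ι} (hij : i ≠ j)
    (ha : AreEnds next i a a') (hb : AreEnds next j a b') :
    (v b').1 ∉ segment ℝ (v a).1 (v a').1 := by
  intro h
  have hz := D.zero_notMem_segment hij ha hb rfl
  have := eq_of_mem_segment_of_mem_segment (b := (v a).1) (x := (v b').1) hz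
    (by simpa using h) (by simpa using right_mem_segment ℝ (v a).1 (v b').1)
  exact D.fst_ne_of_areEnds hb this.symm

/-- Disjointness and transversality at crossings are stable. What needs the consistent choice of
sides is an edge against its own copy or against the copy of an adjacent edge. -/
lemma eventually_edge_push (D : IsDiagram n next v)
    (N : IsNormal next v C σ ν) {i j : ι} (hi : i ∉ C) (hj : j ∉ C) :
    ∀ᶠ ε in 𝓝[>] (0 : ℝ), ∀ x ∈ segment ℝ (v i).1 (v (next i)).1,
      x ∈ segment ℝ ((v j).1 + ε • ν j) ((v (next j)).1 + ε • ν (next j)) →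
      ∃ a, (a = i ∨ a = next i) ∧ ∃ b, (b = j ∨ b = next j) ∧ (v a).1 = x ∧
        (v b).1 + ε • ν b = x := by
  by_cases hij : i = j
  · subst hij
    filter_upwards [eventually_mem_nhdsWithin (a := (0 : ℝ))] with ε hε x h1 h2
    -- Were both ends crossings, neither would move and the edge would coincide with its copy.
    have hnn : ¬ (ν i = 0 ∧ ν (next i) = 0) := by
      rintro ⟨h0, h1⟩
      have hcr : IsCrossingVertex v i := by
        by_contra h
        exact N.ne_zero i h h0
      exact N.ne_zero _ (D.not_next i hcr) h1
    rcases pushoff_inter hε (N.eq_zero_or_pos hi) (N.eq_zero_or_pos_next hi) hnn h1 h2 with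
      ⟨h0, rfl⟩ | ⟨h0, rfl⟩
    · exact ⟨i, Or.inl rfl, i, Or.inl rfl, rfl, by simp [h0]⟩
    · exact ⟨next i, Or.inr rfl, next i, Or.inr rfl, rfl, by simp [h0]⟩
  rcases D.disjoint_or hij with h | ⟨a, a', b, b', ha, hb, hab, ⟨hca, hcb⟩ | ⟨rfl, hca⟩⟩
  · filter_upwards [(eventually_disjoint_segment h 0 0 (ν j) (ν (next j))).filter_mono
      nhdsWithin_le_nhds] with ε hε x h1 h2
    simp only [smul_zero, add_zero] at hε
    exact absurd h2 (Set.disjoint_left.1 hε h1)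
  · have hz := D.zero_notMem_segment hij ha hb hab
    rw [← hab] at hz
    filter_upwards [(eventually_inter_eq hz 0 0 (ν b')).filter_mono
      nhdsWithin_le_nhds] with ε hε x h1 h2
    rw [ha.segment_eq (fun i => (v i).1)] at h1
    rw [hb.segment_eq (fun i => (v i).1 + ε • ν i)] at h2
    have hxa : x = (v a).1 := by
      simpa using hε x (by simpa using h1) (by simpa [N.eq_zero b hcb, ← hab] using h2)
    exact ⟨a, ha.left, b, hb.left, hxa.symm, by rw [N.eq_zero b hcb, hxa, hab]; simp⟩
  · suffices hd : ∀ᶠ ε in 𝓝[>] (0 : ℝ),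
        Disjoint (segment ℝ ((v b').1 + ε • ν b') ((v a).1 + ε • ν a))
          (segment ℝ (v a).1 (v a').1) by
      filter_upwards [hd] with ε hε x h1 h2
      rw [ha.segment_eq (fun i => (v i).1)] at h1
      rw [hb.segment_eq (fun i => (v i).1 + ε • ν i), segment_symm] at h2
      exact absurd h1 (Set.disjoint_left.1 hε h2)
    have hnot := D.notMem_segment hij ha hb
    rcases ha with ⟨rfl, rfl⟩ | ⟨rfl, rfl⟩
    · rcases hb with ⟨h, -⟩ | ⟨rfl, rfl⟩
      · exact absurd h hij
      · refine eventually_pushoff_disjoint (τ := σ b') (N.eq_zero_or_pos hj)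
          (N.pos_next _ hj hca) ?_ hnot
        rw [← N.sign_next _ hj hca]
        exact N.pos _ hi hca
    · rcases hb with ⟨rfl, rfl⟩ | ⟨h, -⟩
      -- Here the two edges are read against the cyclic order, which reverses the side and hence the
      -- sign.
      · refine eventually_pushoff_disjoint (τ := -σ (next a')) ?_ ?_ ?_ hnot
        · rw [cross_neg_sub, neg_mul_neg]
          exact N.eq_zero_or_pos_next hj
        · rw [cross_neg_sub, neg_mul_neg]
          exact N.pos _ hj hca
        · rw [cross_neg_sub, neg_mul_neg, N.sign_next _ hi hca]
          exact N.pos_next _ hi hca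
      · exact absurd (next.injective h) hij

/-- A common end moves in the same way for both edges: at a crossing it stays fixed, and otherwise
it is one and the same vertex. -/
lemma eventually_push_push (D : IsDiagram n next v) (N : IsNormal next v C σ ν) {i j : ι}
    (hij : i ≠ j) :
    ∀ᶠ ε in 𝓝[>] (0 : ℝ), ∀ x ∈ segment ℝ ((v i).1 + ε • ν i) ((v (next i)).1 + ε • ν (next i)),
      x ∈ segment ℝ ((v j).1 + ε • ν j) ((v (next j)).1 + ε • ν (next j)) →
      ∃ a, (a = i ∨ a = next i) ∧ ∃ b, (b = j ∨ b = next j) ∧ (v a).1 + ε • ν a = x ∧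
        (v b).1 + ε • ν b = x := by
  rcases D.disjoint_or hij with h | ⟨a, a', b, b', ha, hb, hab, hcr⟩
  · filter_upwards [(eventually_disjoint_segment h (ν i) (ν (next i)) (ν j)
      (ν (next j))).filter_mono nhdsWithin_le_nhds] with ε hε x h1 h2
    exact absurd h2 (Set.disjoint_left.1 hε h1)
  · have hν : ν a = ν b := by
      rcases hcr with ⟨hca, hcb⟩ | ⟨rfl, -⟩
      · rw [N.eq_zero a hca, N.eq_zero b hcb]
      · rfl
    have hz := D.zero_notMem_segment hij ha hb hab
    rw [← hab] at hz
    filter_upwards [(eventually_inter_eq hz (ν a') (ν a) (ν b')).filter_mono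
      nhdsWithin_le_nhds] with ε hε x h1 h2
    rw [ha.segment_eq (fun i => (v i).1 + ε • ν i)] at h1
    rw [hb.segment_eq (fun i => (v i).1 + ε • ν i), ← hab, ← hν] at h2
    have hxa := hε x h1 h2
    exact ⟨a, ha.left, b, hb.left, hxa.symm, by rw [← hν, ← hab, hxa]⟩

lemma IsNormal.cross_ne_zero (N : IsNormal next v C σ ν) {i a a' : ι} (hi : i ∉ C)
    (h : AreEnds next i a a') (ha : ¬ IsCrossingVertex v a) :
    cross ((v a').1 - (v a).1) (ν a) ≠ 0 := by
  rcases h with ⟨rfl, rfl⟩ | ⟨rfl, rfl⟩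
  · intro h0
    have := N.pos _ hi ha
    rw [h0, mul_zero] at this
    exact this.false
  · intro h0
    rw [cross_neg_sub, neg_eq_zero] at h0
    have := N.pos_next _ hi ha
    rw [h0, mul_zero] at this
    exact this.false

lemma eventually_cap_edge (D : IsDiagram n next v) (N : IsNormal next v C σ ν) {b i : ι}
    (hb : ¬ IsCrossingVertex v b) (hi : i ∉ C) :
    ∀ᶠ ε in 𝓝[>] (0 : ℝ), ∀ x ∈ segment ℝ (v b).1 ((v b).1 + ε • ν b),
      x ∈ segment ℝ (v i).1 (v (next i)).1 → x = (v b).1 ∧ (b = i ∨ b = next i) := by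
  by_cases hbi : b = i ∨ b = next i
  · obtain ⟨b', hb'⟩ := exists_areEnds hbi
    filter_upwards [eventually_mem_nhdsWithin (a := (0 : ℝ))] with ε hε x h1 h2
    rw [hb'.segment_eq (fun i => (v i).1)] at h2
    exact ⟨cap_inter_eq (ne_of_gt hε) (N.cross_ne_zero hi hb' hb) h1 h2, hbi⟩
  · have hd : Disjoint (segment ℝ (v b).1 (v b).1) (segment ℝ (v i).1 (v (next i)).1) := by
      rw [segment_same, Set.disjoint_singleton_left]
      exact fun h => hbi (D.mem_edge hb h)
    filter_upwards [(eventually_disjoint_segment hd 0 (ν b) 0 0).filter_mono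
      nhdsWithin_le_nhds] with ε hε x h1 h2
    simp only [smul_zero, add_zero] at hε
    exact absurd h2 (Set.disjoint_left.1 hε h1)

lemma eventually_cap_push (D : IsDiagram n next v) (N : IsNormal next v C σ ν) {b i : ι}
    (hb : ¬ IsCrossingVertex v b) (hi : i ∉ C) :
    ∀ᶠ ε in 𝓝[>] (0 : ℝ), ∀ x ∈ segment ℝ (v b).1 ((v b).1 + ε • ν b),
      x ∈ segment ℝ ((v i).1 + ε • ν i) ((v (next i)).1 + ε • ν (next i)) →
        x = (v b).1 + ε • ν b ∧ (b = i ∨ b = next i) := by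
  by_cases hbi : b = i ∨ b = next i
  · obtain ⟨b', hb'⟩ := exists_areEnds hbi
    filter_upwards [eventually_cap_inter_eq (N.cross_ne_zero hi hb' hb) (ν b')] with ε hε x h1 h2
    rw [hb'.segment_eq (fun i => (v i).1 + ε • ν i)] at h2
    exact ⟨hε x h1 h2, hbi⟩
  · have hd : Disjoint (segment ℝ (v b).1 (v b).1) (segment ℝ (v i).1 (v (next i)).1) := by
      rw [segment_same, Set.disjoint_singleton_left]
      exact fun h => hbi (D.mem_edge hb h)
    filter_upwards [(eventually_disjoint_segment hd 0 (ν b) (ν i) (ν (next i))).filter_mono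
      nhdsWithin_le_nhds] with ε hε x h1 h2
    simp only [smul_zero, add_zero] at hε
    exact absurd h2 (Set.disjoint_left.1 hε h1)

/-- A cut edge has no crossing at its ends, so in projection it meets other edges only in shared
vertices, which belong to its own component. -/
lemma IsDiagram.disjoint_of_not_sameCycle (D : IsDiagram n next v) (hC : IsCut next v C)
    {c i : ι} (hc : c ∈ C) (hci : ¬ next.SameCycle c i) :
    Disjoint (segment ℝ (v c).1 (v (next c)).1) (segment ℝ (v i).1 (v (next i)).1) := by
  have hne : c ≠ i := by
    rintro rfl
    exact hci (Equiv.Perm.SameCycle.refl _ _)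
  rcases D.disjoint_or hne with h | ⟨a, a', b, b', ha, hb, hab, ⟨hca, hcb⟩ | ⟨rfl, hca⟩⟩
  · exact h
  · rcases ha.left with rfl | rfl
    · exact absurd hca (hC.not_crossing _ hc)
    · exact absurd hca (hC.not_crossing_next _ hc)
  · exfalso
    apply hci
    have h1 : next.SameCycle c a := by
      rcases ha.left with rfl | rfl
      · exact Equiv.Perm.SameCycle.refl _ _
      · exact Equiv.Perm.sameCycle_apply_right.2 (Equiv.Perm.SameCycle.refl _ _)
    refine h1.trans ?_
    rcases hb.left with rfl | rfl
    · exact Equiv.Perm.SameCycle.refl _ _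
    · exact Equiv.Perm.sameCycle_apply_left.2 (Equiv.Perm.SameCycle.refl _ _)

lemma IsCut.not_crossing_of_cap (hC : IsCut next v C) {b : ι} (hb : b ∈ C ∨ next.symm b ∈ C) :
    ¬ IsCrossingVertex v b := by
  rcases hb with hb | hb
  · exact hC.not_crossing _ hb
  · simpa using hC.not_crossing_next _ hb

/-- All requirements are finitely many conditions that hold for small positive `ε`, so a single `ε`
satisfies them simultaneously. -/
theorem IsDiagram.exists_isPushoff [Finite ι] (D : IsDiagram n next v) (hC : IsCut next v C) :
    ∃ w : ι → Plane, IsPushoff next v C w := by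
  obtain ⟨σ, ν, N⟩ := D.exists_isNormal hC
  have point_ne : ∀ {i j : ι}, (v i).1 ≠ (v j).1 → ∀ μ μ' : Plane, ∀ᶠ ε in 𝓝[>] (0 : ℝ),
      (v i).1 + ε • μ ≠ (v j).1 + ε • μ' := by
    intro i j hij μ μ'
    have hd : Disjoint (segment ℝ (v i).1 (v i).1) (segment ℝ (v j).1 (v j).1) := by
      simpa using hij
    filter_upwards [(eventually_disjoint_segment hd μ μ μ' μ').filter_mono
      nhdsWithin_le_nhds] with ε hε
    simpa [eq_comm] using hε
  have h1 : ∀ᶠ ε in 𝓝[>] (0 : ℝ), ∀ i j, i ∉ C → j ∉ C →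
      ∀ x ∈ segment ℝ (v i).1 (v (next i)).1,
      x ∈ segment ℝ ((v j).1 + ε • ν j) ((v (next j)).1 + ε • ν (next j)) →
      ∃ a, (a = i ∨ a = next i) ∧ ∃ b, (b = j ∨ b = next j) ∧ (v a).1 = x ∧
        (v b).1 + ε • ν b = x := by
    simp only [Filter.eventually_all]
    exact fun i j hi hj => eventually_edge_push D N hi hj
  have h2 : ∀ᶠ ε in 𝓝[>] (0 : ℝ), ∀ i j, i ≠ j →
      ∀ x ∈ segment ℝ ((v i).1 + ε • ν i) ((v (next i)).1 + ε • ν (next i)),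
      x ∈ segment ℝ ((v j).1 + ε • ν j) ((v (next j)).1 + ε • ν (next j)) →
      ∃ a, (a = i ∨ a = next i) ∧ ∃ b, (b = j ∨ b = next j) ∧ (v a).1 + ε • ν a = x ∧
        (v b).1 + ε • ν b = x := by
    simp only [Filter.eventually_all]
    exact fun i j hij => eventually_push_push D N hij
  have h3 : ∀ᶠ ε in 𝓝[>] (0 : ℝ), ∀ b, (b ∈ C ∨ next.symm b ∈ C) → ∀ i, i ∉ C →
      ∀ x ∈ segment ℝ (v b).1 ((v b).1 + ε • ν b),
      x ∈ segment ℝ (v i).1 (v (next i)).1 → x = (v b).1 ∧ (b = i ∨ b = next i) := by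
    simp only [Filter.eventually_all]
    exact fun b hb i hi => eventually_cap_edge D N (hC.not_crossing_of_cap hb) hi
  have h4 : ∀ᶠ ε in 𝓝[>] (0 : ℝ), ∀ b, (b ∈ C ∨ next.symm b ∈ C) → ∀ i, i ∉ C →
      ∀ x ∈ segment ℝ (v b).1 ((v b).1 + ε • ν b),
      x ∈ segment ℝ ((v i).1 + ε • ν i) ((v (next i)).1 + ε • ν (next i)) →
        x = (v b).1 + ε • ν b ∧ (b = i ∨ b = next i) := by
    simp only [Filter.eventually_all]
    exact fun b hb i hi => eventually_cap_push D N (hC.not_crossing_of_cap hb) hi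
  have h5 : ∀ᶠ ε in 𝓝[>] (0 : ℝ), ∀ b, (b ∈ C ∨ next.symm b ∈ C) → ∀ b', b ≠ b' →
      Disjoint (segment ℝ (v b).1 ((v b).1 + ε • ν b))
        (segment ℝ (v b').1 ((v b').1 + ε • ν b')) := by
    simp only [Filter.eventually_all]
    intro b hb b' hbb'
    have hd : Disjoint (segment ℝ (v b).1 (v b).1) (segment ℝ (v b').1 (v b').1) := by
      rw [segment_same, segment_same, Set.disjoint_singleton]
      exact fun h => hC.not_crossing_of_cap hb ⟨b', hbb'.symm, h.symm⟩
    filter_upwards [(eventually_disjoint_segment hd 0 (ν b) 0 (ν b')).filter_mono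
      nhdsWithin_le_nhds] with ε hε
    simpa only [smul_zero, add_zero] using hε
  have h6 : ∀ᶠ ε in 𝓝[>] (0 : ℝ), ∀ c, c ∈ C → ∀ i, ¬ next.SameCycle c i →
      Disjoint (segment ℝ (v c).1 (v (next c)).1)
        (segment ℝ ((v i).1 + ε • ν i) ((v (next i)).1 + ε • ν (next i))) := by
    simp only [Filter.eventually_all]
    intro c hc i hci
    filter_upwards [(eventually_disjoint_segment (D.disjoint_of_not_sameCycle hC hc hci) 0 0 (ν i)
      (ν (next i))).filter_mono nhdsWithin_le_nhds] with ε hε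
    simpa only [smul_zero, add_zero] using hε
  have h7 : ∀ᶠ ε in 𝓝[>] (0 : ℝ), ∀ c, c ∈ C → ∀ b, ¬ next.SameCycle c b →
      Disjoint (segment ℝ (v c).1 (v (next c)).1)
        (segment ℝ (v b).1 ((v b).1 + ε • ν b)) := by
    simp only [Filter.eventually_all]
    intro c hc b hcb
    have hd : Disjoint (segment ℝ (v c).1 (v (next c)).1) (segment ℝ (v b).1 (v b).1) :=
      (D.disjoint_of_not_sameCycle hC hc hcb).mono_right
        (by rw [segment_same]; simpa using left_mem_segment ℝ _ _)
    filter_upwards [(eventually_disjoint_segment hd 0 0 0 (ν b)).filter_mono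
      nhdsWithin_le_nhds] with ε hε
    simpa only [smul_zero, add_zero] using hε
  have h8 : ∀ᶠ ε in 𝓝[>] (0 : ℝ), ∀ i j, (v i).1 ≠ (v j).1 →
      (v i).1 + ε • ν i ≠ (v j).1 + ε • ν j ∧ (v i).1 + ε • ν i ≠ (v j).1 := by
    simp only [Filter.eventually_all]
    intro i j hij
    filter_upwards [point_ne hij (ν i) (ν j), point_ne hij (ν i) 0] with ε h h'
    exact ⟨h, by simpa using h'⟩
  obtain ⟨ε, ⟨h1, h2, h3, h4, h5, h6, h7, h8⟩, hε⟩ :=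
    ((h1.and (h2.and (h3.and (h4.and (h5.and (h6.and (h7.and h8))))))).and
      (eventually_mem_nhdsWithin (a := (0 : ℝ)))).exists
  refine ⟨fun i => (v i).1 + ε • ν i, fun i hi j hj => h1 i j hi hj,
    fun i _ j _ hij => h2 i j hij, h3, h4, fun b hb b' _ => h5 b hb b',
    fun c hc i _ => h6 c hc i, fun c hc b _ => h7 c hc b, ?_, ?_, ?_, ?_⟩
  · intro i j hw hij
    have hv : (v i).1 = (v j).1 := by
      by_contra h
      exact (h8 i j h).1 hw
    exact ⟨⟨j, hij.symm, hv.symm⟩, ⟨i, hij, hv⟩⟩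
  · intro i j hw
    have hv : (v i).1 = (v j).1 := by
      by_contra h
      exact (h8 i j h).2 hw
    have hi : IsCrossingVertex v i := by
      by_contra h
      simp only [hv, add_eq_left] at hw
      exact smul_ne_zero (ne_of_gt hε) (N.ne_zero i h) hw
    exact ⟨hi, hi.of_fst_eq hv⟩
  · intro i hi
    simp [N.eq_zero i hi]
  · intro i hi
    have hadd := congrArg Prod.fst (D.add_eq i hi)
    simp only [Prod.fst_add, Prod.smul_fst] at hadd
    have hν := N.add_eq i hi
    simp only [N.eq_zero i hi, smul_zero, add_zero]
    rw [← hadd, add_add_add_comm, ← smul_add, hν, smul_zero, add_zero]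

end

/-! ### Doubling the components one after another. -/

section

variable {ι : Type} {next : Equiv.Perm ι} {v : ι → Space} {n : ℕ} {C : Set ι} {w : ι → Plane}

/-- The edges outside of `C` together with the doubled paths `u` along the components through `R`,
joined to the ends of the cut edges. -/
def doubling (next : Equiv.Perm ι) (v : ι → Space) (C : Set ι) (u : ι → Space) (R : Set ι) :
    Set Space :=
  (⋃ i, ⋃ (_ : i ∉ C), segment ℝ (v i) (v (next i))) ∪
    (⋃ i, ⋃ (_ : i ∉ C ∧ ∃ c ∈ R, next.SameCycle c i), segment ℝ (u i) (u (next i))) ∪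
    ⋃ b, ⋃ (_ : (b ∈ C ∨ next.symm b ∈ C) ∧ ∃ c ∈ R, next.SameCycle c b), segment ℝ (v b) (u b)

lemma iterate_symm_sameCycle (c : ι) (k : ℕ) : next.SameCycle c (next.symm^[k] c) := by
  induction k with
  | zero => exact Equiv.Perm.SameCycle.refl _ _
  | succ k ih =>
    rw [Function.iterate_succ_apply']
    exact Equiv.Perm.sameCycle_symm_apply_right.2 ih

lemma exists_iterate_symm_eq [Finite ι] {c i : ι} (h : next.SameCycle c i) :
    ∃ k < Function.minimalPeriod next.symm c, next.symm^[k] c = i := by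
  obtain ⟨k, -, -, hk⟩ := (Equiv.Perm.sameCycle_inv.2 h).exists_pow_eq''
  have hk' : next.symm^[k] c = i := by
    rw [← hk, ← Equiv.Perm.iterate_eq_pow]
    rfl
  have hper : c ∈ Function.periodicPts next.symm :=
    next.symm.injective.mem_periodicPts c
  refine ⟨k % Function.minimalPeriod next.symm c,
    Nat.mod_lt _ (Function.minimalPeriod_pos_of_mem_periodicPts hper), ?_⟩
  rw [Function.iterate_mod_minimalPeriod_eq, hk']

/-- No strand crosses over a cut edge: other edges are disjoint from it in projection or share a
vertex with it and diverge. This starts the raising of triangles. -/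
lemma Below.edge (D : IsDiagram n next v) (hC : IsCut next v C) {c i : ι} (hc : c ∈ C)
    (hci : c ≠ i) :
    Below (segment ℝ (v i) (v (next i))) (segment ℝ (v c) (v (next c))) := by
  rcases D.disjoint_or hci with h | ⟨a, a', b, b', ha, hb, hab, ⟨hca, hcb⟩ | ⟨rfl, hca⟩⟩
  · exact Below.of_forall_ne (isCompact_segment _ _) (isCompact_segment _ _) fun _ hz _ hu he =>
      Set.disjoint_left.1 h (fst_mem_segment hu) (he ▸ fst_mem_segment hz)
  · rcases ha.left with rfl | rfl
    · exact absurd hca (hC.not_crossing _ hc)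
    · exact absurd hca (hC.not_crossing_next _ hc)
  · have hz := D.zero_notMem_segment hci.symm hb ha rfl
    have := Below.of_segment (y := v a) (a := v b' - v a) (b := v a' - v a) (by simpa using hz)
    rw [add_sub_cancel, add_sub_cancel] at this
    have e1 : segment ℝ (v i) (v (next i)) = segment ℝ (v a) (v b') := by
      rcases hb with ⟨rfl, rfl⟩ | ⟨rfl, rfl⟩
      · rfl
      · rw [segment_symm]
    have e2 : segment ℝ (v c) (v (next c)) = segment ℝ (v a) (v a') := by
      rcases ha with ⟨rfl, rfl⟩ | ⟨rfl, rfl⟩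
      · rfl
      · rw [segment_symm]
    rwa [e1, e2]

lemma Below.of_disjoint_fst {x y a b : Space}
    (h : Disjoint (segment ℝ x.1 y.1) (segment ℝ a.1 b.1)) :
    Below (segment ℝ a b) (segment ℝ x y) :=
  Below.of_forall_ne (isCompact_segment _ _) (isCompact_segment _ _) fun _ hz _ hu he =>
    Set.disjoint_left.1 h (fst_mem_segment hu) (he ▸ fst_mem_segment hz)

lemma below_doubling [Finite ι] (D : IsDiagram n next v) (hC : IsCut next v C)
    (W : IsPushoff next v C w) {u : ι → Space} (hu : ∀ i, (u i).1 = w i) {R : Set ι}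
    (hR : R ⊆ C) {c : ι} (hc : c ∈ C) (hcR : c ∉ R) :
    Below (doubling next v C u R) (segment ℝ (v c) (v (next c))) := by
  have hcyc : ∀ i, (∃ c' ∈ R, next.SameCycle c' i) → ¬ next.SameCycle c i := by
    rintro i ⟨c', hc', hi⟩ h
    have := hC.eq_of_sameCycle c hc c' (hR hc') (h.trans hi.symm)
    exact hcR (this ▸ hc')
  refine Below.union (Below.union ?_ ?_) ?_
  · refine Below.iUnion fun i => Below.iUnion fun hi => Below.edge D hC hc ?_
    rintro rfl
    exact hi hc
  · refine Below.iUnion fun i => Below.iUnion fun hi => Below.of_disjoint_fst ?_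
    rw [hu, hu]
    exact W.cut_push c hc i hi.1 (hcyc i hi.2)
  · refine Below.iUnion fun b => Below.iUnion fun hb => Below.of_disjoint_fst ?_
    rw [hu]
    exact W.cut_cap c hc b hb.1 (hcyc b hb.2)

/-- The cut edges of index in `S`. -/
def cutEdges (next : Equiv.Perm ι) (v : ι → Space) (S : Set ι) : Set (Space × Space) :=
  (fun c => (v c, v (next c))) '' S

lemma edgeUnion_cutEdges (S : Set ι) :
    edgeUnion (cutEdges next v S) = ⋃ c ∈ S, segment ℝ (v c) (v (next c)) := by
  simp [edgeUnion, cutEdges]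

/-- A stage of the construction, in which the components through `R` have been doubled. -/
structure IsPartialDoubling (K : Link) (next : Equiv.Perm ι) (v : ι → Space) (C : Set ι)
    (w : ι → Plane) (B : ℝ) (R : Set ι) (u : ι → Space) : Prop where
  fst_eq : ∀ i, (u i).1 = w i
  add_eq : ∀ i, (∃ c ∈ R, next.SameCycle c i) → IsCrossingVertex v i →
    u (next i) + u (next.symm i) = (2 : ℝ) • u i
  lt : ∀ i, (∃ c ∈ R, next.SameCycle c i) → B < (u i).2
  injOn : Set.InjOn (fun i => (u i).2) {i | ∃ c ∈ R, next.SameCycle c i}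
  isLinkWith : IsLinkWith (doubling next v C u R) (cutEdges next v (C \ R))
  isotopic : ∃ L : Link, Isotopic K L ∧
    L.carrier = doubling next v C u R ∪ edgeUnion (cutEdges next v (C \ R))

lemma IsPartialDoubling.empty [Finite ι] {K : Link} (hv : IsPolygon next v) (B : ℝ)
    (hK : ∃ L : Link, Isotopic K L ∧ L.carrier = ⋃ i, segment ℝ (v i) (v (next i))) :
    IsPartialDoubling K next v C w B ∅ (fun i => (w i, 0)) := by
  have h : doubling next v C (fun i => (w i, 0)) ∅ =
      ⋃ i, ⋃ (_ : i ∉ C), segment ℝ (v i) (v (next i)) := by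
    simp [doubling]
  refine ⟨fun _ => rfl, by simp, by simp, by simp, ?_, ?_⟩
  · rw [h, Set.sdiff_empty]
    exact ⟨ι, inferInstance, next, v, C, hv, rfl, rfl⟩
  · obtain ⟨L, hL, hLc⟩ := hK
    refine ⟨L, hL, ?_⟩
    rw [hLc, h, Set.sdiff_empty, edgeUnion_cutEdges]
    ext z
    simp only [Set.mem_iUnion, Set.mem_union, exists_prop]
    constructor
    · rintro ⟨i, hi⟩
      by_cases hiC : i ∈ C
      · exact Or.inr ⟨i, hiC, hi⟩
      · exact Or.inl ⟨i, hiC, hi⟩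
    · rintro (⟨i, -, hi⟩ | ⟨i, -, hi⟩)
      · exact ⟨i, hi⟩
      · exact ⟨i, hi⟩

/-- The cut edge at `c` is replaced by an arc from `v c` to `v (next c)` that follows the copy
against the cyclic order. Components already doubled do not obstruct it, since their copies and
joining segments avoid the projection of this cut edge. -/
lemma IsPartialDoubling.extend [Finite ι] {K : Link} (D : IsDiagram n next v)
    (hC : IsCut next v C) (W : IsPushoff next v C w) {B : ℝ} {R : Set ι} (hR : R ⊆ C) {c : ι}
    (hc : c ∈ C) (hcR : c ∉ R) {u : ι → Space} (P : IsPartialDoubling K next v C w B R u) :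
    ∃ u', IsPartialDoubling K next v C w B (insert c R) u' := by
  classical
  -- the path along the component through `c`
  set a : ℕ → ι := fun k => next.symm^[k] c with ha
  set N := Function.minimalPeriod next.symm c with hN
  have ha0 : a 0 = c := rfl
  have has : ∀ k, a (k + 1) = next.symm (a k) := fun k => Function.iterate_succ_apply' _ _ _
  have has' : ∀ k, next (a (k + 1)) = a k := fun k => by rw [has]; simp
  have haN : a N = c := Function.iterate_minimalPeriod
  have hNpos : 0 < N := Function.minimalPeriod_pos_of_mem_periodicPts
    (next.symm.injective.mem_periodicPts c)
  have haN' : a (N - 1) = next c := by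
    rw [← haN, ← has' (N - 1), Nat.sub_add_cancel hNpos]
  have hainj : ∀ k < N, ∀ l < N, a k = a l → k = l := fun k hk l hl h =>
    Function.iterate_injOn_Iio_minimalPeriod hk hl h
  have hacyc : ∀ k, next.SameCycle c (a k) := iterate_symm_sameCycle c
  have haC : ∀ k, 0 < k → k < N → a k ∉ C := by
    intro k hk hkN h
    have := hC.eq_of_sameCycle c hc _ h (hacyc k)
    have := hainj 0 hNpos k hkN this
    omega
  have hcn : c ≠ next c := fun h => D.fst_ne c (by rw [← h])
  have hcapn : next c ∈ C ∨ next.symm (next c) ∈ C := Or.inr (by simpa using hc)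
  set F := cutEdges next v (C \ insert c R) with hF
  have hFeq : cutEdges next v (C \ R) = insert (v c, v (next c)) F := by
    have hCR : C \ R = insert c (C \ insert c R) := by
      ext i
      simp only [Set.mem_sdiff, Set.mem_insert_iff]
      by_cases hic : i = c
      · simp [hic, hc, hcR]
      · simp [hic]
    rw [hF, hCR, cutEdges, cutEdges, Set.image_insert_eq]
  have hFn : (v c, v (next c)) ∉ F := by
    rintro ⟨i, hi, he⟩
    have := D.isPolygon.injective (congrArg Prod.fst he)
    exact hi.2 (Or.inl this)
  have hext : IsExtensible K (doubling next v C u R) F (v c) (v (next c)) := by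
    obtain ⟨L, hL, hLc⟩ := P.isotopic
    refine ⟨hFeq ▸ P.isLinkWith, hFn, ⟨L, hL, ?_⟩, ?_⟩
    · rw [hLc, hFeq, edgeUnion_insert, Set.union_assoc, Set.union_comm (edgeUnion F)]
    · refine Below.union (Below.union (below_doubling D hC W P.fst_eq hR hc hcR) ?_)
        (Below.self (D.fst_ne c))
      rw [hF, edgeUnion_cutEdges]
      refine Below.iUnion fun i => Below.iUnion fun hi => Below.edge D hC hc ?_
      rintro rfl
      exact hi.2 (Or.inl rfl)
  -- The arc starts at `v c` itself, which shifts the copy by one: position `k + 1` is over `w (a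
  -- k)`, and position `N` is over `w (next c)`.
  set p : ℕ → Plane := fun k => Nat.casesOn k (v c).1 (fun k => w (a k)) with hp
  set cr : ℕ → Prop := fun k => Nat.casesOn k False (fun k => IsCrossingVertex v (a k)) with hcr
  -- Starting above all earlier copies keeps the heights of the copied vertices distinct across
  -- components.
  obtain ⟨B', hBB', hB'⟩ : ∃ B', B ≤ B' ∧ ∀ i, (u i).2 ≤ B' := by
    obtain ⟨M, hM⟩ := (Set.finite_range fun i => (u i).2).bddAbove
    exact ⟨max B M, le_max_left _ _, fun i => (hM ⟨i, rfl⟩).trans (le_max_right _ _)⟩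
  have hcrN : ¬ cr N := by
    have : cr N = IsCrossingVertex v (a (N - 1)) := by
      obtain ⟨m, hm⟩ := Nat.exists_eq_succ_of_ne_zero hNpos.ne'
      rw [hm]
      rfl
    rw [this, haN']
    exact hC.not_crossing_next c hc
  obtain ⟨q, hq0, hqp, hqm, hqB, hqi, hqe⟩ := hext.exists_path (D.fst_ne c) (p := p) rfl (cr := cr)
    id (B := B') N hcrN (by
      intro k hk hck
      have hck' : IsCrossingVertex v (a k) := hck
      rcases k with _ | k
      · exact absurd hck' (hC.not_crossing c hc)
      · have h1 := D.not_next _ hck'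
        rw [has'] at h1
        refine ⟨h1, ?_⟩
        have h2 := W.add_eq _ hck'
        rw [has', ← has] at h2
        exact h2) (by
      -- The arc may not pass over its goal `v (next c)`: the first edge is a joining segment
      -- disjoint from the one at `next c`, and the others meet the latter only in its far end.
      intro k hk
      have hmem := left_mem_segment ℝ (v (next c)).1 (w (next c))
      rcases k with _ | k
      · exact Set.disjoint_right.1 (W.cap_cap c (Or.inl hc) (next c) hcapn hcn) hmem
      · intro h
        have hi := haC (k + 1) (by omega) hk
        have h' : (v (next c)).1 ∈ segment ℝ (w (a (k + 1))) (w (next (a (k + 1)))) := by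
          rw [has', segment_symm]
          exact h
        have := (W.cap_push (next c) hcapn _ hi _ hmem h').1
        exact hC.not_crossing_next c hc (W.push_eq_vertex _ _ this.symm).1)
  choose! idx hidx using fun i (hi : next.SameCycle c i) => exists_iterate_symm_eq hi
  have hidxa : ∀ k < N, idx (a k) = k := fun k hk =>
    hainj _ (hidx _ (hacyc k)).1 k hk (hidx _ (hacyc k)).2
  set u' : ι → Space := fun i => if next.SameCycle c i then q (idx i + 1) else u i with hu'
  have hua : ∀ k < N, u' (a k) = q (k + 1) := fun k hk => by
    simp only [hu', if_pos (hacyc k), hidxa k hk]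
  have hun : ∀ i, ¬ next.SameCycle c i → u' i = u i := fun i hi => if_neg hi
  have hsucc : ∀ i, next.SameCycle c (next i) ↔ next.SameCycle c i := fun i =>
    Equiv.Perm.sameCycle_apply_right
  have hpred : ∀ i, next.SameCycle c (next.symm i) ↔ next.SameCycle c i := fun i =>
    Equiv.Perm.sameCycle_symm_apply_right
  have hcov : ∀ i, (∃ c' ∈ insert c R, next.SameCycle c' i) ↔
      next.SameCycle c i ∨ ∃ c' ∈ R, next.SameCycle c' i := fun i => by
    simp
  have hnot : ∀ i, (∃ c' ∈ R, next.SameCycle c' i) → ¬ next.SameCycle c i := by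
    rintro i ⟨c', hc', hi⟩ h
    have := hC.eq_of_sameCycle c hc c' (hR hc') (h.trans hi.symm)
    exact hcR (this ▸ hc')
  have hset : doubling next v C u' (insert c R) =
      (doubling next v C u R ∪ ⋃ k < N, segment ℝ (q k) (q (k + 1))) ∪
        segment ℝ (q N) (v (next c)) := by
    have hlast : u' (next c) = q N := by
      rw [← haN', hua _ (by omega), Nat.sub_add_cancel hNpos]
    have hstep : ∀ k, k + 1 < N →
        segment ℝ (u' (a (k + 1))) (u' (next (a (k + 1)))) = segment ℝ (q (k + 1)) (q (k + 2)) := by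
      intro k hk
      rw [has', hua _ hk, hua _ (by omega), segment_symm]
    ext z
    simp only [doubling, Set.mem_union, Set.mem_iUnion, exists_prop]
    constructor
    · rintro ((⟨i, hi, hz⟩ | ⟨i, ⟨hi, hic⟩, hz⟩) | ⟨b, ⟨hb, hbc⟩, hz⟩)
      · exact Or.inl (Or.inl (Or.inl (Or.inl ⟨i, hi, hz⟩)))
      · rcases (hcov i).1 hic with hic | hic
        · obtain ⟨k, hk, rfl⟩ := exists_iterate_symm_eq hic
          rcases k with _ | k
          · exact absurd hc hi
          · refine Or.inl (Or.inr ⟨k + 1, hk, ?_⟩)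
            rw [← hstep k hk]
            exact hz
        · have hi' := hnot i hic
          rw [hun i hi', hun _ (fun h => hi' ((hsucc i).1 h))] at hz
          exact Or.inl (Or.inl (Or.inl (Or.inr ⟨i, ⟨hi, hic⟩, hz⟩)))
      · rcases (hcov b).1 hbc with hbc | hbc
        · rcases hb with hb | hb
          · obtain rfl := hC.eq_of_sameCycle c hc b hb hbc
            refine Or.inl (Or.inr ⟨0, hNpos, ?_⟩)
            rwa [hq0, ← hua 0 hNpos]
          · have hcb := hC.eq_of_sameCycle c hc _ hb ((hpred b).2 hbc)
            obtain rfl : b = next c := by rw [hcb]; simp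
            refine Or.inr ?_
            rwa [hlast, segment_symm] at hz
        · rw [hun b (hnot b hbc)] at hz
          exact Or.inl (Or.inl (Or.inr ⟨b, ⟨hb, hbc⟩, hz⟩))
    · rintro ((((⟨i, hi, hz⟩ | ⟨i, ⟨hi, hic⟩, hz⟩) | ⟨b, ⟨hb, hbc⟩, hz⟩) | ⟨k, hk, hz⟩) | hz)
      · exact Or.inl (Or.inl ⟨i, hi, hz⟩)
      · have hi' := hnot i hic
        rw [← hun i hi', ← hun _ (fun h => hi' ((hsucc i).1 h))] at hz
        exact Or.inl (Or.inr ⟨i, ⟨hi, (hcov i).2 (Or.inr hic)⟩, hz⟩)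
      · rw [← hun b (hnot b hbc)] at hz
        exact Or.inr ⟨b, ⟨hb, (hcov b).2 (Or.inr hbc)⟩, hz⟩
      · rcases k with _ | k
        · refine Or.inr ⟨c, ⟨Or.inl hc, (hcov c).2 (Or.inl (hacyc 0))⟩, ?_⟩
          rwa [hq0, ← hua 0 hNpos] at hz
        · refine Or.inl (Or.inr ⟨a (k + 1), ⟨haC _ (by omega) hk,
            (hcov _).2 (Or.inl (hacyc _))⟩, ?_⟩)
          rwa [hstep k hk]
      · refine Or.inr ⟨next c, ⟨hcapn, (hcov _).2 (Or.inl ((hsucc c).2 (hacyc 0)))⟩, ?_⟩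
        rwa [hlast, segment_symm]
  refine ⟨u', ?_, ?_, ?_, ?_, ?_, ?_⟩
  · intro i
    by_cases hi : next.SameCycle c i
    · obtain ⟨k, hk, rfl⟩ := exists_iterate_symm_eq hi
      rw [hua k hk, hqp]
    · rw [hun i hi, P.fst_eq]
  · intro i hi hci
    rcases (hcov i).1 hi with hi | hi
    · obtain ⟨k, hk, rfl⟩ := exists_iterate_symm_eq hi
      have hk0 : k ≠ 0 := by
        rintro rfl
        exact hC.not_crossing c hc hci
      obtain ⟨k, rfl⟩ := Nat.exists_eq_succ_of_ne_zero hk0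
      have hkN : k + 2 < N := by
        rcases (by omega : k + 2 < N ∨ k + 1 = N - 1) with h | h
        · exact h
        · exfalso
          apply hC.not_crossing_next c hc
          rw [← haN', ← h]
          exact hci
      have := hqm (k + 1) (by omega) hci
      change u' (next (a (k + 1))) + u' (next.symm (a (k + 1))) = (2 : ℝ) • u' (a (k + 1))
      rw [has', ← has, hua k (by omega), hua _ hkN, hua _ hk]
      exact this
    · have hi' := hnot i hi
      rw [hun i hi', hun _ (fun h => hi' ((hsucc i).1 h)), hun _ (fun h => hi' ((hpred i).1 h))]
      exact P.add_eq i hi hci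
  · intro i hi
    rcases (hcov i).1 hi with hi | hi
    · obtain ⟨k, hk, rfl⟩ := exists_iterate_symm_eq hi
      rw [hua k hk]
      exact hBB'.trans_lt (hqB k hk)
    · rw [hun i (hnot i hi)]
      exact P.lt i hi
  · have hmono : ∀ k l, k < l → l ≤ N → (q k).2 < (q l).2 := by
      intro k l hkl hl
      induction l, hkl using Nat.le_induction with
      | base => exact hqi k hl
      | succ l _ ih => exact (ih (by omega)).trans (hqi l hl)
    intro i hi j hj hij
    simp only at hij
    rcases (hcov i).1 hi with hi | hi <;> rcases (hcov j).1 hj with hj | hj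
    · obtain ⟨k, hk, rfl⟩ := exists_iterate_symm_eq hi
      obtain ⟨l, hl, rfl⟩ := exists_iterate_symm_eq hj
      rw [hua k hk, hua l hl] at hij
      rcases lt_trichotomy k l with h | h | h
      · exact absurd hij (hmono _ _ (by omega) hl).ne
      · rw [h]
      · exact absurd hij (hmono _ _ (by omega) hk).ne'
    · obtain ⟨k, hk, rfl⟩ := exists_iterate_symm_eq hi
      rw [hua k hk, hun j (hnot j hj)] at hij
      exact absurd hij ((hB' j).trans_lt (hqB k hk)).ne'
    · obtain ⟨k, hk, rfl⟩ := exists_iterate_symm_eq hj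
      rw [hua k hk, hun i (hnot i hi)] at hij
      exact absurd hij ((hB' i).trans_lt (hqB k hk)).ne
    · rw [hun i (hnot i hi), hun j (hnot j hj)] at hij
      exact P.injOn hi hj hij
  · rw [hset]
    exact hqe.isLinkWith.finish hqe.notMem
  · obtain ⟨L, hL, hLc⟩ := hqe.isotopic
    refine ⟨L, hL, ?_⟩
    rw [hLc, hset, Set.union_right_comm]

/-- Each component of a polygonal link can be replaced by a path that follows it twice, the second
time in the opposite direction and above the rest of the link. -/
theorem IsDiagram.exists_isPartialDoubling [Finite ι] {K : Link} (D : IsDiagram n next v)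
    (hC : IsCut next v C) (W : IsPushoff next v C w) (B : ℝ)
    (hK : ∃ L : Link, Isotopic K L ∧ L.carrier = ⋃ i, segment ℝ (v i) (v (next i))) :
    ∃ u, IsPartialDoubling K next v C w B C u := by
  refine Set.Finite.induction_on_subset
    (motive := fun R _ => ∃ u, IsPartialDoubling K next v C w B R u) C C.toFinite
    ⟨_, .empty D.isPolygon B hK⟩ ?_
  rintro c R hc hR hcR ⟨u, P⟩
  exact P.extend D hC W hR hc hcR

end

/-! ### Recognising crossings from the combinatorics of edges. -/

lemma eventually_mem_segment_iff {a x b : Space} (h : a + b = (2 : ℝ) • x) (hab : a ≠ b) :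
    ∀ᶠ y in 𝓝 x, y ∈ segment ℝ a b ↔ ∃ t : ℝ, y = x + t • (b - x) := by
  obtain ⟨c, rfl⟩ : ∃ c, b = x + c := ⟨b - x, by abel⟩
  obtain rfl : a = x - c := by
    rw [two_smul] at h
    rw [eq_sub_iff_add_eq]
    exact add_left_cancel (a := x) (by rw [← h]; abel)
  have hc : c ≠ 0 := by
    rintro rfl
    simp at hab
  filter_upwards [Metric.ball_mem_nhds x (norm_pos_iff.2 hc)] with y hy
  rw [segment_eq_image']
  constructor
  · rintro ⟨s, -, rfl⟩
    exact ⟨2 * s - 1, by module⟩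
  · rintro ⟨t, rfl⟩
    rw [add_sub_cancel_left, Metric.mem_ball, dist_self_add_left, norm_smul, Real.norm_eq_abs,
      mul_lt_iff_lt_one_left (norm_pos_iff.2 hc), abs_lt] at hy
    exact ⟨(1 + t) / 2, ⟨by linarith, by linarith⟩, by module⟩

/-- A link with straight edges that meet in projection only in end points, and whose vertices with
the same projection lie on `m` straight strands, has only `m`-crossings. -/
lemma hasOnlyCrossings_of_edges {A : Type} [Finite A] {m : ℕ} {w : A → Space}
    {E : Set (A × A)} (hcov : ∀ a, ∃ e ∈ E, a = e.1 ∨ a = e.2)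
    (hne : ∀ e ∈ E, (w e.1).1 ≠ (w e.2).1)
    (hinter : ∀ e ∈ E, ∀ f ∈ E, e ≠ f → ∀ x ∈ segment ℝ (w e.1).1 (w e.2).1,
      x ∈ segment ℝ (w f.1).1 (w f.2).1 →
        ∃ a, (a = e.1 ∨ a = e.2) ∧ ∃ b, (b = f.1 ∨ b = f.2) ∧ (w a).1 = x ∧ (w b).1 = x)
    (hinj : Function.Injective w)
    (hstr : ∀ a, IsCrossingVertex w a → ∃ b c, (b, a) ∈ E ∧ (a, c) ∈ E ∧
      w c + w b = (2 : ℝ) • w a ∧ ∀ e ∈ E, (a = e.1 ∨ a = e.2) → e = (b, a) ∨ e = (a, c))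
    (hcard : ∀ a, IsCrossingVertex w a → {b | (w b).1 = (w a).1}.ncard = m)
    {L : Link} (hL : L.carrier = ⋃ e ∈ E, segment ℝ (w e.1) (w e.2)) :
    HasOnlyCrossings m L ∧
      ∀ p ∈ singularPoints L, ∃ a, IsCrossingVertex w a ∧ (w a).1 = p := by
  have hLmem : ∀ a, w a ∈ L.carrier := by
    intro a
    obtain ⟨e, he, ha⟩ := hcov a
    rw [hL]
    refine Set.mem_biUnion he ?_
    rcases ha with rfl | rfl
    · exact left_mem_segment ℝ _ _
    · exact right_mem_segment ℝ _ _
  -- a point of an edge is determined by its projection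
  have huniq : ∀ e ∈ E, ∀ z ∈ segment ℝ (w e.1) (w e.2), ∀ z' ∈ segment ℝ (w e.1) (w e.2),
      z.1 = z'.1 → z = z' := by
    intro e he z hz z' hz' h
    rw [segment_eq_image_lineMap] at hz hz'
    obtain ⟨s, -, rfl⟩ := hz
    obtain ⟨t, -, rfl⟩ := hz'
    have h' : AffineMap.lineMap (w e.1).1 (w e.2).1 s = AffineMap.lineMap (w e.1).1 (w e.2).1 t := by
      simpa [AffineMap.lineMap_apply_module] using h
    rw [lineMap_injective' (hne e he) h']
  have hend : ∀ e ∈ E, ∀ a, (a = e.1 ∨ a = e.2) → w a ∈ segment ℝ (w e.1) (w e.2) := by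
    rintro e - a (rfl | rfl)
    · exact left_mem_segment ℝ _ _
    · exact right_mem_segment ℝ _ _
  have hvert : ∀ p ∈ singularPoints L, ∃ a, IsCrossingVertex w a ∧ (w a).1 = p := by
    rintro p ⟨z, ⟨hz, hzp⟩, z', ⟨hz', hzp'⟩, hzz⟩
    rw [hL] at hz hz'
    simp only [Set.mem_iUnion, exists_prop] at hz hz'
    obtain ⟨e, he, hz⟩ := hz
    obtain ⟨f, hf, hz'⟩ := hz'
    have hef : e ≠ f := by
      rintro rfl
      exact hzz (huniq e he z hz z' hz' (hzp.trans hzp'.symm))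
    obtain ⟨a, ha, b, hb, hap, hbp⟩ := hinter e he f hf hef p (hzp ▸ fst_mem_segment hz)
      (hzp' ▸ fst_mem_segment hz')
    have e1 : z = w a := huniq e he z hz _ (hend e he a ha) (hzp.trans hap.symm)
    have e2 : z' = w b := huniq f hf z' hz' _ (hend f hf b hb) (hzp'.trans hbp.symm)
    refine ⟨a, ⟨b, ?_, hbp.trans hap.symm⟩, hap⟩
    rintro rfl
    exact hzz (e1.trans e2.symm)
  have hfiber : ∀ a, IsCrossingVertex w a →
      fiber L (w a).1 = w '' {b | (w b).1 = (w a).1} := by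
    intro a ha
    ext z
    constructor
    · rintro ⟨hz, hza⟩
      rw [hL] at hz
      simp only [Set.mem_iUnion, exists_prop] at hz
      obtain ⟨e, he, hz⟩ := hz
      obtain ⟨f, hf, haf⟩ := hcov a
      by_cases hef : e = f
      · subst hef
        exact ⟨a, rfl, (huniq e he z hz _ (hend e he a haf) hza).symm⟩
      · obtain ⟨b, hb, -, -, hbp, -⟩ := hinter e he f hf hef (w a).1 (hza ▸ fst_mem_segment hz)
          (fst_mem_segment (hend f hf a haf))
        exact ⟨b, hbp, (huniq e he z hz _ (hend e he b hb) (hza.trans hbp.symm)).symm⟩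
    · rintro ⟨b, hb, rfl⟩
      exact ⟨hLmem b, hb⟩
  refine ⟨⟨?_, ?_⟩, hvert⟩
  · refine (Set.finite_range fun a => (w a).1).subset ?_
    intro p hp
    obtain ⟨a, -, rfl⟩ := hvert p hp
    exact ⟨a, rfl⟩
  intro p hp
  obtain ⟨a, ha, rfl⟩ := hvert p hp
  have hall : ∀ b, (w b).1 = (w a).1 → IsCrossingVertex w b := fun b hb => ha.of_fst_eq hb.symm
  choose! bwd fwd hbwd hfwd hsum honly using hstr
  have hfb : ∀ b, IsCrossingVertex w b → w (fwd b) ≠ w (bwd b) := by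
    intro b hb h
    have := hne _ (hfwd b hb)
    apply this
    have h2 := hsum b hb
    rw [h, ← two_smul ℝ (w (bwd b))] at h2
    have h3 := smul_right_injective Space (two_ne_zero : (2 : ℝ) ≠ 0) h2
    simp only
    rw [h, ← h3]
  refine ⟨?_, ?_⟩
  · rw [hfiber a ha, hinj.encard_image, ← hcard a ha, Set.Finite.cast_ncard_eq (Set.toFinite _)]
  · have : Nonempty A := ⟨a⟩
    have hdir : ∃ d : Space → Space, ∀ b, d (w b) = w (fwd b) - w b :=
      ⟨fun z => w (fwd (Function.invFun w z)) - w (Function.invFun w z), fun b => by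
        simp only [Function.leftInverse_invFun hinj b]⟩
    obtain ⟨d, hd⟩ := hdir
    refine ⟨d, ?_, ?_⟩
    · rw [hfiber a ha]
      rintro _ ⟨b, hb, rfl⟩
      have hbcr := hall b hb
      rw [IsStrand, hd]
      -- The edges that do not end at `b` form a closed set missing `w b`, so near `w b` the link
      -- consists of the two edges there.
      have hclosed : IsClosed (⋃ e ∈ {e ∈ E | ¬ (b = e.1 ∨ b = e.2)},
          segment ℝ (w e.1) (w e.2)) :=
        (Set.toFinite _).isClosed_biUnion fun e _ => (isCompact_segment _ _).isClosed
      have hnot : w b ∉ ⋃ e ∈ {e ∈ E | ¬ (b = e.1 ∨ b = e.2)}, segment ℝ (w e.1) (w e.2) := by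
        simp only [Set.mem_iUnion, exists_prop, not_exists, not_and]
        rintro e ⟨he, hbe⟩ hmem
        have hef : e ≠ (b, fwd b) := by
          rintro rfl
          exact hbe (Or.inl rfl)
        obtain ⟨c, hc, -, -, hcp, -⟩ := hinter e he _ (hfwd b hbcr) hef (w b).1
          (fst_mem_segment hmem) (left_mem_segment ℝ _ _)
        have := huniq e he _ hmem _ (hend e he c hc) hcp.symm
        exact hbe (hinj this ▸ hc)
      have hmid : w (bwd b) + w (fwd b) = (2 : ℝ) • w b := by
        rw [add_comm, hsum b hbcr]
      filter_upwards [hclosed.isOpen_compl.mem_nhds hnot,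
        eventually_mem_segment_iff hmid (hfb b hbcr).symm] with y hy hy'
      rw [← hy', ← segment_union_midpoint hmid, hL]
      simp only [Set.mem_iUnion, exists_prop, Set.mem_union]
      constructor
      · rintro ⟨e, he, hye⟩
        by_cases hbe : b = e.1 ∨ b = e.2
        · rcases honly b hbcr e he hbe with rfl | rfl
          · exact Or.inl hye
          · exact Or.inr hye
        · refine absurd ?_ hy
          simp only [Set.mem_iUnion, exists_prop]
          exact ⟨e, ⟨he, hbe⟩, hye⟩
      · rintro (h | h)
        · exact ⟨_, hbwd b hbcr, h⟩
        · exact ⟨_, hfwd b hbcr, h⟩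
    · rw [hfiber a ha]
      rintro _ ⟨b, hb, rfl⟩ _ ⟨c, hc, rfl⟩ hbc
      rw [hd, hd]
      have hbcr := hall b hb
      have hccr := hall c hc
      have hbc' : b ≠ c := fun h => hbc (h ▸ rfl)
      have hbc1 : (w c).1 = (w b).1 := hc.trans hb.symm
      have hu : (w (fwd b)).1 - (w b).1 ≠ 0 := sub_ne_zero.2 (hne _ (hfwd b hbcr)).symm
      have hu' : (w (fwd c)).1 - (w c).1 ≠ 0 := sub_ne_zero.2 (hne _ (hfwd c hccr)).symm
      -- edges at the same crossing do not have the same direction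
      have key : ∀ e ∈ E, e ≠ (b, fwd b) → ∀ μ : ℝ, 0 < μ →
          segment ℝ (w e.1).1 (w e.2).1 =
            segment ℝ (w b).1 ((w b).1 + μ • ((w (fwd b)).1 - (w b).1)) → False := by
        intro e he heb μ hμ hseg
        set s := min (1 / 2) (μ / 2) with hs
        have hs0 : 0 < s := lt_min (by norm_num) (by linarith)
        have hs1 : s ≤ 1 / 2 := min_le_left _ _
        have hs2 : s ≤ μ / 2 := min_le_right _ _
        have m1 : (w b).1 + s • ((w (fwd b)).1 - (w b).1) ∈
            segment ℝ (w b).1 (w (fwd b)).1 := by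
          rw [segment_eq_image']
          exact ⟨s, ⟨hs0.le, by linarith⟩, rfl⟩
        have m2 : (w b).1 + s • ((w (fwd b)).1 - (w b).1) ∈
            segment ℝ (w e.1).1 (w e.2).1 := by
          rw [hseg, segment_eq_image']
          refine ⟨s / μ, ⟨by positivity, ?_⟩, ?_⟩
          · rw [div_le_one hμ]; linarith
          · simp only [add_sub_cancel_left, smul_smul, div_mul_cancel₀ _ hμ.ne']
        obtain ⟨a', ha', -, -, hx, -⟩ := hinter _ (hfwd b hbcr) e he heb.symm _ m1 m2
        simp only at ha'
        rcases ha' with rfl | rfl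
        · exact smul_ne_zero hs0.ne' hu (by simpa using hx.symm)
        · have : (1 - s) • ((w (fwd b)).1 - (w b).1) = 0 := by
            rw [sub_smul, one_smul, sub_eq_zero]
            nth_rewrite 1 [hx]
            simp
          rcases smul_eq_zero.1 this with h | h
          · linarith
          · exact hu h
      rw [LinearIndependent.pair_iff]
      intro s t hst
      simp only [Prod.fst_sub] at hst
      by_contra hnot
      have hs0 : s ≠ 0 := by
        rintro rfl
        rw [zero_smul, zero_add] at hst
        exact hnot ⟨rfl, (smul_eq_zero.1 hst).resolve_right hu'⟩
      have ht0 : t ≠ 0 := by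
        rintro rfl
        rw [zero_smul, add_zero] at hst
        exact hnot ⟨(smul_eq_zero.1 hst).resolve_right hu, rfl⟩
      have hdirc : (w (fwd c)).1 - (w c).1 = (-(s / t)) • ((w (fwd b)).1 - (w b).1) := by
        refine smul_right_injective Plane ht0 ?_
        simp only
        rw [smul_smul, mul_neg, mul_div_cancel₀ _ ht0, neg_smul]
        exact eq_neg_of_add_eq_zero_right hst
      -- Parallel strands would give either the forward or the backward edge at `c` the direction of
      -- the forward edge at `b`.
      rcases lt_or_gt_of_ne (div_ne_zero hs0 ht0) with h | h
      · refine key _ (hfwd c hccr) (fun he => hbc' (congrArg Prod.fst he).symm) (-(s / t))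
          (by linarith) ?_
        rw [← hdirc, hbc1]
        simp
      · refine key _ (hbwd c hccr) (fun he => ?_) (s / t) h ?_
        · have h1 : bwd c = b := congrArg Prod.fst he
          exact hne _ (hbwd c hccr) (by simp only [h1, hbc1])
        · have h2 := congrArg Prod.fst (hsum c hccr)
          simp only [Prod.fst_add, two_smul] at h2
          have h3 : (w (bwd c)).1 - (w c).1 = -((w (fwd c)).1 - (w c).1) := by
            rw [neg_sub, sub_eq_sub_iff_add_eq_add, ← h2, add_comm]
          rw [hdirc, ← neg_smul, neg_neg, hbc1] at h3
          rw [← h3, segment_symm, hbc1]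
          simp

/-! ### Crossings of the doubled link. -/

section

variable {ι : Type} {next : Equiv.Perm ι} {v : ι → Space} {n : ℕ} {C : Set ι} {w : ι → Plane}

/-- The edges of the doubled link: edges, parallel edges, and short segments joining them. -/
def doubledEdges (next : Equiv.Perm ι) (C : Set ι) : Set ((ι ⊕ ι) × (ι ⊕ ι)) :=
  {e | (∃ i ∉ C, e = (Sum.inl i, Sum.inl (next i))) ∨ (∃ i ∉ C, e = (Sum.inr i, Sum.inr (next i))) ∨
    ∃ b, (b ∈ C ∨ next.symm b ∈ C) ∧ e = (Sum.inl b, Sum.inr b)}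

lemma iUnion_doubledEdges (hC : IsCut next v C) (u : ι → Space) :
    (⋃ e ∈ doubledEdges next C, segment ℝ (Sum.elim v u e.1) (Sum.elim v u e.2)) =
      doubling next v C u C := by
  have hcov : ∀ i, ∃ c ∈ C, next.SameCycle c i := fun i => by
    obtain ⟨c, hc, h⟩ := hC.exists_sameCycle i
    exact ⟨c, hc, h.symm⟩
  ext z
  simp only [doubling, doubledEdges, Set.mem_iUnion, Set.mem_union, exists_prop, hcov, and_true,
    Set.mem_ofPred_eq]
  constructor
  · rintro ⟨e, ⟨i, hi, rfl⟩ | ⟨i, hi, rfl⟩ | ⟨b, hb, rfl⟩, h⟩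
    · exact Or.inl (Or.inl ⟨i, hi, h⟩)
    · exact Or.inl (Or.inr ⟨i, hi, h⟩)
    · exact Or.inr ⟨b, hb, h⟩
  · rintro ((⟨i, hi, h⟩ | ⟨i, hi, h⟩) | ⟨b, hb, h⟩)
    · exact ⟨_, Or.inl ⟨i, hi, rfl⟩, h⟩
    · exact ⟨_, Or.inr (Or.inl ⟨i, hi, rfl⟩), h⟩
    · exact ⟨_, Or.inr (Or.inr ⟨b, hb, rfl⟩), h⟩

lemma IsPushoff.isCrossingVertex_elim (W : IsPushoff next v C w)
    {u : ι → Space} (hu : ∀ i, (u i).1 = w i) {i : ι} :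
    (IsCrossingVertex (Sum.elim v u) (Sum.inl i) → IsCrossingVertex v i) ∧
      (IsCrossingVertex (Sum.elim v u) (Sum.inr i) → IsCrossingVertex v i) := by
  constructor
  · rintro ⟨j | j, hj, h⟩
    · exact ⟨j, fun hji => hj (by rw [hji]), h⟩
    · simp only [Sum.elim_inl, Sum.elim_inr, hu] at h
      exact (W.push_eq_vertex _ _ h).2
  · rintro ⟨j | j, hj, h⟩
    · simp only [Sum.elim_inl, Sum.elim_inr, hu] at h
      exact (W.push_eq_vertex _ _ h.symm).1
    · simp only [Sum.elim_inr, hu] at h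
      exact (W.push_injective _ _ h fun hji => hj (by rw [hji])).2

/-- Copies of crossing vertices keep their projection, and no other copied vertex is over an old
vertex; so each strand contributes exactly two points. -/
lemma ncard_doubled [Finite ι] (D : IsDiagram n next v) (W : IsPushoff next v C w)
    {u : ι → Space} (hu : ∀ i, (u i).1 = w i) {i : ι} (hi : IsCrossingVertex v i) :
    {b | (Sum.elim v u b).1 = (v i).1}.ncard = 2 * n := by
  have hset : {b | (Sum.elim v u b).1 = (v i).1} =
      Sum.inl '' {j | (v j).1 = (v i).1} ∪ Sum.inr '' {j | (v j).1 = (v i).1} := by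
    ext (j | j)
    · simp
    · simp only [Set.mem_ofPred_eq, Sum.elim_inr, hu, Set.mem_union, Set.mem_image, reduceCtorEq,
        and_false, exists_false, Sum.inr.injEq, exists_eq_right, false_or]
      constructor
      · intro h
        rw [← W.eq_of_crossing j (W.push_eq_vertex _ _ h).1, h]
      · intro h
        rw [W.eq_of_crossing j (hi.of_fst_eq h.symm), h]
  rw [hset, Set.ncard_union_eq ?_ (Set.toFinite _) (Set.toFinite _),
    Set.ncard_image_of_injective _ Sum.inl_injective,
    Set.ncard_image_of_injective _ Sum.inr_injective, D.ncard i hi, two_mul]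
  rw [Set.disjoint_left]
  rintro _ ⟨j, -, rfl⟩ ⟨k, -, h⟩
  simp at h

/-- The push-off properties cover all pairs of edge types in projection. Heights separate the
vertices in space: copies are above `B`, originals are not, and copies have distinct heights. -/
lemma IsPartialDoubling.hasOnlyCrossings [Finite ι] {K : Link} (D : IsDiagram n next v)
    (hC : IsCut next v C) (W : IsPushoff next v C w) {B : ℝ} (hB : ∀ i, (v i).2 ≤ B)
    {u : ι → Space} (P : IsPartialDoubling K next v C w B C u) {L : Link}
    (hL : L.carrier = doubling next v C u C) :
    HasOnlyCrossings (2 * n) L ∧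
      ∀ p ∈ singularPoints L, ∃ i, IsCrossingVertex v i ∧ (v i).1 = p := by
  have hu := P.fst_eq
  have hcov : ∀ i, ∃ c ∈ C, next.SameCycle c i := fun i => by
    obtain ⟨c, hc, h⟩ := hC.exists_sameCycle i
    exact ⟨c, hc, h.symm⟩
  have hnC : ∀ i, IsCrossingVertex v i → i ∉ C := fun i hi h => hC.not_crossing i h hi
  have hpC : ∀ i, IsCrossingVertex v i → next.symm i ∉ C := fun i hi h =>
    hC.not_crossing_next _ h (by simpa using hi)
  have hcap : ∀ i, IsCrossingVertex v i → ¬ (i ∈ C ∨ next.symm i ∈ C) := fun i hi h =>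
    h.elim (hnC i hi) (hpC i hi)
  have hw : ∀ i, w i ≠ w (next i) := by
    intro i h
    have := W.push_injective _ _ h (fun h => D.fst_ne i (by rw [← h]))
    exact D.not_next i this.1 this.2
  have hcr : ∀ b, IsCrossingVertex (Sum.elim v u) b →
      IsCrossingVertex v (b.elim id id) := by
    rintro (i | i) hi
    · exact (W.isCrossingVertex_elim hu).1 hi
    · exact (W.isCrossingVertex_elim hu).2 hi
  have hVcr : ∀ b, IsCrossingVertex (Sum.elim v u) b →
      (Sum.elim v u b).1 = (v (b.elim id id)).1 := by
    rintro (i | i) hi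
    · rfl
    · have := hcr _ hi
      simp only [Sum.elim_inr, hu]
      exact W.eq_of_crossing i this
  have edge_cap : ∀ b, (b ∈ C ∨ next.symm b ∈ C) → ∀ i ∉ C, ∀ x ∈ segment ℝ (v b).1 (w b),
      x ∈ segment ℝ (v i).1 (v (next i)).1 → ∃ a : ι ⊕ ι, (a = Sum.inl b ∨ a = Sum.inr b) ∧
        ∃ c : ι ⊕ ι, (c = Sum.inl i ∨ c = Sum.inl (next i)) ∧ (Sum.elim v u a).1 = x ∧
          (Sum.elim v u c).1 = x := by
    intro b hb i hi x h1 h2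
    obtain ⟨rfl, hbi⟩ := W.cap_edge b hb i hi x h1 h2
    exact ⟨Sum.inl b, Or.inl rfl, Sum.inl b, by simpa using hbi, rfl, rfl⟩
  have push_cap : ∀ b, (b ∈ C ∨ next.symm b ∈ C) → ∀ i ∉ C, ∀ x ∈ segment ℝ (v b).1 (w b),
      x ∈ segment ℝ (w i) (w (next i)) → ∃ a : ι ⊕ ι, (a = Sum.inl b ∨ a = Sum.inr b) ∧
        ∃ c : ι ⊕ ι, (c = Sum.inr i ∨ c = Sum.inr (next i)) ∧ (Sum.elim v u a).1 = x ∧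
          (Sum.elim v u c).1 = x := by
    intro b hb i hi x h1 h2
    obtain ⟨rfl, hbi⟩ := W.cap_push b hb i hi x h1 h2
    exact ⟨Sum.inr b, Or.inr rfl, Sum.inr b, by simpa using hbi, hu b, hu b⟩
  have edge_push : ∀ i ∉ C, ∀ j ∉ C, ∀ x ∈ segment ℝ (v i).1 (v (next i)).1,
      x ∈ segment ℝ (w j) (w (next j)) →
      ∃ a : ι ⊕ ι, (a = Sum.inl i ∨ a = Sum.inl (next i)) ∧
        ∃ c : ι ⊕ ι, (c = Sum.inr j ∨ c = Sum.inr (next j)) ∧ (Sum.elim v u a).1 = x ∧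
          (Sum.elim v u c).1 = x := by
    intro i hi j hj x h1 h2
    obtain ⟨a, ha, b, hb, hax, hbx⟩ := W.edge_push i hi j hj x h1 h2
    exact ⟨Sum.inl a, by simpa using ha, Sum.inr b, by simpa using hb, hax, (hu b).trans hbx⟩
  have swap : ∀ {e f : (ι ⊕ ι) × (ι ⊕ ι)} {x : Plane},
      (∃ a, (a = e.1 ∨ a = e.2) ∧ ∃ b, (b = f.1 ∨ b = f.2) ∧ (Sum.elim v u a).1 = x ∧
        (Sum.elim v u b).1 = x) →
      ∃ a, (a = f.1 ∨ a = f.2) ∧ ∃ b, (b = e.1 ∨ b = e.2) ∧ (Sum.elim v u a).1 = x ∧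
        (Sum.elim v u b).1 = x := by
    rintro e f x ⟨a, ha, b, hb, h1, h2⟩
    exact ⟨b, hb, a, ha, h2, h1⟩
  suffices h : HasOnlyCrossings (2 * n) L ∧
      ∀ p ∈ singularPoints L, ∃ a, IsCrossingVertex (Sum.elim v u) a ∧ (Sum.elim v u a).1 = p by
    refine ⟨h.1, fun p hp => ?_⟩
    obtain ⟨b, hb, rfl⟩ := h.2 p hp
    exact ⟨_, hcr b hb, (hVcr b hb).symm⟩
  refine hasOnlyCrossings_of_edges (E := doubledEdges next C) ?_ ?_ ?_ ?_ ?_ ?_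
    (hL.trans (iUnion_doubledEdges hC u).symm)
  · rintro (i | i)
    · by_cases hi : i ∈ C
      · exact ⟨_, Or.inr (Or.inr ⟨i, Or.inl hi, rfl⟩), Or.inl rfl⟩
      · exact ⟨_, Or.inl ⟨i, hi, rfl⟩, Or.inl rfl⟩
    · by_cases hi : i ∈ C
      · exact ⟨_, Or.inr (Or.inr ⟨i, Or.inl hi, rfl⟩), Or.inr rfl⟩
      · exact ⟨_, Or.inr (Or.inl ⟨i, hi, rfl⟩), Or.inl rfl⟩
  · rintro e (⟨i, hi, rfl⟩ | ⟨i, hi, rfl⟩ | ⟨b, hb, rfl⟩)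
    · exact D.fst_ne i
    · simp only [Sum.elim_inr, hu]
      exact hw i
    · simp only [Sum.elim_inl, Sum.elim_inr, hu]
      exact fun h => hcap b (W.push_eq_vertex _ _ h.symm).1 hb
  · rintro e he f hf hef x hx hx'
    rcases he with ⟨i, hi, rfl⟩ | ⟨i, hi, rfl⟩ | ⟨b, hb, rfl⟩ <;>
    rcases hf with ⟨j, hj, rfl⟩ | ⟨j, hj, rfl⟩ | ⟨b', hb', rfl⟩ <;>
    simp only [Sum.elim_inl, Sum.elim_inr, hu] at hx hx'
    · obtain ⟨a, ha, b, hb, h1, h2⟩ := D.inter i j (fun h => hef (by rw [h])) x hx hx'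
      exact ⟨Sum.inl a, by simpa using ha, Sum.inl b, by simpa using hb, h1, h2⟩
    · exact edge_push i hi j hj x hx hx'
    · exact swap (edge_cap b' hb' i hi x hx' hx)
    · exact swap (edge_push j hj i hi x hx' hx)
    · obtain ⟨a, ha, b, hb, h1, h2⟩ := W.push_push i hi j hj (fun h => hef (by rw [h])) x hx hx'
      exact ⟨Sum.inr a, by simpa using ha, Sum.inr b, by simpa using hb, (hu a).trans h1,
        (hu b).trans h2⟩
    · exact swap (push_cap b' hb' i hi x hx' hx)
    · exact edge_cap b hb j hj x hx hx'
    · exact push_cap b hb j hj x hx hx'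
    · exact absurd hx' (Set.disjoint_left.1 (W.cap_cap b hb b' hb' (fun h => hef (by rw [h]))) hx)
  · rintro (i | i) (j | j) h
    · exact congrArg _ (D.isPolygon.injective h)
    · exact absurd (congrArg Prod.snd h) ((hB i).trans_lt (P.lt j (hcov j))).ne
    · exact absurd (congrArg Prod.snd h) ((hB j).trans_lt (P.lt i (hcov i))).ne'
    · exact congrArg _ (P.injOn (hcov i) (hcov j) (congrArg Prod.snd h))
  · rintro (i | i) hi
    · have hi' := hcr _ hi
      simp only [Sum.elim_inl, id_eq] at hi'
      refine ⟨Sum.inl (next.symm i), Sum.inl (next i), Or.inl ⟨_, hpC i hi', by simp⟩,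
        Or.inl ⟨i, hnC i hi', rfl⟩, D.add_eq i hi', ?_⟩
      rintro e (⟨j, hj, rfl⟩ | ⟨j, hj, rfl⟩ | ⟨b, hb, rfl⟩) h
      · simp only [Sum.inl.injEq] at h
        rcases h with rfl | rfl
        · exact Or.inr rfl
        · exact Or.inl (by simp)
      · simp at h
      · simp only [Sum.inl.injEq, reduceCtorEq, or_false] at h
        exact absurd (h ▸ hb) (hcap i hi')
    · have hi' := hcr _ hi
      simp only [Sum.elim_inr, id_eq] at hi'
      refine ⟨Sum.inr (next.symm i), Sum.inr (next i), Or.inr (Or.inl ⟨_, hpC i hi', by simp⟩),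
        Or.inr (Or.inl ⟨i, hnC i hi', rfl⟩), P.add_eq i (hcov i) hi', ?_⟩
      rintro e (⟨j, hj, rfl⟩ | ⟨j, hj, rfl⟩ | ⟨b, hb, rfl⟩) h
      · simp at h
      · simp only [Sum.inr.injEq] at h
        rcases h with rfl | rfl
        · exact Or.inr rfl
        · exact Or.inl (by simp)
      · simp only [Sum.inr.injEq, reduceCtorEq, false_or] at h
        exact absurd (h ▸ hb) (hcap i hi')
  · intro b hb
    rw [hVcr b hb]
    exact ncard_doubled D W hu (hcr b hb)

end

/-! ### The doubled link and the inequality. -/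

/-- A link with only `n`-crossings is isotopic to a link with only `2n`-crossings, at the same points
of the plane. -/
theorem exists_isotopic_hasOnlyCrossings {n : ℕ} {L : Link}
    (hL : HasOnlyCrossings n L) :
    ∃ L' : Link, Isotopic L L' ∧ HasOnlyCrossings (2 * n) L' ∧
      singularPoints L' ⊆ singularPoints L := by
  obtain ⟨ι, _, next, v, D, hLv, hs⟩ := exists_isDiagram hL
  obtain ⟨C, hC⟩ := D.exists_isCut
  obtain ⟨w, W⟩ := D.exists_isPushoff hC
  obtain ⟨B, hB⟩ := (Set.finite_range fun i => (v i).2).bddAbove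
  obtain ⟨u, P⟩ := D.exists_isPartialDoubling hC W B ⟨L, Relation.EqvGen.refl L, hLv⟩
  obtain ⟨L', hLL', hL'⟩ := P.isotopic
  rw [Set.sdiff_self, edgeUnion_cutEdges, Set.biUnion_empty, Set.union_empty] at hL'
  obtain ⟨h1, h2⟩ := P.hasOnlyCrossings D hC W (fun i => hB ⟨i, rfl⟩) hL'
  refine ⟨L', hLL', h1, fun p hp => ?_⟩
  obtain ⟨i, hi, rfl⟩ := h2 p hp
  exact hs i hi

end Multicrossing

theorem lemma5p1 (n : ℕ) (hn : 2 ≤ n) (K : Multicrossing.Link) :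
    Multicrossing.crossingNumber n K ≥ Multicrossing.crossingNumber (2 * n) K := by
  refine le_iInf fun L => le_iInf fun hKL => le_iInf fun hL => ?_
  obtain ⟨L', hLL', hL', hsub⟩ := Multicrossing.exists_isotopic_hasOnlyCrossings hL
  exact (iInf_le_of_le L' (iInf_le_of_le (Relation.EqvGen.trans _ _ _ hKL hLL')
    (iInf_le_of_le hL' le_rfl))).trans (Set.encard_le_encard hsub)
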